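/- **Setting.** Let $\mathcal S$ be a measurable space of states and $\mathcal A$ a finite set of $A$ actions. Consider a discounted infinite-horizon MDP with transition kernel $P$, reward $r(s,a)\in[0,1]$, discount factor $\gamma\in(0,1)$ and reset distribution $\mu_0$ on $\mathcal S\times\mathcal A$: $(s_0,a_0)\sim\mu_0$, $s_{h+1}\sim P(s_h,a_h)$, $a_{h+1}\sim\pi(s_{h+1})$. For a stationary policy $\pi$ let $Q^\pi(s,a)$ be the expected discounted sum of rewards from $(s,a)$, $V^\pi=\mathbb E_{\mu_0}[Q^\pi(s_0,a_0)]$, $d^\pi=(1-\gamma)\sum_{h\ge 0}\gamma^h\,\mathrm{Law}(s_h,a_h)$, $f(s,\pi(s))=\mathbb E_{a\sim\pi(s)}f(s,a)$ and $\mathcal T^\pi f(s,a)=r(s,a)+\gamma\,\mathbb E_{s'\sim P(s,a)}[f(s',\pi(s'))]$. Let $\nu$ be an offline distribution on $\mathcal S\times\mathcal A$, and $\mathcal F$ a finite class of measurable functions $f:\mathcal S\times\mathcal A\to\mathbb R$ with $|f|\le 1/(1-\gamma)$. **Algorithm HPE$(\pi)$** (parameters $K_1<K_2$, $m_{\rm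 on},m_{\rm off}$, $\lambda$). Start with any $f_0\in\mathcal F$. For $k=1,\dots,K_2$ draw fresh datasets: $\mathcal D_{\rm off}$ of $m_{\rm off}$ i.i.d. samples $(s,a)\sim\nu$, $s'\sim P(s,a)$, $r=r(s,a)$, and $\mathcal D_{\rm on}$ of $m_{\rm on}$ i.i.d. samples $(s,a,y)$ with $(s,a)\sim d^\pi$ and $y$ the undiscounted sum of the rewards of a rollout of $\pi$ from $(s,a)$ that stops after each step independently with probability $1-\gamma$; let $$f_k\in\arg\min_{f\in\mathcal F}\ \widehat{\mathbb E}_{\mathcal D_{\rm off}}\big[(f(s,a)-r-\gamma f_{k-1}(s',\pi(s')))^2\big]+\lambda\,\widehat{\mathbb E}_{\mathcal D_{\rm on}}\big[(f(s,a)-y)^2\big]$$ (ties broken arbitrarily). Return $\bar f=\frac1{K_2-K_1}\sum_{k=K_1+1}^{K_2}f_k$. **Algorithm HAC** ($T\ge1$ rounds). $\pi^1$ is uniform. In round $t=1,\dots,T$ let $f^t$ be the output of HPE$(\pi^t)$ and set $\pi^{t+1}(a\mid s)\propto\pi^t(a\mid s)\exp(\eta f^t(s,a))$ with $\eta=(1-\gamma)\sqrt{\log(A)/T}$.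 **Coefficients.** - $\mathcal F$ has point-wise inherent Bellman error $\varepsilon_{\rm be}$ if for all $f\in\mathcal F$ and all policies $\pi$ there is $f'\in\mathcal F$ with $\|f'-\mathcal T^\pi f\|_\infty\le\varepsilon_{\rm be}$. - $C_{{\rm npg},\pi^e}\in[0,\infty]$ is the least $C$ with $\|d^{\pi^e}/d^\pi\|_\infty\le C$ for all policies $\pi$. - The Bellman error transfer coefficient is $$C_{{\rm off},\pi^e}=\max\Big\{0,\ \sup_{\pi}\ \sup_{f,f'\in\mathcal F}\frac{\mathbb E_{d^{\pi^e}}[\mathcal T^\pi f'-f]}{\sqrt{\mathbb E_\nu[(\mathcal T^\pi f'-f)^2]}}\Big\}\in[0,\infty],$$ where $x/0=\infty$ for $x>0$, and quotients with $x\le0$ over $0$ are ignored. **Theorem (Cumulative suboptimality).** There is a universal constant $c>0$ such that the following holds. Let $\delta\in(0,1)$, and run HAC with $K_1=4\lceil\log(1/\gamma)\rceil$, $K_2=K_1+T$ and $m_{\rm off}=m_{\rm on}=\big\lceil 2T\log(2|\mathcal F|/\delta)/(1-\gamma)^2\big\rceil$. Let $\Pi$ be any set of policies that contains all policies $\pi^1,\dots,\pi^T$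 that this run of HAC can generate (for instance, the set of all policies), and suppose that for every $\pi\in\Pi$ there is $f\in\mathcal F$ with $\mathbb E_{d^\pi}[(f-Q^\pi)^2]=0$ (realizability). 1. *(Approximate Bellman completeness.)* If $\mathcal F$ has point-wise inherent Bellman error $\varepsilon_{\rm be}\le 1/T$ and $\lambda=1$, then with probability at least $1-\delta$, simultaneously for all comparator policies $\pi^e$, $$\sum_{t=1}^T\big(V^{\pi^e}-V^{\pi^t}\big)\le c\left(\frac{1}{(1-\gamma)^2}\sqrt{\log(A)\,T}+\frac1{(1-\gamma)^2}\sqrt{\min\{C_{{\rm npg},\pi^e},\,C_{{\rm off},\pi^e}^2\}\,T}\right).$$ 2. *(Without Bellman completeness.)* If $\lambda=T/2-1$, then, whatever the inherent Bellman error is, with probability at least $1-\delta$, simultaneously for all comparator policies $\pi^e$, $$\sum_{t=1}^T\big(V^{\pi^e}-V^{\pi^t}\big)\le c\left(\frac{1}{(1-\gamma)^2}\sqrt{\log(A)\,T}+\frac1{(1-\gamma)^2}\sqrt{C_{{\rm npg},\pi^e}\,T}\right).$$ -/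

import Mathlib

open MeasureTheory ProbabilityTheory
open scoped ENNReal

namespace HybridRL

noncomputable section

universe u v w

/-- A stationary (randomized) policy: a measurable map from states to distributions on actions. -/
structure Policy (S : Type u) (A : Type v) [MeasurableSpace S] [MeasurableSpace A] where
  kernel : Kernel S A
  markov : IsMarkovKernel kernel

attribute [instance] Policy.markov

/-- A discounted infinite-horizon MDP with rewards in `[0, 1]`. Episodes start from a
state-action pair drawn from the reset distribution `reset`. -/
structure MDP (S : Type u) (A : Type v) [MeasurableSpace S] [MeasurableSpace A] where
  transition : Kernel (S × A) S
  markov : IsMarkovKernel transition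
  reward : S × A → ℝ
  measurable_reward : Measurable reward
  reward_nonneg : ∀ x, 0 ≤ reward x
  reward_le_one : ∀ x, reward x ≤ 1
  reset : Measure (S × A)
  reset_prob : IsProbabilityMeasure reset
  γ : ℝ
  γ_pos : 0 < γ
  γ_lt_one : γ < 1

attribute [instance] MDP.markov MDP.reset_prob

variable {S : Type u} {A : Type v} [MeasurableSpace S] [MeasurableSpace A]

/-- The probability `π(a | s)`. -/
def Policy.prob (π : Policy S A) (s : S) (a : A) : ℝ := (π.kernel s).real {a}

/-- `f(s, π(s)) = ∑ₐ π(a | s) f(s, a)`. -/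
def Policy.avg [Fintype A] (π : Policy S A) (f : S × A → ℝ) (s : S) : ℝ :=
  ∑ a, π.prob s a * f (s, a)

namespace MDP

variable (M : MDP S A)

/-- One step of the chain of state-action pairs: `s' ∼ P(s, a)`, then `a' ∼ π(s')`. -/
def step (π : Policy S A) : Kernel (S × A) (S × A) :=
  M.transition ⊗ₖ Kernel.prodMkLeft (S × A) π.kernel

/-- The law of `(s_h, a_h)` when the chain is started at `(s_0, a_0)`. -/
def stepPow (π : Policy S A) : ℕ → Kernel (S × A) (S × A)
  | 0 => Kernel.id
  | h + 1 => M.step π ∘ₖ stepPow π h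

/-- `Q^π(s, a)`, the expected discounted sum of rewards from `(s, a)`. -/
def Q (π : Policy S A) (x : S × A) : ℝ :=
  ∑' h : ℕ, M.γ ^ h * ∫ z, M.reward z ∂(M.stepPow π h x)

/-- `V^π`, the expected discounted return when `(s_0, a_0)` is drawn from the reset distribution. -/
def V (π : Policy S A) : ℝ := ∫ x, M.Q π x ∂M.reset

/-- The Bellman operator `T^π f (s, a) = r(s, a) + γ E[f(s', a')]`. -/
def bellman (π : Policy S A) (f : S × A → ℝ) (x : S × A) : ℝ :=
  M.reward x + M.γ * ∫ z, f z ∂(M.step π x)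

/-- The normalized discounted state-action occupancy measure
`d^π = (1 - γ) ∑_h γ^h Law(s_h, a_h)`, where `(s_0, a_0)` is drawn from the reset distribution. -/
def occupancy (π : Policy S A) : Measure (S × A) :=
  Measure.sum fun h : ℕ =>
    ENNReal.ofReal ((1 - M.γ) * M.γ ^ h) • M.reset.bind (M.stepPow π h)

/-- One step of a rollout that records the current state-action pair and the sum of the
(undiscounted) rewards collected so far. -/
def rolloutStep (π : Policy S A) : Kernel ((S × A) × ℝ) ((S × A) × ℝ) :=
  Kernel.prodMkRight ℝ (M.step π) ⊗ₖ
    Kernel.deterministic (fun p : ((S × A) × ℝ) × (S × A) => p.1.2 + M.reward p.2)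
      ((measurable_snd.comp measurable_fst).add (M.measurable_reward.comp measurable_snd))

/-- The rollout from `(s_0, a_0)` after `h` steps: the law of
`((s_h, a_h), r_0 + ⋯ + r_h)`. -/
def rollout (π : Policy S A) : ℕ → Kernel (S × A) ((S × A) × ℝ)
  | 0 => Kernel.deterministic (fun x => (x, M.reward x))
      (measurable_id.prodMk M.measurable_reward)
  | h + 1 => M.rolloutStep π ∘ₖ rollout π h

/-- The law of one on-policy sample `((s, a), y)`: `(s, a) ∼ d^π`, and `y` is the undiscounted sum
of the rewards `r_0 + ⋯ + r_h` of a rollout of `π` from `(s, a)` that stops after each step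
independently with probability `1 - γ`, so that the index `h` of its last reward is geometric. -/
def onlineLaw (π : Policy S A) : Measure ((S × A) × ℝ) :=
  Measure.sum fun h : ℕ =>
    ENNReal.ofReal ((1 - M.γ) * M.γ ^ h) • (M.occupancy π ⊗ₘ (M.rollout π h).snd)

/-- The law of one offline sample `((s, a), s')`: `(s, a) ∼ ν`, `s' ∼ P(s, a)`. The reward of the
sample is `r(s, a)`. -/
def offlineLaw (ν : Measure (S × A)) : Measure ((S × A) × S) := ν ⊗ₘ M.transition

/-- `F` realizes the value functions of all policies in `Π`. -/
def Realizable (F : Finset (S × A → ℝ)) (Pi : Set (Policy S A)) : Prop :=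
  ∀ π ∈ Pi, ∃ f ∈ F, ∫ x, (f x - M.Q π x) ^ 2 ∂(M.occupancy π) = 0

/-- `F` has point-wise inherent Bellman error (at most) `ε`. -/
def HasInherentBellmanError (F : Finset (S × A → ℝ)) (ε : ℝ) : Prop :=
  ∀ f ∈ F, ∀ π : Policy S A, ∃ f' ∈ F, ∀ x, |f' x - M.bellman π f x| ≤ ε

/-- The coverage coefficient of `πe`: the least `C ∈ [0, ∞]` such that the density of `d^{πe}` with
respect to `d^π` is at most `C` for all policies `π`. -/
def Cnpg (πe : Policy S A) : ℝ≥0∞ :=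
  sInf {C | ∀ π : Policy S A, M.occupancy πe ≤ C • M.occupancy π}

/-- The Bellman error transfer coefficient of `πe`: the supremum over all policies `π` and all
`f, f' ∈ F` of the positive part of
`E_{d^{πe}}[T^π f' - f] / (E_ν[(T^π f' - f)²])^{1/2}`,
where a quotient `x / 0` is `∞` if `x > 0` and counts as `0` otherwise. -/
def Coff (F : Finset (S × A → ℝ)) (ν : Measure (S × A)) (πe : Policy S A) : ℝ≥0∞ :=
  ⨆ (π : Policy S A) (f ∈ F) (f' ∈ F),
    ENNReal.ofReal (∫ x, (M.bellman π f' x - f x) ∂(M.occupancy πe)) /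
      ENNReal.ofReal (Real.sqrt (∫ x, (M.bellman π f' x - f x) ^ 2 ∂ν))

end MDP

/-- A pair consisting of an offline dataset of samples `((s, a), s')` and an on-policy dataset of
samples `((s, a), y)`. -/
abbrev Dataset (S : Type u) (A : Type v) (moff mon : ℕ) : Type (max u v) :=
  (Fin moff → (S × A) × S) × (Fin mon → (S × A) × ℝ)

/-- The law of a pair of datasets with i.i.d. offline samples and i.i.d. on-policy samples. -/
def MDP.dataLaw (M : MDP S A) (ν : Measure (S × A)) (moff mon : ℕ) (π : Policy S A) :
    Measure (Dataset S A moff mon) :=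
  (Measure.pi fun _ : Fin moff => M.offlineLaw ν).prod
    (Measure.pi fun _ : Fin mon => M.onlineLaw π)

/-- The hybrid least-squares objective of a candidate `f`, with previous iterate `fprev`. -/
def MDP.hpeLoss [Fintype A] (M : MDP S A) {moff mon : ℕ} (lam : ℝ) (π : Policy S A)
    (D : Dataset S A moff mon) (fprev f : S × A → ℝ) : ℝ :=
  (1 / (moff : ℝ)) * ∑ i, (f (D.1 i).1 - M.reward (D.1 i).1 - M.γ * π.avg fprev (D.1 i).2) ^ 2
    + lam * ((1 / (mon : ℝ)) * ∑ j, (f (D.2 j).1 - (D.2 j).2) ^ 2)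

/-- The inputs of the Hybrid Actor-Critic algorithm, other than the MDP, the function class and the
offline distribution: the number `T` of rounds, the numbers `K1, K2` of iterations of the policy
evaluation, the sizes of the datasets, and the weight `lam` of the on-policy loss. -/
structure HACParams where
  T : ℕ
  K1 : ℕ
  K2 : ℕ
  moff : ℕ
  mon : ℕ
  lam : ℝ

/-- A run, on the probability space `Ω`, of the (softmax) Hybrid Actor-Critic algorithm with the
subroutine Hybrid Fitted Policy Evaluation. Rounds are `t = 1, …, T`; iterations of the subroutine
within a round are `k = 1, …, K2`. -/
structure HACRun [Fintype A] (M : MDP S A) (F : Finset (S × A → ℝ)) (ν : Measure (S × A))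
    (p : HACParams) {Ω : Type w} [MeasurableSpace Ω] (P : Measure Ω) where
  /-- `policy t` is the policy of round `t`. -/
  policy : ℕ → Ω → Policy S A
  /-- `iter t k` is the `k`-th iterate of the policy evaluation in round `t`. -/
  iter : ℕ → ℕ → Ω → S × A → ℝ
  /-- `data t k` are the datasets used in iteration `k` of round `t`. -/
  data : ℕ → ℕ → Ω → Dataset S A p.moff p.mon
  measurable_iter : ∀ t k f, MeasurableSet {ω | iter t k ω = f}
  measurable_data : ∀ t k, Measurable (data t k)
  /-- The first policy is uniform. -/
  policy_one : ∀ ω s a, (policy 1 ω).prob s a = 1 / (Fintype.card A : ℝ)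
  /-- The iterates are elements of the class; the initial iterate of a round is any of them. -/
  iter_mem : ∀ t ∈ Finset.Icc 1 p.T, ∀ k ∈ Finset.Icc 0 p.K2, ∀ ω, iter t k ω ∈ F
  /-- Given everything that happened before, the datasets of iteration `k` of round `t` are fresh
  samples, drawn according to the policy of round `t`. -/
  data_law : ∀ t ∈ Finset.Icc 1 p.T, ∀ k ∈ Finset.Icc 1 p.K2, ∀ E : Set Ω,
    MeasurableSet[
      (⨆ q ∈ {q : ℕ × ℕ | 1 ≤ q.1 ∧ q.2 ≤ p.K2 ∧ (q.1 < t ∨ q.1 = t ∧ q.2 < k)},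
        MeasurableSpace.comap (iter q.1 q.2) ⊤) ⊔
      (⨆ q ∈ {q : ℕ × ℕ | 1 ≤ q.1 ∧ 1 ≤ q.2 ∧ q.2 ≤ p.K2 ∧ (q.1 < t ∨ q.1 = t ∧ q.2 < k)},
        MeasurableSpace.comap (data q.1 q.2) inferInstance)] E →
    ∀ B : Set (Dataset S A p.moff p.mon), MeasurableSet B →
      P (E ∩ data t k ⁻¹' B) = ∫⁻ ω in E, M.dataLaw ν p.moff p.mon (policy t ω) B ∂P
  /-- Each iterate minimizes the hybrid least-squares objective over the class. -/
  iter_argmin : ∀ t ∈ Finset.Icc 1 p.T, ∀ k ∈ Finset.Icc 1 p.K2, ∀ ω, ∀ f ∈ F,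
    M.hpeLoss p.lam (policy t ω) (data t k ω) (iter t (k - 1) ω) (iter t k ω) ≤
      M.hpeLoss p.lam (policy t ω) (data t k ω) (iter t (k - 1) ω) f
  /-- The softmax update `π^{t+1}(a | s) ∝ π^t(a | s) exp(η f^t(s, a))`, where
  `η = (1 - γ) (log |A| / T)^{1/2}` and `f^t` is the average of the last `K2 - K1` iterates. -/
  policy_succ : ∀ t ∈ Finset.Icc 1 p.T, ∀ ω s a,
    let η : ℝ := (1 - M.γ) * Real.sqrt (Real.log (Fintype.card A) / p.T)
    let f : S × A → ℝ := fun x =>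
      (1 / ((p.K2 : ℝ) - p.K1)) * ∑ k ∈ Finset.Icc (p.K1 + 1) p.K2, iter t k ω x
    (policy (t + 1) ω).prob s a =
      (policy t ω).prob s a * Real.exp (η * f (s, a)) /
        ∑ b, (policy t ω).prob s b * Real.exp (η * f (s, b))

/-- The parameter choice: `K1 = 4⌈log(1/γ)⌉`, `K2 = K1 + T` and
`moff = mon = ⌈2 T log(2|F|/δ) / (1 - γ)²⌉`. -/
def stdParams (M : MDP S A) (F : Finset (S × A → ℝ)) (T : ℕ) (δ lam : ℝ) : HACParams where
  T := T
  K1 := 4 * ⌈Real.log (1 / M.γ)⌉₊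
  K2 := 4 * ⌈Real.log (1 / M.γ)⌉₊ + T
  moff := ⌈2 * T * Real.log (2 * F.card / δ) / (1 - M.γ) ^ 2⌉₊
  mon := ⌈2 * T * Real.log (2 * F.card / δ) / (1 - M.γ) ^ 2⌉₊
  lam := lam

/-- The cumulative suboptimality `∑_{t=1}^T (V^{πe} - V^{π^t})` in the outcome `ω`. -/
def HACRun.subopt [Fintype A] {M : MDP S A} {F : Finset (S × A → ℝ)} {ν : Measure (S × A)}
    {p : HACParams} {Ω : Type w} [MeasurableSpace Ω] {P : Measure Ω} (R : HACRun M F ν p P)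
    (πe : Policy S A) (ω : Ω) : ℝ :=
  ∑ t ∈ Finset.Icc 1 p.T, (M.V πe - M.V (R.policy t ω))

/-- The bound `c ((1-γ)^{-2} (log|A| T)^{1/2} + (1-γ)^{-2} (C T)^{1/2})`, in `[0, ∞]`. -/
def MDP.bound [Fintype A] (M : MDP S A) (c : ℝ) (T : ℕ) (C : ℝ≥0∞) : ℝ≥0∞ :=
  ENNReal.ofReal c *
    (ENNReal.ofReal (1 / (1 - M.γ) ^ 2 * Real.sqrt (Real.log (Fintype.card A) * T)) +
      ENNReal.ofReal (1 / (1 - M.γ) ^ 2) * (C * (T : ℝ≥0∞)) ^ (1 / 2 : ℝ))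

end

end HybridRL

/-! Write `H = 1 / (1 - γ)`. For any critic `f`, the gap `V^{πe} - V^π` is `H` times a sum of three
terms (`V_sub_V_eq`): the Bellman residual `T^π f - f` under `d^{πe}`, the opposite residual under
`d^π`, and `γ` times the advantage of `πe` over `π`, as judged by `f`, one step after `d^{πe}`.
Summed over the rounds, the third is in every state a regret of exponential weights, of order `H √(T
log |A|)`. What remains are the residuals of the averaged critics.

The residual is affine in `f`, so that of the critic is the mean of those of the iterates `h_1, …,
h_T`. Under `d^π` a residual is controlled by the mean square distance `onErr` to `Q^π`, and `Cnpg`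
carries this over to `d^{πe}`. The coefficient `Coff` only sees `T^π h_j - h_{j+1}`; replacing `T^π
h_j` by `T^π h_{j+1}` telescopes over the averaged iterates (`integral_critic_residual_le_Coff`).

Both empirical losses are regressions: the offline one has mean `T^π h_j`, the on-policy one has
mean `Q^π`, since a geometrically stopped return is unbiased. If the class nearly contains `T^π
h_j`, that competitor has tiny offline error and on-policy error about `γ * onErr h_j`, because
`T^π` contracts second moments under `d^π`. Optimality then gives a contraction of `onErr` by `(1 +
γ) / 2`, up to noise, with `offErr` as a further term on the left (`offErr_add_onErr_le`). Without
completeness the competitor is `Q^π` itself: its offline loss is only known to be `O(H ^ 2)`, and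
the weight `λ` of order `T` reduces this to `O(H ^ 2 / T)` (`onErr_le_of_realizable`).

A union bound over the `T ^ 2` averaged regressions would cost a factor `log T`. Instead, the
exponentials of all deviations in one iteration are added into a single weight whose conditional
mean is at most `1 + 4 |F|`. Multiplying the weights along the run and applying Markov's inequality
bounds the sum of their logarithms by `T ^ 2 log(1 + 4 |F|) + log(1 / δ)`
(`exists_concentration_event`). The noise of a single iteration is thus controlled only in total,
which suffices because the errors enter through sums and the Cauchy-Schwarz inequality. The
deviations are measured relative to the error itself, with factor `α = (1 - γ) / 8`, small enough to
keep the contraction. If `T` is below `H ^ 2`, `log |A|` or `4`, the trivial bound `T H` is good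
enough. -/

namespace HybridRL

noncomputable section

universe u v w

variable {S : Type u} {A : Type v} [MeasurableSpace S] [MeasurableSpace A]

/-! ### Bounded integrals, occupancy measures and Bellman operators -/

section

theorem integrable_of_bounded {X : Type*} [MeasurableSpace X] {μ : Measure X} [IsFiniteMeasure μ]
    {f : X → ℝ} {C : ℝ} (hf : Measurable f) (hC : ∀ x, |f x| ≤ C) : Integrable f μ :=
  Integrable.of_bound hf.aestronglyMeasurable C (Filter.Eventually.of_forall hC)

theorem abs_integral_le_of_bounded {X : Type*} [MeasurableSpace X] {μ : Measure X}
    [IsProbabilityMeasure μ] {f : X → ℝ} {C : ℝ} (hC : ∀ x, |f x| ≤ C) : |∫ x, f x ∂μ| ≤ C := by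
  have := norm_integral_le_of_norm_le_const (μ := μ) (f := f) (C := C)
    (Filter.Eventually.of_forall hC)
  simpa using this

theorem sq_integral_le_integral_sq {X : Type*} [MeasurableSpace X] {μ : Measure X}
    [IsProbabilityMeasure μ] {f : X → ℝ} {C : ℝ} (hf : Measurable f) (hC : ∀ x, |f x| ≤ C) :
    (∫ x, f x ∂μ) ^ 2 ≤ ∫ x, f x ^ 2 ∂μ := by
  have h1 : Integrable f μ := integrable_of_bounded hf hC
  have h2 : Integrable (fun x => f x ^ 2) μ :=
    integrable_of_bounded (C := C ^ 2) (hf.pow_const 2) fun x => by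
      rw [abs_pow]; exact pow_le_pow_left₀ (abs_nonneg _) (hC x) 2
  set m := ∫ x, f x ∂μ with hm
  have h3 : 0 ≤ ∫ x, (f x - m) ^ 2 ∂μ := integral_nonneg fun x => sq_nonneg _
  have h4 : ∫ x, (f x - m) ^ 2 ∂μ = ∫ x, f x ^ 2 ∂μ - m ^ 2 := by
    have : ∀ x, (f x - m) ^ 2 = f x ^ 2 - 2 * m * f x + m ^ 2 := fun x => by ring
    simp_rw [this]
    have h5 : Integrable (fun x => 2 * m * f x) μ := h1.const_mul _
    have h6 : Integrable (fun x => f x ^ 2 - 2 * m * f x) μ := h2.sub h5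
    rw [integral_add h6 (integrable_const _), integral_sub h2 h5, integral_const_mul, ← hm]
    simp
    ring
  linarith

theorem abs_integral_le_sqrt {X : Type*} [MeasurableSpace X] {μ : Measure X}
    [IsProbabilityMeasure μ] {f : X → ℝ} {C : ℝ} (hf : Measurable f) (hC : ∀ x, |f x| ≤ C) :
    |∫ x, f x ∂μ| ≤ √(∫ x, f x ^ 2 ∂μ) :=
  Real.abs_le_sqrt (sq_integral_le_integral_sq hf hC)

theorem integral_measure_comp {X Y : Type*} [MeasurableSpace X] [MeasurableSpace Y]
    {μ : Measure X} {κ : Kernel X Y} {f : Y → ℝ} (hf : Integrable f (μ.bind κ)) :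
    ∫ y, f y ∂(μ.bind κ) = ∫ x, ∫ y, f y ∂(κ x) ∂μ := by
  have h : μ.bind κ = (κ ∘ₖ Kernel.const Unit μ) () := by
    rw [Kernel.comp_apply, Kernel.const_apply]
  rw [h] at hf ⊢
  rw [Kernel.integral_comp hf, Kernel.const_apply]

namespace MDP

variable (M : MDP S A)

/-- The effective horizon `1 / (1 - γ)`. -/
def horizon : ℝ := 1 / (1 - M.γ)

theorem one_sub_pos : 0 < 1 - M.γ := sub_pos.2 M.γ_lt_one

theorem horizon_mul : M.horizon * (1 - M.γ) = 1 := by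
  have := M.one_sub_pos.ne'
  unfold horizon; field_simp

theorem one_le_horizon : 1 ≤ M.horizon := by
  unfold horizon
  rw [le_div_iff₀ M.one_sub_pos]
  linarith [M.γ_pos]

theorem horizon_pos : 0 < M.horizon := zero_lt_one.trans_le M.one_le_horizon

theorem horizon_eq : M.horizon = 1 + M.γ * M.horizon := by
  have := M.horizon_mul; linarith

instance (π : Policy S A) : IsMarkovKernel (M.step π) := by
  unfold step; infer_instance

instance (π : Policy S A) (h : ℕ) : IsMarkovKernel (M.stepPow π h) := by
  induction h with
  | zero => unfold stepPow; infer_instance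
  | succ h ih => unfold stepPow; infer_instance

/-- The definition appends steps at the end; the Bellman equation needs the first step split off. -/
theorem stepPow_succ' (π : Policy S A) (h : ℕ) :
    M.stepPow π (h + 1) = M.stepPow π h ∘ₖ M.step π := by
  induction h with
  | zero => simp [stepPow]
  | succ h ih =>
    rw [stepPow, ih, ← Kernel.comp_assoc, ← stepPow, ih]

theorem measurable_integral_kernel {X Y : Type*} [MeasurableSpace X] [MeasurableSpace Y]
    (κ : Kernel X Y) [IsSFiniteKernel κ] {f : Y → ℝ} (hf : Measurable f) :
    Measurable fun x => ∫ y, f y ∂(κ x) :=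
  (hf.stronglyMeasurable.integral_kernel (κ := κ)).measurable

/-- The expected reward after `h` steps. -/
def rewardAt (π : Policy S A) (h : ℕ) (x : S × A) : ℝ := ∫ z, M.reward z ∂(M.stepPow π h x)

theorem abs_reward_le (x : S × A) : |M.reward x| ≤ 1 :=
  abs_le.2 ⟨by linarith [M.reward_nonneg x], M.reward_le_one x⟩

theorem measurable_rewardAt (π : Policy S A) (h : ℕ) : Measurable (M.rewardAt π h) :=
  measurable_integral_kernel _ M.measurable_reward

theorem rewardAt_nonneg (π : Policy S A) (h : ℕ) (x : S × A) : 0 ≤ M.rewardAt π h x :=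
  integral_nonneg M.reward_nonneg

theorem rewardAt_le_one (π : Policy S A) (h : ℕ) (x : S × A) : M.rewardAt π h x ≤ 1 :=
  (abs_le.1 (abs_integral_le_of_bounded (C := 1) M.abs_reward_le)).2

theorem rewardAt_zero (π : Policy S A) (x : S × A) : M.rewardAt π 0 x = M.reward x := by
  simp only [rewardAt, stepPow, Kernel.id_apply]
  exact integral_dirac' _ _ M.measurable_reward.stronglyMeasurable

theorem rewardAt_succ (π : Policy S A) (h : ℕ) (x : S × A) :
    M.rewardAt π (h + 1) x = ∫ z, M.rewardAt π h z ∂(M.step π x) := by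
  unfold rewardAt
  rw [stepPow_succ', Kernel.integral_comp]
  exact integrable_of_bounded M.measurable_reward M.abs_reward_le

theorem Q_eq (π : Policy S A) (x : S × A) : M.Q π x = ∑' h : ℕ, M.γ ^ h * M.rewardAt π h x := rfl

theorem summable_Q (π : Policy S A) (x : S × A) :
    Summable fun h : ℕ => M.γ ^ h * M.rewardAt π h x :=
  (summable_geometric_of_lt_one M.γ_pos.le M.γ_lt_one).of_nonneg_of_le
    (fun h => mul_nonneg (pow_nonneg M.γ_pos.le h) (M.rewardAt_nonneg π h x))
    fun h => mul_le_of_le_one_right (pow_nonneg M.γ_pos.le h) (M.rewardAt_le_one π h x)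

theorem Q_nonneg (π : Policy S A) (x : S × A) : 0 ≤ M.Q π x :=
  tsum_nonneg fun h => mul_nonneg (pow_nonneg M.γ_pos.le h) (M.rewardAt_nonneg π h x)

theorem Q_le_horizon (π : Policy S A) (x : S × A) : M.Q π x ≤ M.horizon := by
  have h1 := (M.summable_Q π x).tsum_le_tsum
    (fun h => mul_le_of_le_one_right (pow_nonneg M.γ_pos.le h) (M.rewardAt_le_one π h x))
    (summable_geometric_of_lt_one M.γ_pos.le M.γ_lt_one)
  rw [tsum_geometric_of_lt_one M.γ_pos.le M.γ_lt_one] at h1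
  rw [horizon, one_div]
  exact h1

theorem abs_Q_le (π : Policy S A) (x : S × A) : |M.Q π x| ≤ M.horizon :=
  abs_le.2 ⟨by linarith [M.Q_nonneg π x, M.horizon_pos], M.Q_le_horizon π x⟩

theorem measurable_Q (π : Policy S A) : Measurable (M.Q π) := by
  refine measurable_of_tendsto_metrizable (f := fun n x =>
    ∑ h ∈ Finset.range n, M.γ ^ h * M.rewardAt π h x) (fun n => ?_) ?_
  · exact Finset.measurable_fun_sum _ fun h _ => (M.measurable_rewardAt π h).const_mul _
  · rw [tendsto_pi_nhds]
    exact fun x => (M.summable_Q π x).hasSum.tendsto_sum_nat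

theorem bellman_Q (π : Policy S A) (x : S × A) : M.bellman π (M.Q π) x = M.Q π x := by
  have h1 : ∫ z, M.Q π z ∂(M.step π x) = ∑' h : ℕ, M.γ ^ h * M.rewardAt π (h + 1) x := by
    have hs : ∀ h : ℕ, ∫ z, M.γ ^ h * M.rewardAt π h z ∂(M.step π x)
        = M.γ ^ h * M.rewardAt π (h + 1) x := fun h => by
      rw [integral_const_mul, rewardAt_succ]
    simp_rw [← hs, Q_eq]
    refine (integral_tsum_of_summable_integral_norm (fun h => ?_) ?_).symm
    · refine integrable_of_bounded (C := M.γ ^ h) ((M.measurable_rewardAt π h).const_mul _) ?_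
      intro z
      rw [abs_of_nonneg (mul_nonneg (pow_nonneg M.γ_pos.le h) (M.rewardAt_nonneg π h z))]
      exact mul_le_of_le_one_right (pow_nonneg M.γ_pos.le h) (M.rewardAt_le_one π h z)
    · have : ∀ h : ℕ, ∫ z, ‖M.γ ^ h * M.rewardAt π h z‖ ∂(M.step π x)
          = M.γ ^ h * M.rewardAt π (h + 1) x := fun h => by
        rw [← hs]
        refine integral_congr_ae (Filter.Eventually.of_forall fun z => ?_)
        exact abs_of_nonneg (mul_nonneg (pow_nonneg M.γ_pos.le h) (M.rewardAt_nonneg π h z))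
      simp_rw [this]
      exact (summable_geometric_of_lt_one M.γ_pos.le M.γ_lt_one).of_nonneg_of_le
        (fun h => mul_nonneg (pow_nonneg M.γ_pos.le h) (M.rewardAt_nonneg π _ x))
        fun h => mul_le_of_le_one_right (pow_nonneg M.γ_pos.le h) (M.rewardAt_le_one π _ x)
  rw [bellman, h1, Q_eq, (M.summable_Q π x).tsum_eq_zero_add, ← tsum_mul_left]
  simp only [pow_zero, one_mul, rewardAt_zero]
  congr 1
  refine tsum_congr fun h => by ring

theorem tsum_weights : ∑' h : ℕ, ENNReal.ofReal ((1 - M.γ) * M.γ ^ h) = 1 := by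
  rw [← ENNReal.ofReal_tsum_of_nonneg, tsum_mul_left,
    tsum_geometric_of_lt_one M.γ_pos.le M.γ_lt_one, mul_inv_cancel₀ M.one_sub_pos.ne',
    ENNReal.ofReal_one]
  · exact fun h => mul_nonneg M.one_sub_pos.le (pow_nonneg M.γ_pos.le h)
  · exact (summable_geometric_of_lt_one M.γ_pos.le M.γ_lt_one).mul_left _

instance (π : Policy S A) : IsProbabilityMeasure (M.occupancy π) := ⟨by
  rw [occupancy, Measure.sum_apply _ MeasurableSet.univ]
  simp only [Measure.smul_apply, measure_univ, smul_eq_mul, mul_one]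
  exact M.tsum_weights⟩

/-- The flow equation: split off `h = 0` and shift the index. It is what relates integrals against
`d^π` to integrals one step later, hence to Bellman residuals. -/
theorem occupancy_eq (π : Policy S A) :
    M.occupancy π = ENNReal.ofReal (1 - M.γ) • M.reset
      + ENNReal.ofReal M.γ • (M.occupancy π).bind (M.step π) := by
  ext s hs
  have h1 : ((M.occupancy π).bind (M.step π)) s
      = ∑' h : ℕ, ENNReal.ofReal ((1 - M.γ) * M.γ ^ h) *
          (M.reset.bind (M.stepPow π (h + 1))) s := by
    rw [Measure.bind_apply hs (Kernel.aemeasurable _), occupancy, lintegral_sum_measure]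
    refine tsum_congr fun h => ?_
    rw [lintegral_smul_measure, ← Measure.bind_apply hs (Kernel.aemeasurable _),
      Measure.comp_assoc]
    rfl
  rw [Measure.add_apply, Measure.smul_apply, Measure.smul_apply, h1]
  conv_lhs => rw [occupancy, Measure.sum_apply _ hs, tsum_eq_zero_add' ENNReal.summable]
  simp only [Measure.smul_apply, smul_eq_mul, pow_zero, mul_one]
  congr 1
  · simp [stepPow]
  · rw [← ENNReal.tsum_mul_left]
    refine tsum_congr fun h => ?_
    rw [← mul_assoc, ← ENNReal.ofReal_mul M.γ_pos.le]
    ring_nf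

theorem integral_occupancy_eq (π : Policy S A) {f : S × A → ℝ} {C : ℝ} (hf : Measurable f)
    (hC : ∀ x, |f x| ≤ C) :
    ∫ x, f x ∂(M.occupancy π) = (1 - M.γ) * ∫ x, f x ∂M.reset
      + M.γ * ∫ x, ∫ z, f z ∂(M.step π x) ∂(M.occupancy π) := by
  have hb : IsProbabilityMeasure ((M.occupancy π).bind (M.step π)) := inferInstance
  conv_lhs => rw [occupancy_eq]
  rw [integral_add_measure, integral_smul_measure, integral_smul_measure,
    ENNReal.toReal_ofReal M.one_sub_pos.le, ENNReal.toReal_ofReal M.γ_pos.le,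
    integral_measure_comp (integrable_of_bounded hf hC)]
  · rfl
  · exact (integrable_of_bounded hf hC).smul_measure ENNReal.ofReal_ne_top
  · exact (integrable_of_bounded hf hC).smul_measure ENNReal.ofReal_ne_top

/-- The expectation of `f` after one step of the chain. -/
def next (π : Policy S A) (f : S × A → ℝ) (x : S × A) : ℝ := ∫ z, f z ∂(M.step π x)

theorem bellman_eq (π : Policy S A) (f : S × A → ℝ) (x : S × A) :
    M.bellman π f x = M.reward x + M.γ * M.next π f x := rfl

theorem measurable_next (π : Policy S A) {f : S × A → ℝ} (hf : Measurable f) :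
    Measurable (M.next π f) := measurable_integral_kernel _ hf

theorem abs_next_le (π : Policy S A) {f : S × A → ℝ} {C : ℝ} (hC : ∀ x, |f x| ≤ C) (x : S × A) :
    |M.next π f x| ≤ C := abs_integral_le_of_bounded hC

theorem measurable_bellman (π : Policy S A) {f : S × A → ℝ} (hf : Measurable f) :
    Measurable (M.bellman π f) :=
  M.measurable_reward.add ((M.measurable_next π hf).const_mul _)

theorem abs_bellman_le (π : Policy S A) {f : S × A → ℝ} (hC : ∀ x, |f x| ≤ M.horizon)
    (x : S × A) : |M.bellman π f x| ≤ M.horizon := by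
  have h1 := M.abs_next_le π hC x
  have h2 := M.abs_reward_le x
  calc |M.bellman π f x| ≤ |M.reward x| + M.γ * |M.next π f x| := by
        rw [bellman_eq]
        refine (abs_add_le _ _).trans ?_
        rw [abs_mul, abs_of_pos M.γ_pos]
    _ ≤ 1 + M.γ * M.horizon := add_le_add h2 (mul_le_mul_of_nonneg_left h1 M.γ_pos.le)
    _ = M.horizon := M.horizon_eq.symm

theorem next_sub (π : Policy S A) {f g : S × A → ℝ} {C D : ℝ} (hf : Measurable f)
    (hC : ∀ x, |f x| ≤ C) (hg : Measurable g) (hD : ∀ x, |g x| ≤ D) (x : S × A) :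
    M.next π (fun z => f z - g z) x = M.next π f x - M.next π g x :=
  integral_sub (integrable_of_bounded hf hC) (integrable_of_bounded hg hD)

theorem bellman_sub_Q (π : Policy S A) {f : S × A → ℝ} {C : ℝ} (hf : Measurable f)
    (hC : ∀ x, |f x| ≤ C) (x : S × A) :
    M.bellman π f x - M.Q π x = M.γ * M.next π (fun z => f z - M.Q π z) x := by
  rw [next_sub M π hf hC (M.measurable_Q π) (M.abs_Q_le π)]
  conv_lhs => rw [← M.bellman_Q π x, bellman_eq, bellman_eq]
  ring

/-- Value of a function at the reset distribution against its Bellman residual. -/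
theorem V_sub_integral_reset (π : Policy S A) {f : S × A → ℝ} {C : ℝ} (hf : Measurable f)
    (hC : ∀ x, |f x| ≤ C) :
    M.V π - ∫ x, f x ∂M.reset
      = M.horizon * ∫ x, (M.bellman π f x - f x) ∂(M.occupancy π) := by
  have hQ : Measurable fun x => M.Q π x - f x := (M.measurable_Q π).sub hf
  have hQb : ∀ x, |M.Q π x - f x| ≤ M.horizon + C := fun x =>
    (abs_sub _ _).trans (add_le_add (M.abs_Q_le π x) (hC x))
  have h1 := M.integral_occupancy_eq π hQ hQb
  have h2 : ∫ x, (M.bellman π f x - f x) ∂(M.occupancy π)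
      = ∫ x, (M.Q π x - f x) ∂(M.occupancy π)
        - M.γ * ∫ x, M.next π (fun z => M.Q π z - f z) x ∂(M.occupancy π) := by
    rw [← integral_const_mul, ← integral_sub (integrable_of_bounded hQ hQb)]
    · refine integral_congr_ae (Filter.Eventually.of_forall fun x => ?_)
      have := M.bellman_sub_Q π hf hC x
      have h3 := M.next_sub π (M.measurable_Q π) (M.abs_Q_le π) hf hC x
      have h4 := M.next_sub π hf hC (M.measurable_Q π) (M.abs_Q_le π) x
      simp only
      rw [h3]; rw [h4] at this
      linarith
    · exact (integrable_of_bounded (M.measurable_next π hQ) (M.abs_next_le π hQb)).const_mul _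
  have h3 : M.V π - ∫ x, f x ∂M.reset = ∫ x, (M.Q π x - f x) ∂M.reset := by
    rw [V, integral_sub (integrable_of_bounded (M.measurable_Q π) (M.abs_Q_le π))
      (integrable_of_bounded hf hC)]
  rw [h3, h2, h1]
  simp only [next]
  linear_combination (- ∫ x, (M.Q π x - f x) ∂M.reset) * M.horizon_mul

/-- The Bellman operator is a contraction in the second moment of the occupancy measure. -/
theorem integral_bellman_sub_Q_sq_le (π : Policy S A) {f : S × A → ℝ} {C : ℝ} (hf : Measurable f)
    (hC : ∀ x, |f x| ≤ C) :
    ∫ x, (M.bellman π f x - M.Q π x) ^ 2 ∂(M.occupancy π)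
      ≤ M.γ * ∫ x, (f x - M.Q π x) ^ 2 ∂(M.occupancy π) := by
  have hd : Measurable fun x => f x - M.Q π x := hf.sub (M.measurable_Q π)
  have hdb : ∀ x, |f x - M.Q π x| ≤ C + M.horizon := fun x =>
    (abs_sub _ _).trans (add_le_add (hC x) (M.abs_Q_le π x))
  have hsq : Measurable fun x => (f x - M.Q π x) ^ 2 := hd.pow_const 2
  have hsqb : ∀ x, |(f x - M.Q π x) ^ 2| ≤ (C + M.horizon) ^ 2 := fun x => by
    rw [abs_pow]; exact pow_le_pow_left₀ (abs_nonneg _) (hdb x) 2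
  have h1 := M.integral_occupancy_eq π hsq hsqb
  have h0 : 0 ≤ ∫ x, (f x - M.Q π x) ^ 2 ∂M.reset := integral_nonneg fun x => sq_nonneg _
  have h2 : ∫ x, (M.bellman π f x - M.Q π x) ^ 2 ∂(M.occupancy π)
      ≤ ∫ x, M.γ ^ 2 * M.next π (fun z => (f z - M.Q π z) ^ 2) x ∂(M.occupancy π) := by
    refine integral_mono ?_ ?_ fun x => ?_
    · simp_rw [M.bellman_sub_Q π hf hC]
      refine integrable_of_bounded (C := (M.γ * (C + M.horizon)) ^ 2)
        (((M.measurable_next π hd).const_mul _).pow_const 2) fun x => ?_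
      rw [abs_pow, abs_mul, abs_of_pos M.γ_pos]
      exact pow_le_pow_left₀ (mul_nonneg M.γ_pos.le (abs_nonneg _))
        (mul_le_mul_of_nonneg_left (M.abs_next_le π hdb x) M.γ_pos.le) 2
    · exact (integrable_of_bounded (M.measurable_next π hsq) (M.abs_next_le π hsqb)).const_mul _
    · simp only
      rw [M.bellman_sub_Q π hf hC, mul_pow]
      exact mul_le_mul_of_nonneg_left (sq_integral_le_integral_sq hd hdb) (sq_nonneg _)
  rw [integral_const_mul] at h2
  refine h2.trans ?_
  -- Jensen's inequality gave the factor `γ ^ 2` and one further step. By the flow equation, that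
  -- step costs a factor `1 / γ` at most, since the reset term is nonnegative.
  rw [h1]
  have h3 := mul_nonneg (mul_nonneg M.γ_pos.le M.one_sub_pos.le) h0
  simp only [next]
  linarith

theorem V_nonneg (π : Policy S A) : 0 ≤ M.V π := integral_nonneg (M.Q_nonneg π)

theorem V_le_horizon (π : Policy S A) : M.V π ≤ M.horizon :=
  (abs_le.1 (abs_integral_le_of_bounded (M.abs_Q_le π))).2

/-- The infimum is attained. On a set of positive `d^π` mass, the ratio of the masses is a lower
bound for every admissible constant; on a null set, any one admissible constant forces the
comparator mass to vanish. -/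
theorem occupancy_le_Cnpg (πe π : Policy S A) (hfin : M.Cnpg πe ≠ ⊤) :
    M.occupancy πe ≤ M.Cnpg πe • M.occupancy π := by
  rw [Measure.le_iff]
  intro s _
  rw [Measure.smul_apply, smul_eq_mul]
  rcases eq_or_ne (M.occupancy π s) 0 with h0 | h0
  · have hne : {C : ℝ≥0∞ | ∀ π : Policy S A, M.occupancy πe ≤ C • M.occupancy π}.Nonempty := by
      by_contra hne
      rw [Set.not_nonempty_iff_eq_empty] at hne
      exact hfin (by rw [Cnpg, hne, sInf_empty])
    obtain ⟨C, hC⟩ := hne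
    have := hC π s
    rw [Measure.smul_apply, h0, smul_zero] at this
    exact this.trans (by simp)
  · rw [← ENNReal.div_le_iff h0 (measure_ne_top _ _)]
    refine le_sInf fun C hC => ?_
    rw [ENNReal.div_le_iff h0 (measure_ne_top _ _)]
    exact hC π s

/-- Change of measure from the occupancy measure of a comparator. -/
theorem integral_occupancy_le_Cnpg (πe π : Policy S A) (hfin : M.Cnpg πe ≠ ⊤) {g : S × A → ℝ}
    {C : ℝ} (hg : Measurable g) (hC : ∀ x, |g x| ≤ C) :
    ∫ x, g x ∂(M.occupancy πe)
      ≤ √(M.Cnpg πe).toReal * √(∫ x, g x ^ 2 ∂(M.occupancy π)) := by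
  have hsq : Measurable fun x => g x ^ 2 := hg.pow_const 2
  have hsqb : ∀ x, |g x ^ 2| ≤ C ^ 2 := fun x => by
    rw [abs_pow]; exact pow_le_pow_left₀ (abs_nonneg _) (hC x) 2
  refine (le_abs_self _).trans ((abs_integral_le_sqrt hg hC).trans ?_)
  rw [← Real.sqrt_mul ENNReal.toReal_nonneg]
  refine Real.sqrt_le_sqrt ?_
  have h1 : ∫ x, g x ^ 2 ∂(M.occupancy πe) ≤ ∫ x, g x ^ 2 ∂(M.Cnpg πe • M.occupancy π) :=
    integral_mono_measure (M.occupancy_le_Cnpg πe π hfin)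
      (Filter.Eventually.of_forall fun x => sq_nonneg _)
      ((integrable_of_bounded hsq hsqb).smul_measure hfin)
  rwa [integral_smul_measure] at h1

/-- Change of measure by the Bellman error transfer coefficient. -/
theorem integral_occupancy_le_Coff {F : Finset (S × A → ℝ)} {ν : Measure (S × A)}
    (πe π : Policy S A) (hfin : M.Coff F ν πe ≠ ⊤) {f f' : S × A → ℝ} (hf : f ∈ F) (hf' : f' ∈ F) :
    ∫ x, (M.bellman π f' x - f x) ∂(M.occupancy πe)
      ≤ (M.Coff F ν πe).toReal * √(∫ x, (M.bellman π f' x - f x) ^ 2 ∂ν) := by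
  set I := ∫ x, (M.bellman π f' x - f x) ∂(M.occupancy πe)
  set r := √(∫ x, (M.bellman π f' x - f x) ^ 2 ∂ν)
  have h1 : ENNReal.ofReal I / ENNReal.ofReal r ≤ M.Coff F ν πe := by
    unfold Coff
    exact le_iSup_of_le π (le_iSup₂_of_le f hf (le_iSup₂_of_le f' hf' le_rfl))
  have h2 : ENNReal.ofReal I ≤ M.Coff F ν πe * ENNReal.ofReal r := by
    -- With zero denominator a positive numerator would make the coefficient infinite, so finiteness
    -- leaves only a nonpositive numerator.
    rcases eq_or_ne (ENNReal.ofReal r) 0 with h0 | h0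
    · rcases eq_or_ne (ENNReal.ofReal I) 0 with hI | hI
      · simp [hI]
      · rw [h0, ENNReal.div_zero hI] at h1
        exact absurd (top_le_iff.1 h1) hfin
    · exact (ENNReal.div_le_iff h0 ENNReal.ofReal_ne_top).1 h1
  rw [← ENNReal.ofReal_toReal hfin, ← ENNReal.ofReal_mul ENNReal.toReal_nonneg] at h2
  exact (ENNReal.ofReal_le_ofReal_iff
    (mul_nonneg ENNReal.toReal_nonneg (Real.sqrt_nonneg _))).1 h2

end MDP

end

/-! ### Exponential moments of excess square losses -/

section

theorem exp_le_one_add_add_sq_mul_exp_abs (x : ℝ) :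
    Real.exp x ≤ 1 + x + x ^ 2 * Real.exp |x| := by
  have h := Complex.norm_exp_sub_sum_le_norm_mul_exp (x : ℂ) 2
  rw [Finset.sum_range_succ, Finset.sum_range_one] at h
  have h2 : Complex.exp (x : ℂ) - ((x : ℂ) ^ 0 / (Nat.factorial 0 : ℕ)
      + (x : ℂ) ^ 1 / (Nat.factorial 1 : ℕ)) = ((Real.exp x - (1 + x) : ℝ) : ℂ) := by
    push_cast; simp
  rw [h2, Complex.norm_real, Complex.norm_real, Real.norm_eq_abs, Real.norm_eq_abs, sq_abs] at h
  linarith [le_abs_self (Real.exp x - (1 + x))]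

theorem exp_le_one_add_add_sq {x : ℝ} (hx : |x| ≤ 1) : Real.exp x ≤ 1 + x + x ^ 2 := by
  have h := Real.norm_exp_sub_one_sub_id_le (x := x) (by simpa using hx)
  rw [Real.norm_eq_abs, Real.norm_eq_abs, sq_abs] at h
  linarith [le_abs_self (Real.exp x - 1 - x)]

/-- This is `u ^ 2 / 2 ≤ exp u` at `u = |x| / (4 H)`. It trades a square for half of the available
exponential moment. -/
theorem sq_le_mul_exp_abs_div {H : ℝ} (hH : 0 < H) (x : ℝ) :
    x ^ 2 ≤ 32 * H ^ 2 * Real.exp (|x| / (4 * H)) := by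
  have h0 : 0 ≤ |x| / (4 * H) := by positivity
  have h := Real.quadratic_le_exp_of_nonneg h0
  have h1 : (|x| / (4 * H)) ^ 2 = x ^ 2 / (16 * H ^ 2) := by
    rw [div_pow, sq_abs]; ring
  have h2 : x ^ 2 / (16 * H ^ 2) ≤ 2 * Real.exp (|x| / (4 * H)) := by
    rw [← h1]; linarith
  rw [div_le_iff₀ (by positivity)] at h2
  linarith

/-- A centered variable with an exponential moment has a sub-Gaussian moment generating function
near the origin. -/
theorem integral_exp_mul_le {Y : Type*} [MeasurableSpace Y] {κ : Measure Y}
    [IsProbabilityMeasure κ] {X : Y → ℝ} {H s : ℝ} (hH : 0 < H) (hX : Measurable X)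
    (hint : Integrable (fun y => Real.exp (|X y| / (2 * H))) κ)
    (hexp : ∫ y, Real.exp (|X y| / (2 * H)) ∂κ ≤ 11) (hmean : ∫ y, X y ∂κ = 0)
    (hs : |s| ≤ 1 / (4 * H)) :
    Integrable (fun y => Real.exp (s * X y)) κ ∧
      ∫ y, Real.exp (s * X y) ∂κ ≤ Real.exp (352 * s ^ 2 * H ^ 2) := by
  have hsX : ∀ y, |s * X y| ≤ |X y| / (4 * H) := fun y => by
    rw [abs_mul]
    calc |s| * |X y| ≤ 1 / (4 * H) * |X y| := mul_le_mul_of_nonneg_right hs (abs_nonneg _)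
      _ = |X y| / (4 * H) := by ring
  have hhalf : ∀ y, |X y| / (4 * H) + |X y| / (4 * H) = |X y| / (2 * H) := fun y => by
    field_simp; ring
  have hmono : ∀ y, Real.exp (s * X y) ≤ Real.exp (|X y| / (2 * H)) := fun y => by
    refine Real.exp_le_exp.2 ?_
    have h1 := hsX y
    have h2 := le_abs_self (s * X y)
    have h3 : 0 ≤ |X y| / (4 * H) := by positivity
    linarith [hhalf y]
  have hI : Integrable (fun y => Real.exp (s * X y)) κ := by
    refine hint.mono' (by fun_prop) (Filter.Eventually.of_forall fun y => ?_)
    rw [Real.norm_eq_abs, abs_of_pos (Real.exp_pos _)]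
    exact hmono y
  have hXi : Integrable X κ := by
    refine (hint.const_mul (2 * H)).mono' hX.aestronglyMeasurable
      (Filter.Eventually.of_forall fun y => ?_)
    have h := Real.add_one_le_exp (|X y| / (2 * H))
    have h2 : |X y| / (2 * H) ≤ Real.exp (|X y| / (2 * H)) := by linarith
    rw [div_le_iff₀ (by positivity)] at h2
    rw [Real.norm_eq_abs]
    linarith
  refine ⟨hI, ?_⟩
  -- In the second-order remainder, the square and the factor `exp |s X|` each cost `exp (|X| / (4
  -- H))`; together they use up exactly the assumed moment. The constant `352` is then `32 * 11`.
  have hpt : ∀ y, Real.exp (s * X y)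
      ≤ 1 + s * X y + 32 * s ^ 2 * H ^ 2 * Real.exp (|X y| / (2 * H)) := fun y => by
    have h1 := exp_le_one_add_add_sq_mul_exp_abs (s * X y)
    have h2 : (s * X y) ^ 2 * Real.exp |s * X y|
        ≤ s ^ 2 * (32 * H ^ 2 * Real.exp (|X y| / (4 * H))) * Real.exp (|X y| / (4 * H)) := by
      rw [mul_pow]
      exact mul_le_mul (mul_le_mul_of_nonneg_left (sq_le_mul_exp_abs_div hH _) (sq_nonneg _))
        (Real.exp_le_exp.2 (hsX y)) (Real.exp_pos _).le (by positivity)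
    have h3 : Real.exp (|X y| / (2 * H))
        = Real.exp (|X y| / (4 * H)) * Real.exp (|X y| / (4 * H)) := by
      rw [← Real.exp_add, hhalf]
    rw [h3]
    linarith
  have h1 : Integrable (fun y => 1 + s * X y) κ := (integrable_const _).add (hXi.const_mul _)
  have h2 : Integrable (fun y => 32 * s ^ 2 * H ^ 2 * Real.exp (|X y| / (2 * H))) κ :=
    hint.const_mul _
  calc ∫ y, Real.exp (s * X y) ∂κ
      ≤ ∫ y, (1 + s * X y + 32 * s ^ 2 * H ^ 2 * Real.exp (|X y| / (2 * H))) ∂κ :=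
        integral_mono hI (h1.add h2) hpt
    _ = 1 + 32 * s ^ 2 * H ^ 2 * ∫ y, Real.exp (|X y| / (2 * H)) ∂κ := by
        rw [integral_add h1 h2, integral_add (integrable_const _) (hXi.const_mul _),
          integral_const_mul, integral_const_mul, hmean]
        simp
    _ ≤ 1 + 32 * s ^ 2 * H ^ 2 * 11 := by
        have := mul_le_mul_of_nonneg_left hexp (by positivity : 0 ≤ 32 * s ^ 2 * H ^ 2)
        linarith
    _ ≤ Real.exp (352 * s ^ 2 * H ^ 2) := by
        have := Real.add_one_le_exp (352 * s ^ 2 * H ^ 2)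
        linarith

/-- Under `κ x`, the target `y (x, ·)` has mean `g x` and a fluctuation of exponential scale
`2 H`. -/
structure IsRegression {X Y : Type*} [MeasurableSpace X] [MeasurableSpace Y] (κ : Kernel X Y)
    (y : X × Y → ℝ) (g : X → ℝ) (H : ℝ) : Prop where
  measurable_target : Measurable y
  measurable_mean : Measurable g
  integrable_exp : ∀ x, Integrable (fun z => Real.exp (|y (x, z) - g x| / (2 * H))) (κ x)
  integral_exp_le : ∀ x, ∫ z, Real.exp (|y (x, z) - g x| / (2 * H)) ∂(κ x) ≤ 11
  integral_sub_mean : ∀ x, ∫ z, (y (x, z) - g x) ∂(κ x) = 0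

section Regression

variable {X Y : Type*} [MeasurableSpace X] [MeasurableSpace Y] {κ : Kernel X Y}
  {y : X × Y → ℝ} {g f : X → ℝ} {H : ℝ}

/-- The excess square loss of `f` over `g` on one sample. -/
def excess (y : X × Y → ℝ) (g f : X → ℝ) (p : X × Y) : ℝ :=
  (f p.1 - y p) ^ 2 - (g p.1 - y p) ^ 2

theorem measurable_excess (hy : Measurable y) (hg : Measurable g) (hf : Measurable f) :
    Measurable (excess y g f) := by
  unfold excess; fun_prop

/-- With `u = θ a d ^ 2`, boundedness of `d` and smallness of `θ` give `|u| ≤ 1`, so `exp u ≤ 1 + u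
+ u ^ 2`. Moreover `u ^ 2 ≤ 16 θ H ^ 2 * θ d ^ 2`, which is at most `θ (α / 2) d ^ 2`: the
fluctuation is charged to the mean of `d ^ 2` itself, with a small relative factor. -/
theorem integral_exp_sq_le {μ : Measure X} [IsProbabilityMeasure μ] {d : X → ℝ} {θ a α : ℝ}
    (hθ : 0 ≤ θ) (hα : 0 ≤ α) (hα1 : α ≤ 1) (hθH : 6000 * θ * H ^ 2 ≤ α) (ha : |a| ≤ 2)
    (hd : Measurable d) (hdH : ∀ x, |d x| ≤ 2 * H) :
    ∫⁻ x, ENNReal.ofReal (Real.exp (θ * a * d x ^ 2)) ∂μ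
      ≤ ENNReal.ofReal (Real.exp (θ * (a + α / 2) * ∫ x, d x ^ 2 ∂μ)) := by
  have hsqb : ∀ x, d x ^ 2 ≤ 4 * H ^ 2 := fun x => by
    have := pow_le_pow_left₀ (abs_nonneg _) (hdH x) 2
    rw [sq_abs] at this; linarith
  have hsqm : Measurable fun x => d x ^ 2 := hd.pow_const 2
  have hsqi : Integrable (fun x => d x ^ 2) μ :=
    integrable_of_bounded (C := 4 * H ^ 2) hsqm fun x => by
      rw [abs_of_nonneg (sq_nonneg _)]; exact hsqb x
  have hu : ∀ x, |θ * a * d x ^ 2| ≤ 1 := fun x => by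
    rw [abs_mul, abs_mul, abs_of_nonneg hθ, abs_of_nonneg (sq_nonneg (d x))]
    have h1 : θ * |a| * d x ^ 2 ≤ θ * 2 * (4 * H ^ 2) :=
      mul_le_mul (mul_le_mul_of_nonneg_left ha hθ) (hsqb x) (sq_nonneg _) (by positivity)
    nlinarith [mul_nonneg hθ (sq_nonneg H)]
  have hpt : ∀ x, Real.exp (θ * a * d x ^ 2) ≤ 1 + θ * (a + α / 2) * d x ^ 2 := fun x => by
    have h1 := exp_le_one_add_add_sq (hu x)
    have h2 : (θ * a * d x ^ 2) ^ 2 ≤ θ * (α / 2) * d x ^ 2 := by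
      have ha2 : a ^ 2 ≤ 4 := by
        have := pow_le_pow_left₀ (abs_nonneg _) ha 2
        rw [sq_abs] at this; linarith
      have h3 : θ * a ^ 2 * d x ^ 2 ≤ θ * 4 * (4 * H ^ 2) :=
        mul_le_mul (mul_le_mul_of_nonneg_left ha2 hθ) (hsqb x) (sq_nonneg _) (by positivity)
      have h4 : θ * a ^ 2 * d x ^ 2 ≤ α / 2 := by
        nlinarith [mul_nonneg hθ (sq_nonneg H)]
      have h5 := mul_le_mul_of_nonneg_left h4 (mul_nonneg hθ (sq_nonneg (d x)))
      nlinarith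
    nlinarith
  have hnn : ∀ x, 0 ≤ 1 + θ * (a + α / 2) * d x ^ 2 := fun x => (Real.exp_pos _).le.trans (hpt x)
  have hi : Integrable (fun x => 1 + θ * (a + α / 2) * d x ^ 2) μ :=
    (integrable_const _).add (hsqi.const_mul _)
  calc ∫⁻ x, ENNReal.ofReal (Real.exp (θ * a * d x ^ 2)) ∂μ
      ≤ ∫⁻ x, ENNReal.ofReal (1 + θ * (a + α / 2) * d x ^ 2) ∂μ :=
        lintegral_mono fun x => ENNReal.ofReal_le_ofReal (hpt x)
    _ = ENNReal.ofReal (∫ x, (1 + θ * (a + α / 2) * d x ^ 2) ∂μ) :=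
        (ofReal_integral_eq_lintegral_ofReal hi (Filter.Eventually.of_forall hnn)).symm
    _ ≤ _ := by
        refine ENNReal.ofReal_le_ofReal ?_
        rw [integral_add (integrable_const _) (hsqi.const_mul _), integral_const_mul]
        simp only [integral_const, probReal_univ, smul_eq_mul, mul_one]
        linarith [Real.add_one_le_exp (θ * (a + α / 2) * ∫ x, d x ^ 2 ∂μ)]

/-- With `d = f - g`, the excess loss is `d ^ 2 - 2 d (y - g)`. Given `x`, the noise is linear in
`d`, so its exponential moment costs `1408 θ ^ 2 H ^ 2 d ^ 2`, at most `θ (α / 4) d ^ 2`.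
Integrating over `x` costs another `θ (α / 2) d ^ 2` in the mean. The sign `σ` treats both tails at
once. -/
theorem lintegral_exp_excess_le {μ : Measure X} [IsProbabilityMeasure μ] [IsMarkovKernel κ]
    {θ α σ : ℝ} (hreg : IsRegression κ y g H)
    (hH : 0 < H) (hθ : 0 ≤ θ) (hα : 0 ≤ α) (hα1 : α ≤ 1) (hθH : 6000 * θ * H ^ 2 ≤ α)
    (hσ : |σ| = 1) (hf : Measurable f) (hfg : ∀ x, |f x - g x| ≤ 2 * H) :
    ∫⁻ p, ENNReal.ofReal (Real.exp (θ * (σ * excess y g f p))) ∂(μ ⊗ₘ κ)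
      ≤ ENNReal.ofReal (Real.exp (θ * ((σ + α) * ∫ x, (f x - g x) ^ 2 ∂μ))) := by
  have hg := hreg.measurable_mean
  have hy := hreg.measurable_target
  have hσ2 : σ ^ 2 = 1 := by rw [← sq_abs, hσ, one_pow]
  have hinner : ∀ x, ∫⁻ z, ENNReal.ofReal (Real.exp (θ * (σ * excess y g f (x, z)))) ∂(κ x)
      ≤ ENNReal.ofReal (Real.exp (θ * (σ + α / 4) * (f x - g x) ^ 2)) := by
    intro x
    set d := f x - g x with hd
    have hs : |(-2 * σ * θ * d)| ≤ 1 / (4 * H) := by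
      rw [abs_mul, abs_mul, abs_mul, hσ, abs_of_nonneg hθ]
      have h1 := hfg x
      rw [le_div_iff₀ (by positivity)]
      have h2 : θ * |d| ≤ θ * (2 * H) := mul_le_mul_of_nonneg_left h1 hθ
      norm_num
      nlinarith [mul_le_mul_of_nonneg_right h2 hH.le]
    have hXm : Measurable fun z => y (x, z) - g x :=
      (hy.comp measurable_prodMk_left).sub_const _
    obtain ⟨hI, hle⟩ := integral_exp_mul_le hH hXm (hreg.integrable_exp x)
      (hreg.integral_exp_le x) (hreg.integral_sub_mean x) hs
    have heq : ∀ z, Real.exp (θ * (σ * excess y g f (x, z)))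
        = Real.exp (θ * σ * d ^ 2) * Real.exp (-2 * σ * θ * d * (y (x, z) - g x)) := fun z => by
      rw [← Real.exp_add]
      congr 1
      simp only [excess, hd]
      ring
    simp_rw [heq]
    rw [← ofReal_integral_eq_lintegral_ofReal (hI.const_mul _)
      (Filter.Eventually.of_forall fun z => by positivity), integral_const_mul]
    refine ENNReal.ofReal_le_ofReal ?_
    refine (mul_le_mul_of_nonneg_left hle (Real.exp_pos _).le).trans ?_
    rw [← Real.exp_add]
    refine Real.exp_le_exp.2 ?_
    have h3 : 352 * (-2 * σ * θ * d) ^ 2 * H ^ 2 = θ * d ^ 2 * (1408 * (θ * H ^ 2)) := by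
      have : (-2 * σ * θ * d) ^ 2 = 4 * σ ^ 2 * θ ^ 2 * d ^ 2 := by ring
      rw [this, hσ2]; ring
    rw [h3]
    have h4 : 1408 * (θ * H ^ 2) ≤ α / 4 := by
      nlinarith [mul_nonneg hθ (sq_nonneg H)]
    have := mul_le_mul_of_nonneg_left h4 (mul_nonneg hθ (sq_nonneg d))
    linarith
  rw [Measure.lintegral_compProd]
  · refine (lintegral_mono hinner).trans ?_
    have ha : |σ + α / 4| ≤ 2 := by
      refine (abs_add_le _ _).trans ?_
      rw [hσ, abs_of_nonneg (by positivity)]; linarith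
    refine (integral_exp_sq_le hθ hα hα1 hθH ha (hf.sub hg) hfg).trans ?_
    refine ENNReal.ofReal_le_ofReal (Real.exp_le_exp.2 ?_)
    have : 0 ≤ ∫ x, (f x - g x) ^ 2 ∂μ := integral_nonneg fun x => sq_nonneg _
    have h5 := mul_nonneg (mul_nonneg hθ hα) this
    simp only [Pi.sub_apply]
    linarith
  · have := measurable_excess hy hg hf
    fun_prop

theorem lintegral_pi_prod {Z : Type*} [MeasurableSpace Z] {ρ : Measure Z} [IsProbabilityMeasure ρ]
    {m : ℕ} {h : Z → ℝ≥0∞} (hh : Measurable h) :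
    ∫⁻ ω, ∏ i, h (ω i) ∂(Measure.pi fun _ : Fin m => ρ) = (∫⁻ z, h z ∂ρ) ^ m := by
  have h1 := lintegral_prod_eq_prod_lintegral_of_indepFun
    (μ := Measure.pi fun _ : Fin m => ρ) Finset.univ (fun i ω => h (ω i))
    (iIndepFun_pi (X := fun _ : Fin m => h) fun _ => hh.aemeasurable)
    (fun i => hh.comp (measurable_pi_apply i))
  rw [h1]
  have h2 : ∀ i : Fin m, ∫⁻ ω, h (ω i) ∂(Measure.pi fun _ : Fin m => ρ) = ∫⁻ z, h z ∂ρ :=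
    fun i => (measurePreserving_eval (fun _ : Fin m => ρ) i).lintegral_comp hh
  simp [h2]

/-- Exponential concentration of the empirical excess loss, from above (`σ = 1`) and from below
(`σ = -1`). -/
theorem lintegral_exp_sum_excess_le {μ : Measure X} [IsProbabilityMeasure μ] [IsMarkovKernel κ]
    {θ α σ : ℝ} (m : ℕ) (hreg : IsRegression κ y g H)
    (hH : 0 < H) (hθ : 0 ≤ θ) (hα : 0 ≤ α) (hα1 : α ≤ 1) (hθH : 6000 * θ * H ^ 2 ≤ α)
    (hσ : |σ| = 1) (hf : Measurable f) (hfg : ∀ x, |f x - g x| ≤ 2 * H) :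
    ∫⁻ D, ENNReal.ofReal (Real.exp (θ * (σ * ∑ i, excess y g f (D i)
        - m * ((σ + α) * ∫ x, (f x - g x) ^ 2 ∂μ)))) ∂(Measure.pi fun _ : Fin m => μ ⊗ₘ κ) ≤ 1 := by
  set B := (σ + α) * ∫ x, (f x - g x) ^ 2 ∂μ with hB
  have hm := measurable_excess hreg.measurable_target hreg.measurable_mean hf
  have heq : ∀ D : Fin m → X × Y, ENNReal.ofReal (Real.exp (θ * (σ * ∑ i, excess y g f (D i)
      - m * B))) = ∏ i, ENNReal.ofReal (Real.exp (θ * (σ * excess y g f (D i)) - θ * B)) := by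
    intro D
    rw [← ENNReal.ofReal_prod_of_nonneg fun i _ => (Real.exp_pos _).le, ← Real.exp_sum]
    congr 2
    rw [Finset.sum_sub_distrib, ← Finset.mul_sum, ← Finset.mul_sum]
    simp
    ring
  simp_rw [heq]
  rw [lintegral_pi_prod (h := fun p => ENNReal.ofReal (Real.exp (θ * (σ * excess y g f p) - θ * B)))
    (by fun_prop)]
  refine pow_le_one₀ (zero_le) ?_
  simp_rw [sub_eq_add_neg, Real.exp_add, ENNReal.ofReal_mul (Real.exp_pos _).le]
  rw [lintegral_mul_const _ (by fun_prop)]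
  refine (mul_le_mul_left (lintegral_exp_excess_le hreg hH hθ hα hα1 hθH hσ hf hfg) _).trans ?_
  rw [← ENNReal.ofReal_mul (Real.exp_pos _).le, ← Real.exp_add, ← hB]
  simp

end Regression

end

/-! ### The offline and the on-policy regression problems -/

section

theorem Policy.prob_nonneg (π : Policy S A) (s : S) (a : A) : 0 ≤ π.prob s a := measureReal_nonneg

/-- The softmax update prescribes only the numbers `π(a | s)`; this makes the policy itself a
function of them. -/
theorem Policy.ext_prob [Countable A] {π π' : Policy S A} (h : ∀ s a, π.prob s a = π'.prob s a) : π = π' := by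
  have hk : π.kernel = π'.kernel := by
    refine Kernel.ext fun s => Measure.ext_iff_singleton.2 fun a => ?_
    have := h s a
    simp only [Policy.prob, Measure.real] at this
    exact (ENNReal.toReal_eq_toReal_iff' (measure_ne_top _ _) (measure_ne_top _ _)).1 this
  cases π; cases π'; cases hk; rfl

section Finite

variable [Fintype A] [MeasurableSingletonClass A]

theorem Policy.sum_prob (π : Policy S A) (s : S) : ∑ a, π.prob s a = 1 := by
  have h := integral_fintype (μ := π.kernel s) (f := fun _ : A => (1 : ℝ)) (integrable_const _)
  simp only [integral_const, probReal_univ, smul_eq_mul, mul_one] at h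
  exact h.symm

theorem Policy.measurable_avg (π : Policy S A) {f : S × A → ℝ} (hf : Measurable f) :
    Measurable (π.avg f) := by
  unfold Policy.avg
  refine Finset.measurable_fun_sum _ fun a _ => ?_
  refine Measurable.mul ?_ (hf.comp measurable_prodMk_right)
  exact (π.kernel.measurable_coe (measurableSet_singleton a)).ennreal_toReal

theorem Policy.abs_avg_le (π : Policy S A) {f : S × A → ℝ} {C : ℝ} (hC : ∀ x, |f x| ≤ C) (s : S) :
    |π.avg f s| ≤ C := by
  calc |π.avg f s| ≤ ∑ a, |π.prob s a * f (s, a)| := Finset.abs_sum_le_sum_abs _ _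
    _ ≤ ∑ a, π.prob s a * C := Finset.sum_le_sum fun a _ => by
        rw [abs_mul, abs_of_nonneg (π.prob_nonneg s a)]
        exact mul_le_mul_of_nonneg_left (hC _) (π.prob_nonneg s a)
    _ = C := by rw [← Finset.sum_mul, π.sum_prob, one_mul]

theorem MDP.next_eq_integral_avg (M : MDP S A) (π : Policy S A) {f : S × A → ℝ} {C : ℝ}
    (hf : Measurable f) (hC : ∀ x, |f x| ≤ C) (x : S × A) :
    M.next π f x = ∫ s, π.avg f s ∂(M.transition x) := by
  unfold MDP.next MDP.step
  rw [integral_compProd]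
  · refine integral_congr_ae (Filter.Eventually.of_forall fun s => ?_)
    simp only [Kernel.prodMkLeft_apply]
    rw [integral_fintype]
    · rfl
    · exact integrable_of_bounded (hf.comp measurable_prodMk_left) fun a => hC (s, a)
  · exact integrable_of_bounded hf hC

end Finite

namespace MDP

variable (M : MDP S A)

/-- The target of the offline regression. -/
def offlineTarget [Fintype A] (π : Policy S A) (f : S × A → ℝ) (p : (S × A) × S) : ℝ :=
  M.reward p.1 + M.γ * π.avg f p.2

/-- Target and mean both lie in `[-H, H]`, so the exponent is at most `1` and `e < 11`. The reward
is observed exactly; the only noise is that of the next state. -/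
theorem isRegression_offline [Fintype A] [MeasurableSingletonClass A] (π : Policy S A)
    {f : S × A → ℝ} (hf : Measurable f) (hC : ∀ x, |f x| ≤ M.horizon) :
    IsRegression M.transition (M.offlineTarget π f) (M.bellman π f) M.horizon := by
  have hm : Measurable (M.offlineTarget π f) :=
    (M.measurable_reward.comp measurable_fst).add
      (((π.measurable_avg hf).comp measurable_snd).const_mul _)
  have hb : ∀ p, |M.offlineTarget π f p| ≤ M.horizon := fun p => by
    have h1 := π.abs_avg_le hC p.2
    calc |M.offlineTarget π f p| ≤ |M.reward p.1| + M.γ * |π.avg f p.2| := by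
          refine (abs_add_le _ _).trans ?_
          rw [abs_mul, abs_of_pos M.γ_pos]
      _ ≤ 1 + M.γ * M.horizon :=
          add_le_add (M.abs_reward_le _) (mul_le_mul_of_nonneg_left h1 M.γ_pos.le)
      _ = M.horizon := M.horizon_eq.symm
  have hdm : ∀ x, Measurable fun z => M.offlineTarget π f (x, z) - M.bellman π f x := fun x =>
    (hm.comp measurable_prodMk_left).sub_const _
  have hexp : ∀ x z, Real.exp (|M.offlineTarget π f (x, z) - M.bellman π f x| / (2 * M.horizon))
      ≤ 11 := fun x z => by
    have h1 : |M.offlineTarget π f (x, z) - M.bellman π f x| / (2 * M.horizon) ≤ 1 := by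
      rw [div_le_one (by linarith [M.horizon_pos])]
      refine (abs_sub _ _).trans ?_
      linarith [hb (x, z), M.abs_bellman_le π hC x]
    have := Real.exp_le_exp.2 h1
    linarith [Real.exp_one_lt_d9]
  have hint : ∀ x, Integrable (fun z => Real.exp
      (|M.offlineTarget π f (x, z) - M.bellman π f x| / (2 * M.horizon))) (M.transition x) :=
    fun x => integrable_of_bounded (C := 11) (((hdm x).abs.div_const _).exp) fun z => by
      rw [abs_of_pos (Real.exp_pos _)]; exact hexp x z
  refine ⟨hm, M.measurable_bellman π hf, hint, fun x => ?_, fun x => ?_⟩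
  · have := integral_mono (hint x) (integrable_const 11) (hexp x)
    simpa using this
  · have h1 : ∀ z, M.offlineTarget π f (x, z) - M.bellman π f x
        = M.γ * π.avg f z - M.γ * M.next π f x := fun z => by
      rw [offlineTarget, bellman_eq]; ring
    simp_rw [h1]
    rw [integral_sub ((integrable_of_bounded (π.measurable_avg hf) (π.abs_avg_le hC)).const_mul _)
      (integrable_const _), integral_const_mul, ← M.next_eq_integral_avg π hf hC]
    simp

theorem rolloutStep_apply (π : Policy S A) (p : (S × A) × ℝ) :
    M.rolloutStep π p = (M.step π p.1).map fun z => (z, p.2 + M.reward z) := by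
  have hm : Measurable fun z => (z, p.2 + M.reward z) :=
    measurable_id.prodMk (M.measurable_reward.const_add _)
  ext s hs
  rw [rolloutStep, Kernel.compProd_apply hs, Measure.map_apply hm hs, Kernel.prodMkRight_apply,
    ← lintegral_indicator_one (hm hs)]
  refine lintegral_congr fun z => ?_
  rw [Kernel.deterministic_apply' _ _ (measurable_prodMk_left hs)]
  rfl

instance (π : Policy S A) : IsMarkovKernel (M.rolloutStep π) := by
  unfold rolloutStep; infer_instance

instance (π : Policy S A) (h : ℕ) : IsMarkovKernel (M.rollout π h) := by
  induction h with
  | zero => unfold rollout; infer_instance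
  | succ h ih => unfold rollout; infer_instance

theorem rollout_map_fst (π : Policy S A) (h : ℕ) (x : S × A) :
    (M.rollout π h x).map Prod.fst = M.stepPow π h x := by
  induction h with
  | zero =>
    rw [rollout, stepPow, Kernel.deterministic_apply, Measure.map_dirac' measurable_fst,
      Kernel.id_apply]
  | succ h ih =>
    ext s hs
    rw [Measure.map_apply measurable_fst hs, rollout, stepPow,
      Kernel.comp_apply' _ _ _ (measurable_fst hs), Kernel.comp_apply' _ _ _ hs, ← ih,
      lintegral_map (Kernel.measurable_coe _ hs) measurable_fst]
    refine lintegral_congr fun p => ?_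
    rw [rolloutStep_apply, Measure.map_apply _ (measurable_fst hs)]
    · rfl
    · exact measurable_id.prodMk (M.measurable_reward.const_add _)

theorem ae_rollout_mem (π : Policy S A) (h : ℕ) (x : S × A) :
    ∀ᵐ p ∂(M.rollout π h x), 0 ≤ p.2 ∧ p.2 ≤ (h : ℝ) + 1 := by
  have hms : ∀ c : ℝ, MeasurableSet {p : (S × A) × ℝ | 0 ≤ p.2 ∧ p.2 ≤ c} := fun c =>
    (measurableSet_le measurable_const measurable_snd).inter
      (measurableSet_le measurable_snd measurable_const)
  induction h with
  | zero =>
    rw [rollout, Kernel.deterministic_apply, ae_dirac_iff (hms _)]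
    simp [M.reward_nonneg, M.reward_le_one]
  | succ h ih =>
    rw [rollout, Kernel.comp_apply]
    refine Measure.ae_comp_of_ae_ae (hms _) ?_
    filter_upwards [ih] with p hp
    rw [rolloutStep_apply, ae_map_iff _ (hms _)]
    · refine Filter.Eventually.of_forall fun z => ⟨?_, ?_⟩
      · exact add_nonneg hp.1 (M.reward_nonneg z)
      · push_cast
        exact add_le_add hp.2 (M.reward_le_one z)
    · exact (measurable_id.prodMk (M.measurable_reward.const_add _)).aemeasurable

theorem integrable_rollout_snd (π : Policy S A) (h : ℕ) (x : S × A) :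
    Integrable (fun p : (S × A) × ℝ => p.2) (M.rollout π h x) := by
  refine Integrable.of_bound measurable_snd.aestronglyMeasurable (h + 1) ?_
  filter_upwards [M.ae_rollout_mem π h x] with p hp
  rw [Real.norm_eq_abs, abs_of_nonneg hp.1]
  exact hp.2

theorem integral_rollout_snd (π : Policy S A) (h : ℕ) (x : S × A) :
    ∫ p, p.2 ∂(M.rollout π h x) = ∑ i ∈ Finset.range (h + 1), M.rewardAt π i x := by
  induction h with
  | zero =>
    rw [Finset.sum_range_one, rewardAt_zero, rollout, Kernel.deterministic_apply,
      integral_dirac' _ _ measurable_snd.stronglyMeasurable]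
  | succ h ih =>
    have h1 : ∫ p, p.2 ∂(M.rollout π (h + 1) x)
        = ∫ p, ∫ q, q.2 ∂(M.rolloutStep π p) ∂(M.rollout π h x) := by
      have hi := M.integrable_rollout_snd π (h + 1) x
      rw [rollout] at hi ⊢
      exact Kernel.integral_comp hi
    have h2 : ∀ p : (S × A) × ℝ, ∫ q, q.2 ∂(M.rolloutStep π p)
        = p.2 + M.next π M.reward p.1 := fun p => by
      rw [rolloutStep_apply, integral_map _ measurable_snd.aestronglyMeasurable]
      · simp only
        rw [integral_add (integrable_const _)
          (integrable_of_bounded M.measurable_reward M.abs_reward_le)]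
        simp [next]
      · exact (measurable_id.prodMk (M.measurable_reward.const_add _)).aemeasurable
    have hn := M.measurable_next π M.measurable_reward
    rw [h1, Finset.sum_range_succ, ← ih]
    simp_rw [h2]
    have hni : Integrable (fun p : (S × A) × ℝ => M.next π M.reward p.1) (M.rollout π h x) :=
      integrable_of_bounded (C := 1) (hn.comp measurable_fst)
        fun p => M.abs_next_le π M.abs_reward_le p.1
    rw [integral_add (M.integrable_rollout_snd π h x) hni]
    congr 1
    rw [rewardAt, stepPow, Kernel.integral_comp
      (integrable_of_bounded M.measurable_reward M.abs_reward_le), ← rollout_map_fst]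
    exact (integral_map measurable_fst.aemeasurable hn.aestronglyMeasurable).symm

/-- The conditional law of the return of a rollout with a geometric number of steps. -/
def onlineKernel (π : Policy S A) : Kernel (S × A) ℝ where
  toFun x := Measure.sum fun h : ℕ =>
    ENNReal.ofReal ((1 - M.γ) * M.γ ^ h) • (M.rollout π h).snd x
  measurable' := by
    refine Measure.measurable_of_measurable_coe _ fun s hs => ?_
    simp only [Measure.sum_apply _ hs, Measure.smul_apply, smul_eq_mul]
    exact Measurable.tsum fun h => (Kernel.measurable_coe _ hs).const_mul _

theorem onlineKernel_apply (π : Policy S A) (x : S × A) :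
    M.onlineKernel π x = Measure.sum fun h : ℕ =>
      ENNReal.ofReal ((1 - M.γ) * M.γ ^ h) • (M.rollout π h).snd x := rfl

instance (π : Policy S A) : IsMarkovKernel (M.onlineKernel π) := ⟨fun x => ⟨by
  rw [onlineKernel_apply, Measure.sum_apply _ MeasurableSet.univ]
  simp only [Measure.smul_apply, measure_univ, smul_eq_mul, mul_one]
  exact M.tsum_weights⟩⟩

/-- The stopping index is independent of the initial pair, so the geometric mixture moves into the
kernel. This puts on-policy samples into the form of a regression over `d^π`. -/
theorem onlineLaw_eq (π : Policy S A) :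
    M.onlineLaw π = M.occupancy π ⊗ₘ M.onlineKernel π := by
  ext s hs
  rw [onlineLaw, Measure.sum_apply _ hs, Measure.compProd_apply hs]
  simp_rw [onlineKernel_apply]
  have : ∀ x : S × A, (Measure.sum fun h : ℕ =>
      ENNReal.ofReal ((1 - M.γ) * M.γ ^ h) • (M.rollout π h).snd x) (Prod.mk x ⁻¹' s)
      = ∑' h : ℕ, ENNReal.ofReal ((1 - M.γ) * M.γ ^ h)
        * (M.rollout π h).snd x (Prod.mk x ⁻¹' s) := fun x => by
    rw [Measure.sum_apply _ (measurable_prodMk_left hs)]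
    simp
  simp_rw [this]
  have hmeas : ∀ h : ℕ, Measurable fun x => (M.rollout π h).snd x (Prod.mk x ⁻¹' s) := fun h =>
    Kernel.measurable_kernel_prodMk_left hs
  rw [lintegral_tsum fun h => ((hmeas h).const_mul _).aemeasurable]
  refine tsum_congr fun h => ?_
  rw [Measure.smul_apply, Measure.compProd_apply hs, lintegral_const_mul _ (hmeas h), smul_eq_mul]

/-- The reward at step `i` is collected with probability `γ ^ i`, so stopping replaces discounting
and the return is unbiased. The proof applies the recursion of the partial sums to the series,
instead of interchanging two sums. -/
theorem one_sub_gamma_mul_tsum_sum_rewardAt (π : Policy S A) (x : S × A) :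
    HasSum (fun h : ℕ => (1 - M.γ) * M.γ ^ h * ∑ i ∈ Finset.range (h + 1), M.rewardAt π i x)
      (M.Q π x) := by
  set R : ℕ → ℝ := fun i => M.rewardAt π i x
  set Sm : ℕ → ℝ := fun h => ∑ i ∈ Finset.range (h + 1), R i with hSm
  have hS0 : ∀ h, 0 ≤ Sm h := fun h => Finset.sum_nonneg fun i _ => M.rewardAt_nonneg π i x
  have hS1 : ∀ h, Sm h ≤ h + 1 := fun h => by
    have := Finset.sum_le_card_nsmul (Finset.range (h + 1)) R 1 fun i _ => M.rewardAt_le_one π i x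
    simpa using this
  have hγ : ‖M.γ‖ < 1 := by rw [Real.norm_eq_abs, abs_of_pos M.γ_pos]; exact M.γ_lt_one
  have hs : Summable fun h : ℕ => M.γ ^ h * Sm h := by
    have h1 := summable_pow_mul_geometric_of_norm_lt_one 1 hγ
    have h2 := summable_geometric_of_norm_lt_one hγ
    refine (h1.add h2).of_nonneg_of_le
      (fun h => mul_nonneg (pow_nonneg M.γ_pos.le h) (hS0 h)) fun h => ?_
    have := mul_le_mul_of_nonneg_left (hS1 h) (pow_nonneg M.γ_pos.le h)
    simp only [pow_one]
    linarith
  have hsucc : ∀ h, M.γ ^ (h + 1) * Sm (h + 1) = M.γ * (M.γ ^ h * Sm h) + M.γ ^ (h + 1) * R (h + 1) :=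
    fun h => by
      have : Sm (h + 1) = Sm h + R (h + 1) := Finset.sum_range_succ _ _
      rw [this]; ring
  have hR := M.summable_Q π x
  have h3 : ∑' h : ℕ, M.γ ^ h * Sm h = M.γ * ∑' h : ℕ, M.γ ^ h * Sm h + M.Q π x := by
    conv_lhs => rw [hs.tsum_eq_zero_add]
    simp_rw [hsucc]
    rw [(hs.mul_left M.γ).tsum_add ((summable_nat_add_iff 1).2 hR), tsum_mul_left, Q_eq,
      hR.tsum_eq_zero_add]
    simp [hSm, R]
    ring
  have h4 : M.Q π x = (1 - M.γ) * ∑' h : ℕ, M.γ ^ h * Sm h := by linarith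
  rw [h4]
  have := hs.hasSum.mul_left (1 - M.γ)
  simpa only [mul_assoc] using this

/-- If the last reward has index `h`, the return lies in `[0, h + 1]` and `Q^π` in `[0, H]`. With `g
= 1 - γ`, the exponential is at most `e * exp (g / 2) ^ h`. Against the weights `g * γ ^ h` this is
a geometric series with ratio `q ≤ 1 - g / 4`, of sum at most `4 e < 11`. -/
theorem lintegral_exp_onlineKernel_le (π : Policy S A) (x : S × A) :
    ∫⁻ y, ENNReal.ofReal (Real.exp (|y - M.Q π x| / (2 * M.horizon))) ∂(M.onlineKernel π x)
      ≤ ENNReal.ofReal 11 := by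
  have hH := M.horizon_pos
  set g := 1 - M.γ with hg
  have hg0 : 0 < g := M.one_sub_pos
  have hg1 : g < 1 := by linarith [M.γ_pos]
  have hHg : 1 / (2 * M.horizon) = g / 2 := by
    have := M.horizon_mul
    field_simp
    linarith
  set q := M.γ * Real.exp (g / 2) with hq
  have hq0 : 0 < q := mul_pos M.γ_pos (Real.exp_pos _)
  -- From `γ = 1 - g ≤ exp (-g)` follows `q ≤ exp (-g / 2) ≤ 1 - g / 2 + g ^ 2 / 4`, and `g < 1`.
  have hq1 : q ≤ 1 - g / 4 := by
    have h1 : M.γ ≤ Real.exp (-g) := by linarith [Real.add_one_le_exp (-g)]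
    have h2 : q ≤ Real.exp (-(g / 2)) := by
      calc q ≤ Real.exp (-g) * Real.exp (g / 2) :=
            mul_le_mul_of_nonneg_right h1 (Real.exp_pos _).le
        _ = Real.exp (-(g / 2)) := by rw [← Real.exp_add]; congr 1; ring
    have h3 : |-(g / 2)| ≤ 1 := by rw [abs_neg, abs_of_pos (by linarith)]; linarith
    have := exp_le_one_add_add_sq h3
    nlinarith
  have hmeas : Measurable fun y : ℝ =>
      ENNReal.ofReal (Real.exp (|y - M.Q π x| / (2 * M.horizon))) := by fun_prop
  rw [onlineKernel_apply, lintegral_sum_measure]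
  have hterm : ∀ h : ℕ, ∫⁻ y, ENNReal.ofReal (Real.exp (|y - M.Q π x| / (2 * M.horizon)))
      ∂(ENNReal.ofReal (g * M.γ ^ h) • (M.rollout π h).snd x)
      ≤ ENNReal.ofReal (g * Real.exp 1 * q ^ h) := fun h => by
    rw [lintegral_smul_measure, Kernel.snd_apply, lintegral_map hmeas measurable_snd]
    have h1 : ∫⁻ p, ENNReal.ofReal (Real.exp (|p.2 - M.Q π x| / (2 * M.horizon)))
        ∂(M.rollout π h x) ≤ ∫⁻ _, ENNReal.ofReal (Real.exp 1 * Real.exp (g / 2) ^ h)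
        ∂(M.rollout π h x) := by
      refine lintegral_mono_ae ?_
      filter_upwards [M.ae_rollout_mem π h x] with p hp
      refine ENNReal.ofReal_le_ofReal ?_
      rw [← Real.exp_nat_mul, ← Real.exp_add]
      refine Real.exp_le_exp.2 ?_
      have h2 : |p.2 - M.Q π x| ≤ h + 1 + M.horizon := by
        rw [abs_le]
        constructor
        · linarith [M.Q_le_horizon π x, hp.1, Nat.cast_nonneg (α := ℝ) h]
        · linarith [M.Q_nonneg π x, hp.2]
      calc |p.2 - M.Q π x| / (2 * M.horizon) = |p.2 - M.Q π x| * (1 / (2 * M.horizon)) := by ring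
        _ ≤ (h + 1 + M.horizon) * (1 / (2 * M.horizon)) :=
            mul_le_mul_of_nonneg_right h2 (by positivity)
        _ = h * (g / 2) + g / 2 + (M.horizon * g) / 2 := by rw [hHg]; ring
        _ ≤ 1 + h * (g / 2) := by rw [hg, M.horizon_mul, ← hg]; linarith
    refine (mul_le_mul_right h1 _).trans ?_
    rw [lintegral_const, measure_univ, mul_one, ← ENNReal.ofReal_mul
      (mul_nonneg hg0.le (pow_nonneg M.γ_pos.le h))]
    refine le_of_eq ?_
    congr 1
    rw [hq, mul_pow]; ring
  rw [← hg]
  refine (ENNReal.tsum_le_tsum hterm).trans ?_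
  have hqlt : q < 1 := by linarith
  rw [← ENNReal.ofReal_tsum_of_nonneg (fun h => by positivity)
    ((summable_geometric_of_lt_one hq0.le hqlt).mul_left _), tsum_mul_left,
    tsum_geometric_of_lt_one hq0.le hqlt]
  refine ENNReal.ofReal_le_ofReal ?_
  rw [← div_eq_mul_inv, div_le_iff₀ (by linarith)]
  have := Real.exp_one_lt_d9
  nlinarith

theorem isRegression_online (π : Policy S A) :
    IsRegression (M.onlineKernel π) (fun p => p.2) (M.Q π) M.horizon := by
  have hm : ∀ x, Measurable fun y : ℝ => Real.exp (|y - M.Q π x| / (2 * M.horizon)) :=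
    fun x => by fun_prop
  have hint : ∀ x, Integrable (fun y : ℝ => Real.exp (|y - M.Q π x| / (2 * M.horizon)))
      (M.onlineKernel π x) := fun x => by
    refine ⟨(hm x).aestronglyMeasurable, ?_⟩
    rw [hasFiniteIntegral_iff_ofReal (Filter.Eventually.of_forall fun y => (Real.exp_pos _).le)]
    exact (M.lintegral_exp_onlineKernel_le π x).trans_lt ENNReal.ofReal_lt_top
  refine ⟨measurable_snd, M.measurable_Q π, hint, fun x => ?_, fun x => ?_⟩
  · have := M.lintegral_exp_onlineKernel_le π x
    rw [← ofReal_integral_eq_lintegral_ofReal (hint x)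
      (Filter.Eventually.of_forall fun y => (Real.exp_pos _).le)] at this
    exact (ENNReal.ofReal_le_ofReal_iff (by norm_num)).1 this
  · have hsub : Integrable (fun y : ℝ => y - M.Q π x) (M.onlineKernel π x) := by
      refine ((hint x).const_mul (2 * M.horizon)).mono' (by fun_prop)
        (Filter.Eventually.of_forall fun y => ?_)
      have h1 := Real.add_one_le_exp (|y - M.Q π x| / (2 * M.horizon))
      have h2 : |y - M.Q π x| / (2 * M.horizon)
          ≤ Real.exp (|y - M.Q π x| / (2 * M.horizon)) := by linarith
      rw [div_le_iff₀ (by linarith [M.horizon_pos])] at h2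
      rw [Real.norm_eq_abs]
      linarith
    have hy : Integrable (fun y : ℝ => y) (M.onlineKernel π x) := by
      have := hsub.add (integrable_const (M.Q π x))
      refine this.congr (Filter.Eventually.of_forall fun y => ?_)
      simp
    simp only
    rw [integral_sub hy (integrable_const _)]
    simp only [integral_const, probReal_univ, smul_eq_mul, one_mul]
    rw [sub_eq_zero]
    rw [onlineKernel_apply] at hy ⊢
    rw [integral_sum_measure hy, ← (M.one_sub_gamma_mul_tsum_sum_rewardAt π x).tsum_eq]
    refine tsum_congr fun h => ?_
    rw [integral_smul_measure, ENNReal.toReal_ofReal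
      (mul_nonneg M.one_sub_pos.le (pow_nonneg M.γ_pos.le h)), Kernel.snd_apply,
      integral_map measurable_snd.aemeasurable
        (f := fun y : ℝ => y) measurable_id.aestronglyMeasurable, integral_rollout_snd,
      smul_eq_mul]

end MDP

end

/-! ### Exponential weights and the performance difference -/

section

/-- Regret of exponential weights against a fixed action. -/
theorem exponential_weights_regret {A : Type*} [Fintype A] {T : ℕ} {p : ℕ → A → ℝ} {f : ℕ → A → ℝ}
    {η H : ℝ} (hη : 0 ≤ η) (hηH : η * H ≤ 1) (hf : ∀ t ∈ Finset.Icc 1 T, ∀ a, |f t a| ≤ H)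
    (hp0 : ∀ t a, 0 ≤ p t a) (hp1 : ∀ t, ∑ a, p t a = 1)
    (hinit : ∀ a, p 1 a = 1 / (Fintype.card A : ℝ))
    (hstep : ∀ t ∈ Finset.Icc 1 T, ∀ a, p (t + 1) a
      = p t a * Real.exp (η * f t a) / ∑ b, p t b * Real.exp (η * f t b)) (a : A) :
    η * ∑ t ∈ Finset.Icc 1 T, (f t a - ∑ b, p t b * f t b)
      ≤ Real.log (Fintype.card A) + T * (η * H) ^ 2 := by
  have hcard : 0 < (Fintype.card A : ℝ) := by
    have : Nonempty A := ⟨a⟩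
    exact_mod_cast Fintype.card_pos
  have hηf : ∀ t ∈ Finset.Icc 1 T, ∀ b, |η * f t b| ≤ η * H := fun t ht b => by
    rw [abs_mul, abs_of_nonneg hη]; exact mul_le_mul_of_nonneg_left (hf t ht b) hη
  set Z : ℕ → ℝ := fun t => ∑ b, p t b * Real.exp (η * f t b) with hZ
  have hZpos : ∀ t ∈ Finset.Icc 1 T, 0 < Z t := fun t ht => by
    have h1 : Real.exp (-(η * H)) ≤ Z t := by
      calc Real.exp (-(η * H)) = ∑ b, p t b * Real.exp (-(η * H)) := by
            rw [← Finset.sum_mul, hp1, one_mul]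
        _ ≤ Z t := Finset.sum_le_sum fun b _ => mul_le_mul_of_nonneg_left
            (Real.exp_le_exp.2 (abs_le.1 (hηf t ht b)).1) (hp0 t b)
    exact (Real.exp_pos _).trans_le h1
  have hZle : ∀ t ∈ Finset.Icc 1 T,
      Z t ≤ Real.exp (η * (∑ b, p t b * f t b) + (η * H) ^ 2) := fun t ht => by
    have h1 : ∀ b, Real.exp (η * f t b) ≤ 1 + η * f t b + (η * H) ^ 2 := fun b => by
      have h2 := exp_le_one_add_add_sq ((hηf t ht b).trans hηH)
      have h3 := pow_le_pow_left₀ (abs_nonneg _) (hηf t ht b) 2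
      rw [sq_abs] at h3
      linarith
    calc Z t ≤ ∑ b, p t b * (1 + η * f t b + (η * H) ^ 2) :=
          Finset.sum_le_sum fun b _ => mul_le_mul_of_nonneg_left (h1 b) (hp0 t b)
      _ = η * (∑ b, p t b * f t b) + (η * H) ^ 2 + 1 := by
          have : ∀ b, p t b * (1 + η * f t b + (η * H) ^ 2)
              = p t b * (1 + (η * H) ^ 2) + η * (p t b * f t b) := fun b => by ring
          simp_rw [this]
          rw [Finset.sum_add_distrib, ← Finset.sum_mul, hp1, ← Finset.mul_sum]
          ring
      _ ≤ _ := Real.add_one_le_exp _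
  -- Unrolling the updates: the probability of `a` times all normalizers is the initial probability
  -- times the exponentiated gain of `a`. Since probabilities are at most `1`, this bounds the gain
  -- of `a` by the product of the normalizers.
  have hprod : ∀ n ≤ T, p (n + 1) a * ∏ t ∈ Finset.Icc 1 n, Z t
      = 1 / (Fintype.card A : ℝ) * Real.exp (η * ∑ t ∈ Finset.Icc 1 n, f t a) := by
    intro n hn
    induction n with
    | zero => simp [hinit]
    | succ n ih =>
      have hmem : n + 1 ∈ Finset.Icc 1 T := Finset.mem_Icc.2 ⟨by omega, hn⟩
      rw [Finset.prod_Icc_succ_top (by omega), Finset.sum_Icc_succ_top (by omega), mul_add,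
        Real.exp_add, ← mul_assoc (1 / (Fintype.card A : ℝ)), ← ih (by omega), hstep _ hmem]
      have := (hZpos _ hmem).ne'
      simp only [hZ] at this ⊢
      field_simp
  have hmain := hprod T le_rfl
  have hple : p (T + 1) a ≤ 1 := by
    rw [← hp1 (T + 1)]
    exact Finset.single_le_sum (fun b _ => hp0 (T + 1) b) (Finset.mem_univ a)
  have hPle : ∏ t ∈ Finset.Icc 1 T, Z t
      ≤ Real.exp (∑ t ∈ Finset.Icc 1 T, (η * (∑ b, p t b * f t b) + (η * H) ^ 2)) := by
    rw [Real.exp_sum]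
    exact Finset.prod_le_prod (fun t ht => (hZpos t ht).le) hZle
  have hfin : 1 / (Fintype.card A : ℝ) * Real.exp (η * ∑ t ∈ Finset.Icc 1 T, f t a)
      ≤ Real.exp (∑ t ∈ Finset.Icc 1 T, (η * (∑ b, p t b * f t b) + (η * H) ^ 2)) := by
    rw [← hmain]
    refine (mul_le_of_le_one_left (Finset.prod_nonneg fun t ht => (hZpos t ht).le) hple).trans hPle
  have hfin2 : Real.exp (η * ∑ t ∈ Finset.Icc 1 T, f t a)
      ≤ Real.exp (Real.log (Fintype.card A)
        + ∑ t ∈ Finset.Icc 1 T, (η * (∑ b, p t b * f t b) + (η * H) ^ 2)) := by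
    rw [Real.exp_add, Real.exp_log hcard]
    rwa [one_div, inv_mul_le_iff₀ hcard] at hfin
  have hlog := Real.exp_le_exp.1 hfin2
  rw [Finset.sum_add_distrib, ← Finset.mul_sum, Finset.sum_const, Nat.card_Icc, nsmul_eq_mul]
    at hlog
  rw [Finset.sum_sub_distrib, mul_sub]
  simp only [Nat.add_sub_cancel] at hlog
  linarith

namespace MDP

variable (M : MDP S A)

/-- Performance difference through an arbitrary critic `f`. -/
theorem V_sub_V_eq (πe π : Policy S A) {f : S × A → ℝ} {C : ℝ} (hf : Measurable f)
    (hC : ∀ x, |f x| ≤ C) :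
    M.V πe - M.V π = M.horizon * (∫ x, (M.bellman π f x - f x) ∂(M.occupancy πe)
      + ∫ x, (f x - M.bellman π f x) ∂(M.occupancy π)
      + M.γ * ∫ x, (M.next πe f x - M.next π f x) ∂(M.occupancy πe)) := by
  have h1 := M.V_sub_integral_reset πe hf hC
  have h2 := M.V_sub_integral_reset π hf hC
  have hn : ∀ π' π'' : Policy S A, Integrable (M.next π' f) (M.occupancy π'') := fun π' π'' =>
    integrable_of_bounded (M.measurable_next π' hf) (M.abs_next_le π' hC)
  have hfi : ∀ π'' : Policy S A, Integrable f (M.occupancy π'') := fun π'' =>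
    integrable_of_bounded hf hC
  have hb : ∀ π' π'' : Policy S A, Integrable (fun x => M.bellman π' f x - f x)
      (M.occupancy π'') := fun π' π'' =>
    ((integrable_of_bounded M.measurable_reward M.abs_reward_le).add
      ((hn π' π'').const_mul _)).sub (hfi π'')
  -- Passing from the Bellman operator of `πe` to that of `π` changes only the action drawn after
  -- the transition.
  have h3 : ∫ x, (M.bellman πe f x - f x) ∂(M.occupancy πe)
      = ∫ x, (M.bellman π f x - f x) ∂(M.occupancy πe)
        + M.γ * ∫ x, (M.next πe f x - M.next π f x) ∂(M.occupancy πe) := by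
    have hd : Integrable (fun x => M.γ * (M.next πe f x - M.next π f x)) (M.occupancy πe) :=
      ((hn πe πe).sub (hn π πe)).const_mul _
    rw [← integral_const_mul, ← integral_add (hb π πe) hd]
    refine integral_congr_ae (Filter.Eventually.of_forall fun x => ?_)
    simp only [bellman_eq]
    ring
  have h4 : ∫ x, (f x - M.bellman π f x) ∂(M.occupancy π)
      = - ∫ x, (M.bellman π f x - f x) ∂(M.occupancy π) := by
    rw [← integral_neg]
    refine integral_congr_ae (Filter.Eventually.of_forall fun x => ?_)
    simp only
    ring
  rw [h4]
  rw [h3] at h1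
  linear_combination h1 - h2

/-- The regret part of the performance difference under softmax updates. -/
theorem sum_integral_next_sub_le [Fintype A] [MeasurableSingletonClass A] {T : ℕ} (hT : 1 ≤ T)
    (hA : 2 ≤ Fintype.card A) (hTA : Real.log (Fintype.card A) ≤ T)
    {pol : ℕ → Policy S A} {f : ℕ → S × A → ℝ}
    (hfm : ∀ t ∈ Finset.Icc 1 T, Measurable (f t))
    (hfb : ∀ t ∈ Finset.Icc 1 T, ∀ x, |f t x| ≤ M.horizon)
    (hinit : ∀ s a, (pol 1).prob s a = 1 / (Fintype.card A : ℝ))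
    (hstep : ∀ t ∈ Finset.Icc 1 T, ∀ s a, (pol (t + 1)).prob s a = (pol t).prob s a
      * Real.exp ((1 - M.γ) * √(Real.log (Fintype.card A) / T) * f t (s, a))
        / ∑ b, (pol t).prob s b
          * Real.exp ((1 - M.γ) * √(Real.log (Fintype.card A) / T) * f t (s, b)))
    (πe : Policy S A) :
    ∑ t ∈ Finset.Icc 1 T, ∫ x, (M.next πe (f t) x - M.next (pol t) (f t) x) ∂(M.occupancy πe)
      ≤ 2 * M.horizon * √(Real.log (Fintype.card A) * T) := by
  set L := Real.log (Fintype.card A) with hL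
  have hLpos : 0 < L := Real.log_pos (by exact_mod_cast hA)
  have hTpos : (0 : ℝ) < T := by exact_mod_cast hT
  set r := √(L / T) with hr
  have hrpos : 0 < r := Real.sqrt_pos.2 (by positivity)
  have hr2 : r ^ 2 = L / T := Real.sq_sqrt (by positivity)
  -- This is where `log |A| ≤ T` matters: the exponents `η f` have absolute value at most `η H = r`,
  -- and the regret bound needs `r ≤ 1`.
  have hr1 : r ≤ 1 := by
    exact Real.sqrt_le_one.2 ((div_le_one hTpos).2 hTA)
  have hLT : √(L * T) = T * r := by
    rw [Real.sqrt_eq_iff_mul_self_eq (by positivity) (by positivity)]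
    have : T * r * (T * r) = T ^ 2 * r ^ 2 := by ring
    rw [this, hr2]; field_simp
  set η := (1 - M.γ) * r with hη
  have hηH : η * M.horizon = r := by
    have := M.horizon_mul
    calc η * M.horizon = r * (M.horizon * (1 - M.γ)) := by rw [hη]; ring
      _ = r := by rw [this, mul_one]
  have hηpos : 0 < η := mul_pos M.one_sub_pos hrpos
  have hact : ∀ s a, ∑ t ∈ Finset.Icc 1 T, (f t (s, a) - (pol t).avg (f t) s)
      ≤ 2 * M.horizon * √(L * T) := fun s a => by
    have h := exponential_weights_regret (T := T) (p := fun t a => (pol t).prob s a)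
      (f := fun t a => f t (s, a)) (η := η) (H := M.horizon) hηpos.le (hηH.trans_le hr1)
      (fun t ht a => hfb t ht (s, a)) (fun t a => (pol t).prob_nonneg s a)
      (fun t => (pol t).sum_prob s) (hinit s) (fun t ht a => hstep t ht s a) a
    rw [hηH, hr2, ← hL] at h
    -- The step size balances the two parts of the regret: both equal `L = T * r ^ 2`.
    have h1 : L + T * (L / T) = η * (2 * M.horizon * √(L * T)) := by
      have : L = T * r ^ 2 := by rw [hr2]; field_simp
      calc L + T * (L / T) = 2 * (T * r ^ 2) := by rw [← this]; field_simp; ring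
        _ = (η * M.horizon) * (2 * (T * r)) := by rw [hηH]; ring
        _ = _ := by rw [hLT]; ring
    rw [h1] at h
    exact le_of_mul_le_mul_left h hηpos
  have havg : ∀ s, ∑ t ∈ Finset.Icc 1 T, (πe.avg (f t) s - (pol t).avg (f t) s)
      ≤ 2 * M.horizon * √(L * T) := fun s => by
    have h1 : ∑ t ∈ Finset.Icc 1 T, (πe.avg (f t) s - (pol t).avg (f t) s)
        = ∑ a, πe.prob s a * ∑ t ∈ Finset.Icc 1 T, (f t (s, a) - (pol t).avg (f t) s) := by
      simp_rw [Finset.mul_sum]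
      rw [Finset.sum_comm]
      refine Finset.sum_congr rfl fun t _ => ?_
      simp_rw [mul_sub]
      rw [Finset.sum_sub_distrib, ← Finset.sum_mul, πe.sum_prob, one_mul]
      rfl
    rw [h1]
    calc _ ≤ ∑ a, πe.prob s a * (2 * M.horizon * √(L * T)) := Finset.sum_le_sum fun a _ =>
          mul_le_mul_of_nonneg_left (hact s a) (πe.prob_nonneg s a)
      _ = _ := by rw [← Finset.sum_mul, πe.sum_prob, one_mul]
  have hn : ∀ t ∈ Finset.Icc 1 T, ∀ π' : Policy S A, Integrable (M.next π' (f t))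
      (M.occupancy πe) := fun t ht π' =>
    integrable_of_bounded (M.measurable_next π' (hfm t ht)) (M.abs_next_le π' (hfb t ht))
  have hnd : ∀ t ∈ Finset.Icc 1 T, Integrable
      (fun x => M.next πe (f t) x - M.next (pol t) (f t) x) (M.occupancy πe) := fun t ht =>
    (hn t ht πe).sub (hn t ht (pol t))
  rw [← integral_finsetSum _ hnd]
  have hpt : ∀ x, ∑ t ∈ Finset.Icc 1 T, (M.next πe (f t) x - M.next (pol t) (f t) x)
      ≤ 2 * M.horizon * √(L * T) := fun x => by
    have havgi : ∀ t ∈ Finset.Icc 1 T, ∀ π' : Policy S A, Integrable (π'.avg (f t))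
        (M.transition x) := fun t ht π' =>
      integrable_of_bounded (π'.measurable_avg (hfm t ht)) (π'.abs_avg_le (hfb t ht))
    have havgd : ∀ t ∈ Finset.Icc 1 T, Integrable
        (fun s => πe.avg (f t) s - (pol t).avg (f t) s) (M.transition x) := fun t ht =>
      (havgi t ht πe).sub (havgi t ht (pol t))
    have h1 : ∑ t ∈ Finset.Icc 1 T, (M.next πe (f t) x - M.next (pol t) (f t) x)
        = ∫ s, ∑ t ∈ Finset.Icc 1 T, (πe.avg (f t) s - (pol t).avg (f t) s)
          ∂(M.transition x) := by
      rw [integral_finsetSum _ havgd]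
      refine Finset.sum_congr rfl fun t ht => ?_
      rw [integral_sub (havgi t ht πe) (havgi t ht (pol t)),
        M.next_eq_integral_avg πe (hfm t ht) (hfb t ht),
        M.next_eq_integral_avg (pol t) (hfm t ht) (hfb t ht)]
    rw [h1]
    have := integral_mono (integrable_finsetSum _ havgd) (integrable_const (μ := M.transition x) _)
      (fun s => by simpa using havg s)
    simpa using this
  have := integral_mono (integrable_finsetSum _ hnd) (integrable_const (μ := M.occupancy πe) _)
    (fun s => by simpa using hpt s)
  simpa using this

end MDP

end

/-! ### Adapted randomness and the weight of one iteration -/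

section

/-- A map of finite range all of whose fibres are measurable. -/
def FinMeas {Ω I : Type*} (m : MeasurableSpace Ω) (φ : Ω → I) : Prop :=
  (Set.range φ).Finite ∧ ∀ i, MeasurableSet[m] (φ ⁻¹' {i})

section FinMeas

variable {Ω I J D : Type*} {m m' : MeasurableSpace Ω}

theorem FinMeas.pi [Finite J] {I : J → Type*} {φ : ∀ j, Ω → I j} (h : ∀ j, FinMeas m (φ j)) :
    FinMeas m fun ω j => φ j ω := by
  refine ⟨(Set.Finite.pi' fun j => (h j).1).subset ?_, fun i => ?_⟩
  · rintro _ ⟨ω, rfl⟩ j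
    exact ⟨ω, rfl⟩
  · have : (fun ω j => φ j ω) ⁻¹' {i} = ⋂ j, φ j ⁻¹' {i j} := by
      ext ω; simp [funext_iff]
    rw [this]
    have : Countable J := Finite.to_countable
    exact MeasurableSet.iInter fun j => (h j).2 (i j)

/-- A fibre of `ψ` is a finite union of fibres of `φ`. No σ-algebra on the target is needed, which
matters for policies and for functions on `S × A`. -/
theorem FinMeas.of_determined {φ : Ω → I} {ψ : Ω → J} (h : FinMeas m φ)
    (hd : ∀ ω ω', φ ω = φ ω' → ψ ω = ψ ω') : FinMeas m ψ := by
  have hfac : ∀ ω, ψ ω = ψ (Classical.choose (⟨ω, rfl⟩ : ∃ ω', φ ω' = φ ω)) := fun ω =>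
    hd _ _ (Classical.choose_spec (⟨ω, rfl⟩ : ∃ ω', φ ω' = φ ω)).symm
  refine ⟨?_, fun i => ?_⟩
  · classical
    rcases isEmpty_or_nonempty Ω with hΩ | ⟨⟨ω₀⟩⟩
    · rw [Set.range_eq_empty]; exact Set.finite_empty
    · refine (h.1.image (fun c => if hc : ∃ ω', φ ω' = c then ψ hc.choose else ψ ω₀)).subset ?_
      rintro _ ⟨ω, rfl⟩
      refine ⟨φ ω, ⟨ω, rfl⟩, ?_⟩
      have hc : ∃ ω', φ ω' = φ ω := ⟨ω, rfl⟩
      simp only [hc, dif_pos]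
      exact (hfac ω).symm
  · have : ψ ⁻¹' {i} = ⋃ c ∈ φ '' (ψ ⁻¹' {i}), φ ⁻¹' {c} := by
      ext ω
      simp only [Set.mem_preimage, Set.mem_singleton_iff, Set.mem_iUnion, Set.mem_image,
        exists_prop]
      constructor
      · intro hω
        exact ⟨φ ω, ⟨ω, hω, rfl⟩, rfl⟩
      · rintro ⟨c, ⟨ω', hω', rfl⟩, hc⟩
        rw [hd ω ω' hc, hω']
    rw [this]
    exact Set.Finite.measurableSet_biUnion
      (h.1.subset (Set.image_subset_range _ _)) fun c _ => h.2 c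

theorem FinMeas.prodMk {φ : Ω → I} {ψ : Ω → J} (h : FinMeas m φ) (h' : FinMeas m ψ) :
    FinMeas m fun ω => (φ ω, ψ ω) := by
  refine ⟨(h.1.prod h'.1).subset ?_, fun i => ?_⟩
  · rintro _ ⟨ω, rfl⟩
    exact ⟨⟨ω, rfl⟩, ⟨ω, rfl⟩⟩
  · have : (fun ω => (φ ω, ψ ω)) ⁻¹' {i} = φ ⁻¹' {i.1} ∩ ψ ⁻¹' {i.2} := by
      ext ω; simp [Prod.ext_iff]
    rw [this]
    exact (h.2 _).inter (h'.2 _)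

theorem FinMeas.mono {φ : Ω → I} (h : FinMeas m φ) (hm : m ≤ m') : FinMeas m' φ :=
  ⟨h.1, fun i => hm _ (h.2 i)⟩

theorem FinMeas.measurable_comp {E : Type*} [MeasurableSpace D] [MeasurableSpace E] {φ : Ω → I}
    (h : FinMeas m φ) {d : Ω → D} (hd : Measurable[m] d) {g : I → D → E}
    (hg : ∀ i, Measurable (g i)) : Measurable[m] fun ω => g (φ ω) (d ω) := by
  intro s hs
  have : (fun ω => g (φ ω) (d ω)) ⁻¹' s
      = ⋃ c ∈ Set.range φ, φ ⁻¹' {c} ∩ d ⁻¹' (g c ⁻¹' s) := by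
    ext ω
    simp only [Set.mem_preimage, Set.mem_iUnion, Set.mem_inter_iff, Set.mem_singleton_iff,
      exists_prop]
    constructor
    · intro hω; exact ⟨φ ω, ⟨ω, rfl⟩, rfl, hω⟩
    · rintro ⟨c, _, rfl, hω⟩; exact hω
  rw [this]
  exact Set.Finite.measurableSet_biUnion h.1 fun c _ => (h.2 c).inter (hd (hg c hs))

/-- If `d` is drawn from `law (φ ω)` given a past to which `φ` and `X` belong, then integrating out
`d` costs at most the factor `K`. -/
theorem lintegral_mul_fresh_le {past : MeasurableSpace Ω} [mΩ : MeasurableSpace Ω]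
    [MeasurableSpace D] {P : Measure Ω} [IsFiniteMeasure P] (hpast : past ≤ mΩ) {X : Ω → ℝ≥0∞}
    (hX : Measurable[past] X) {φ : Ω → I} (hφ : FinMeas past φ) {d : Ω → D} (hd : Measurable d)
    {law : I → Measure D} [∀ i, IsProbabilityMeasure (law i)]
    (hlaw : ∀ E, MeasurableSet[past] E → ∀ B, MeasurableSet B →
      P (E ∩ d ⁻¹' B) = ∫⁻ ω in E, law (φ ω) B ∂P)
    {g : I → D → ℝ≥0∞} (hg : ∀ i, Measurable (g i)) {K : ℝ≥0∞}
    (hK : ∀ ω, ∫⁻ x, g (φ ω) x ∂(law (φ ω)) ≤ K) :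
    ∫⁻ ω, X ω * g (φ ω) (d ω) ∂P ≤ K * ∫⁻ ω, X ω ∂P := by
  classical
  have hXm : Measurable X := hX.mono hpast le_rfl
  have hfib : ∀ c, MeasurableSet (φ ⁻¹' {c}) := fun c => hpast _ (hφ.2 c)
  have hpiece : ∀ c ∈ hφ.1.toFinset, ∫⁻ ω in φ ⁻¹' {c}, X ω * g (φ ω) (d ω) ∂P
      ≤ K * ∫⁻ ω in φ ⁻¹' {c}, X ω ∂P := by
    intro c hc
    obtain ⟨ω₀, hω₀⟩ := (Set.Finite.mem_toFinset _).1 hc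
    have h1 : ∫⁻ ω in φ ⁻¹' {c}, X ω * g (φ ω) (d ω) ∂P
        = ∫⁻ ω in φ ⁻¹' {c}, X ω * g c (d ω) ∂P :=
      setLIntegral_congr_fun (hfib c) fun ω hω => by
        rw [Set.mem_preimage, Set.mem_singleton_iff] at hω
        simp only [hω]
    -- On a fibre of `φ` the conditional law of `d` is a fixed measure, so `X` and `d` are
    -- independent there and the integral factors.
    have h2 : ((P.restrict (φ ⁻¹' {c})).map X).prod (law c)
        = (P.restrict (φ ⁻¹' {c})).map fun ω => (X ω, d ω) := by
      refine Measure.prod_eq fun s t hs ht => ?_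
      rw [Measure.map_apply (hXm.prodMk hd) (hs.prod ht), Measure.map_apply hXm hs,
        Measure.restrict_apply ((hXm.prodMk hd) (hs.prod ht)), Measure.restrict_apply (hXm hs)]
      have h3 : (fun ω => (X ω, d ω)) ⁻¹' s ×ˢ t ∩ φ ⁻¹' {c}
          = (X ⁻¹' s ∩ φ ⁻¹' {c}) ∩ d ⁻¹' t := by
        ext ω; simp only [Set.mem_inter_iff, Set.mem_preimage, Set.mem_prod]; tauto
      rw [h3, hlaw _ ((hX hs).inter (hφ.2 c)) t ht]
      have h4 : ∫⁻ ω in X ⁻¹' s ∩ φ ⁻¹' {c}, law (φ ω) t ∂P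
          = ∫⁻ _ in X ⁻¹' s ∩ φ ⁻¹' {c}, law c t ∂P :=
        setLIntegral_congr_fun ((hXm hs).inter (hfib c)) fun ω hω => by
          have := hω.2
          rw [Set.mem_preimage, Set.mem_singleton_iff] at this
          simp only [this]
      rw [h4, setLIntegral_const, mul_comm]
    have h5 : ∫⁻ ω in φ ⁻¹' {c}, X ω * g c (d ω) ∂P
        = ∫⁻ p : ℝ≥0∞ × D, p.1 * g c p.2 ∂((P.restrict (φ ⁻¹' {c})).map fun ω => (X ω, d ω)) := by
      have hm : Measurable fun p : ℝ≥0∞ × D => p.1 * g c p.2 :=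
        measurable_fst.mul ((hg c).comp measurable_snd)
      rw [lintegral_map hm (hXm.prodMk hd)]
    have h6 := lintegral_prod_mul (μ := (P.restrict (φ ⁻¹' {c})).map X) (ν := law c)
      (f := fun x : ℝ≥0∞ => x) (g := g c) measurable_id.aemeasurable (hg c).aemeasurable
    rw [h1, h5, ← h2, h6, lintegral_map (f := fun x : ℝ≥0∞ => x) measurable_id hXm, mul_comm]
    refine mul_le_mul_left ?_ _
    rw [← hω₀]
    exact hK ω₀
  have hsplit : ∀ Y : Ω → ℝ≥0∞, ∫⁻ ω, Y ω ∂P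
      = ∑ c ∈ hφ.1.toFinset, ∫⁻ ω in φ ⁻¹' {c}, Y ω ∂P := fun Y => by
    rw [← lintegral_biUnion_finset]
    · have : (⋃ c ∈ hφ.1.toFinset, φ ⁻¹' {c}) = Set.univ := by
        ext ω; simp
      rw [this, setLIntegral_univ]
    · intro c _ c' _ hcc'
      refine Set.disjoint_left.2 fun ω hω hω' => hcc' ?_
      rw [Set.mem_preimage, Set.mem_singleton_iff] at hω hω'
      rw [← hω, hω']
    · exact fun c _ => hfib c
  rw [hsplit, hsplit X, Finset.mul_sum]
  exact Finset.sum_le_sum hpiece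

/-- The expectation of a product of adapted factors, each of conditional mean at most `K`. -/
theorem lintegral_prod_adapted_le [MeasurableSpace Ω] {P : Measure Ω} [IsProbabilityMeasure P]
    {N : ℕ} {past : ℕ → MeasurableSpace Ω} {W : ℕ → Ω → ℝ≥0∞} {K : ℝ≥0∞}
    (hW : ∀ n < N, ∀ j < n, Measurable[past n] (W j))
    (hK : ∀ n < N, ∀ X : Ω → ℝ≥0∞, Measurable[past n] X →
      ∫⁻ ω, X ω * W n ω ∂P ≤ K * ∫⁻ ω, X ω ∂P) :
    ∀ n ≤ N, ∫⁻ ω, ∏ j ∈ Finset.range n, W j ω ∂P ≤ K ^ n := by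
  intro n hn
  induction n with
  | zero => simp
  | succ n ih =>
    simp_rw [Finset.prod_range_succ]
    refine (hK n (by omega) _ ?_).trans ?_
    · exact Finset.measurable_fun_prod (m := past n) _ fun j hj =>
        hW n (by omega) j (Finset.mem_range.1 hj)
    · rw [pow_succ, mul_comm]
      exact mul_le_mul_left (ih (by omega)) _

end FinMeas

namespace MDP

/-- The exponent for the excess on-policy loss of `f`. -/
def onDev (M : MDP S A) {moff mon : ℕ} (θ α σ : ℝ) (π : Policy S A) (f : S × A → ℝ)
    (D : Dataset S A moff mon) : ℝ :=
  θ * (σ * ∑ i, excess (fun p => p.2) (M.Q π) f (D.2 i)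
    - mon * ((σ + α) * ∫ x, (f x - M.Q π x) ^ 2 ∂(M.occupancy π)))

theorem measurable_onDev {M : MDP S A} {moff mon : ℕ} {θ α σ : ℝ} {π : Policy S A}
    {f : S × A → ℝ} (hf : Measurable f) :
    Measurable fun D : Dataset S A moff mon => M.onDev θ α σ π f D := by
  have hr := M.isRegression_online π
  have := measurable_excess hr.measurable_target hr.measurable_mean hf
  unfold onDev
  fun_prop

variable [Fintype A] (M : MDP S A)

/-- The exponent for the excess offline loss of `f`. -/
def offDev (ν : Measure (S × A)) {moff mon : ℕ} (θ α σ : ℝ) (π : Policy S A) (g f : S × A → ℝ)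
    (D : Dataset S A moff mon) : ℝ :=
  θ * (σ * ∑ i, excess (M.offlineTarget π g) (M.bellman π g) f (D.1 i)
    - moff * ((σ + α) * ∫ x, (f x - M.bellman π g x) ^ 2 ∂ν))

/-- The total exponential weight of the deviations of one iteration. -/
def stepWeight (F : Finset (S × A → ℝ)) (ν : Measure (S × A)) {moff mon : ℕ} (θ α : ℝ)
    (π : Policy S A) (g : S × A → ℝ) (D : Dataset S A moff mon) : ℝ :=
  1 + ∑ f ∈ F, (Real.exp (M.offDev ν θ α 1 π g f D) + Real.exp (M.offDev ν θ α (-1) π g f D)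
    + (Real.exp (M.onDev θ α 1 π f D) + Real.exp (M.onDev θ α (-1) π f D)))

variable {M} {F : Finset (S × A → ℝ)} {ν : Measure (S × A)} {moff mon : ℕ} {θ α σ : ℝ}
  {π : Policy S A} {g f : S × A → ℝ}

/-- The summand `1` in the weight serves this purpose: logarithms of weights become nonnegative and
can act as noise levels. -/
theorem one_le_stepWeight (D : Dataset S A moff mon) : 1 ≤ M.stepWeight F ν θ α π g D :=
  le_add_of_nonneg_right (Finset.sum_nonneg fun f _ => by positivity)

theorem term_le_stepWeight (hf : f ∈ F) (D : Dataset S A moff mon) :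
    Real.exp (M.offDev ν θ α 1 π g f D) + Real.exp (M.offDev ν θ α (-1) π g f D)
    + (Real.exp (M.onDev θ α 1 π f D) + Real.exp (M.onDev θ α (-1) π f D))
      ≤ M.stepWeight F ν θ α π g D := by
  have := Finset.single_le_sum (f := fun f => Real.exp (M.offDev ν θ α 1 π g f D)
    + Real.exp (M.offDev ν θ α (-1) π g f D)
    + (Real.exp (M.onDev θ α 1 π f D) + Real.exp (M.onDev θ α (-1) π f D)))
    (fun f _ => by positivity) hf
  unfold stepWeight
  linarith

/-- The logarithm of a sum of exponentials dominates every exponent, so a single number controls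
both tails for all functions of the class. -/
theorem offDev_le_log_stepWeight (hσ : σ = 1 ∨ σ = -1) (hf : f ∈ F) (D : Dataset S A moff mon) :
    M.offDev ν θ α σ π g f D ≤ Real.log (M.stepWeight F ν θ α π g D) := by
  rw [Real.le_log_iff_exp_le (zero_lt_one.trans_le (one_le_stepWeight D))]
  refine le_trans ?_ (term_le_stepWeight hf D)
  have h1 := Real.exp_pos (M.offDev ν θ α 1 π g f D)
  have h2 := Real.exp_pos (M.offDev ν θ α (-1) π g f D)
  have h3 := Real.exp_pos (M.onDev θ α 1 π f D)
  have h4 := Real.exp_pos (M.onDev θ α (-1) π f D)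
  rcases hσ with rfl | rfl <;> linarith

theorem onDev_le_log_stepWeight (hσ : σ = 1 ∨ σ = -1) (hf : f ∈ F) (D : Dataset S A moff mon) :
    M.onDev θ α σ π f D ≤ Real.log (M.stepWeight F ν θ α π g D) := by
  rw [Real.le_log_iff_exp_le (zero_lt_one.trans_le (one_le_stepWeight D))]
  refine le_trans ?_ (term_le_stepWeight hf D)
  have h1 := Real.exp_pos (M.offDev ν θ α 1 π g f D)
  have h2 := Real.exp_pos (M.offDev ν θ α (-1) π g f D)
  have h3 := Real.exp_pos (M.onDev θ α 1 π f D)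
  have h4 := Real.exp_pos (M.onDev θ α (-1) π f D)
  rcases hσ with rfl | rfl <;> linarith

variable [MeasurableSingletonClass A]

theorem measurable_offDev (hg : Measurable g) (hgb : ∀ x, |g x| ≤ M.horizon) (hf : Measurable f) :
    Measurable fun D : Dataset S A moff mon => M.offDev ν θ α σ π g f D := by
  have hr := M.isRegression_offline π hg hgb
  have := measurable_excess hr.measurable_target hr.measurable_mean hf
  unfold offDev
  fun_prop

theorem measurable_stepWeight (hF : ∀ f ∈ F, Measurable f ∧ ∀ x, |f x| ≤ M.horizon) (hg : g ∈ F) :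
    Measurable fun D : Dataset S A moff mon => M.stepWeight F ν θ α π g D := by
  unfold stepWeight
  refine measurable_const.add (Finset.measurable_fun_sum _ fun f hf => ?_)
  have h1 := fun σ => measurable_offDev (M := M) (ν := ν) (moff := moff) (mon := mon) (θ := θ)
    (α := α) (σ := σ) (π := π) (hF g hg).1 (hF g hg).2 (hF f hf).1
  have h2 := fun σ => measurable_onDev (M := M) (moff := moff) (mon := mon) (θ := θ)
    (α := α) (σ := σ) (π := π) (hF f hf).1
  exact ((h1 1).exp.add (h1 (-1)).exp).add ((h2 1).exp.add (h2 (-1)).exp)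

instance [IsProbabilityMeasure ν] : IsProbabilityMeasure (M.offlineLaw ν) := by
  unfold offlineLaw; infer_instance

instance : IsProbabilityMeasure (M.onlineLaw π) := by
  rw [onlineLaw_eq]; infer_instance

instance [IsProbabilityMeasure ν] : IsProbabilityMeasure (M.dataLaw ν moff mon π) := by
  unfold MDP.dataLaw; infer_instance

/-- The union bound over the class, at the level of expectations: each function contributes four
exponentials of mean at most `1`. The bound depends neither on `π` nor on `g`, so it also holds
conditionally on the past. -/
theorem lintegral_stepWeight_le [IsProbabilityMeasure ν]
    (hF : ∀ f ∈ F, Measurable f ∧ ∀ x, |f x| ≤ M.horizon) (hg : g ∈ F)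
    (hθ : 0 ≤ θ) (hα : 0 ≤ α) (hα1 : α ≤ 1) (hθH : 6000 * θ * M.horizon ^ 2 ≤ α) :
    ∫⁻ D, ENNReal.ofReal (M.stepWeight F ν θ α π g D) ∂(M.dataLaw ν moff mon π)
      ≤ ENNReal.ofReal (1 + 4 * F.card) := by
  have hsig : ∀ σ : ℝ, σ = 1 ∨ σ = -1 → |σ| = 1 := by rintro σ (rfl | rfl) <;> simp
  have hmo := fun σ f (hf : f ∈ F) => measurable_offDev (M := M) (ν := ν) (moff := moff)
    (mon := mon) (θ := θ) (α := α) (σ := σ) (π := π) (hF g hg).1 (hF g hg).2 (hF f hf).1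
  have hmn := fun σ f (hf : f ∈ F) => measurable_onDev (M := M) (moff := moff) (mon := mon)
    (θ := θ) (α := α) (σ := σ) (π := π) (hF f hf).1
  have hoff : ∀ σ : ℝ, σ = 1 ∨ σ = -1 → ∀ f ∈ F,
      ∫⁻ D, ENNReal.ofReal (Real.exp (M.offDev ν θ α σ π g f D)) ∂(M.dataLaw ν moff mon π) ≤ 1 := by
    intro σ hσ f hf
    have hb : ∀ x, |f x - M.bellman π g x| ≤ 2 * M.horizon := fun x =>
      (abs_sub _ _).trans (by linarith [(hF f hf).2 x, M.abs_bellman_le π (hF g hg).2 x])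
    have h := lintegral_exp_sum_excess_le (μ := ν) moff (M.isRegression_offline π (hF g hg).1
      (hF g hg).2) M.horizon_pos hθ hα hα1 hθH (hsig σ hσ) (hF f hf).1 hb
    rw [MDP.dataLaw, lintegral_prod _ ((hmo σ f hf).exp.ennreal_ofReal.aemeasurable)]
    simp only [offDev, lintegral_const, measure_univ, mul_one]
    exact h
  have hon : ∀ σ : ℝ, σ = 1 ∨ σ = -1 → ∀ f ∈ F,
      ∫⁻ D, ENNReal.ofReal (Real.exp (M.onDev θ α σ π f D)) ∂(M.dataLaw ν moff mon π) ≤ 1 := by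
    intro σ hσ f hf
    have hb : ∀ x, |f x - M.Q π x| ≤ 2 * M.horizon := fun x =>
      (abs_sub _ _).trans (by linarith [(hF f hf).2 x, M.abs_Q_le π x])
    have h := lintegral_exp_sum_excess_le (μ := M.occupancy π) mon (M.isRegression_online π)
      M.horizon_pos hθ hα hα1 hθH (hsig σ hσ) (hF f hf).1 hb
    rw [MDP.dataLaw, lintegral_prod _ ((hmn σ f hf).exp.ennreal_ofReal.aemeasurable), onlineLaw_eq]
    simp only [onDev, lintegral_const, measure_univ, mul_one]
    exact h
  have hexp : ∀ D : Dataset S A moff mon, ENNReal.ofReal (M.stepWeight F ν θ α π g D)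
      = 1 + ∑ f ∈ F, (ENNReal.ofReal (Real.exp (M.offDev ν θ α 1 π g f D))
        + ENNReal.ofReal (Real.exp (M.offDev ν θ α (-1) π g f D))
        + (ENNReal.ofReal (Real.exp (M.onDev θ α 1 π f D))
        + ENNReal.ofReal (Real.exp (M.onDev θ α (-1) π f D)))) := fun D => by
    rw [stepWeight, ENNReal.ofReal_add zero_le_one
      (Finset.sum_nonneg fun f _ => by positivity), ENNReal.ofReal_one,
      ENNReal.ofReal_sum_of_nonneg fun f _ => by positivity]
    congr 1
    refine Finset.sum_congr rfl fun f _ => ?_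
    rw [ENNReal.ofReal_add (by positivity) (by positivity),
      ENNReal.ofReal_add (by positivity) (by positivity),
      ENNReal.ofReal_add (by positivity) (by positivity)]
  simp_rw [hexp]
  have m1 : ∀ σ, ∀ f ∈ F, Measurable fun D : Dataset S A moff mon =>
      ENNReal.ofReal (Real.exp (M.offDev ν θ α σ π g f D)) :=
    fun σ f hf => (hmo σ f hf).exp.ennreal_ofReal
  have m2 : ∀ σ, ∀ f ∈ F, Measurable fun D : Dataset S A moff mon =>
      ENNReal.ofReal (Real.exp (M.onDev θ α σ π f D)) :=
    fun σ f hf => (hmn σ f hf).exp.ennreal_ofReal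
  have hsum : ∀ f ∈ F, AEMeasurable (fun D : Dataset S A moff mon =>
      ENNReal.ofReal (Real.exp (M.offDev ν θ α 1 π g f D))
        + ENNReal.ofReal (Real.exp (M.offDev ν θ α (-1) π g f D))
        + (ENNReal.ofReal (Real.exp (M.onDev θ α 1 π f D))
        + ENNReal.ofReal (Real.exp (M.onDev θ α (-1) π f D)))) (M.dataLaw ν moff mon π) :=
    fun f hf => (((m1 1 f hf).add (m1 (-1) f hf)).add
      ((m2 1 f hf).add (m2 (-1) f hf))).aemeasurable
  rw [lintegral_add_left measurable_const, lintegral_const, measure_univ, mul_one,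
    lintegral_finsetSum' _ hsum]
  have hterm : ∀ f ∈ F, ∫⁻ D, (ENNReal.ofReal (Real.exp (M.offDev ν θ α 1 π g f D))
        + ENNReal.ofReal (Real.exp (M.offDev ν θ α (-1) π g f D))
        + (ENNReal.ofReal (Real.exp (M.onDev θ α 1 π f D))
        + ENNReal.ofReal (Real.exp (M.onDev θ α (-1) π f D)))) ∂(M.dataLaw ν moff mon π) ≤ 4 := by
    intro f hf
    have m12 : Measurable fun D : Dataset S A moff mon =>
        ENNReal.ofReal (Real.exp (M.offDev ν θ α 1 π g f D))
        + ENNReal.ofReal (Real.exp (M.offDev ν θ α (-1) π g f D)) :=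
      (m1 1 f hf).add (m1 (-1) f hf)
    rw [lintegral_add_left m12, lintegral_add_left (m1 1 f hf),
      lintegral_add_left (m2 1 f hf)]
    refine (add_le_add (add_le_add (hoff 1 (by simp) f hf) (hoff (-1) (by simp) f hf))
      (add_le_add (hon 1 (by simp) f hf) (hon (-1) (by simp) f hf))).trans ?_
    norm_num
  refine (add_le_add_right (Finset.sum_le_card_nsmul _ _ _ hterm) _).trans (le_of_eq ?_)
  rw [ENNReal.ofReal_add zero_le_one (by positivity), ENNReal.ofReal_one, nsmul_eq_mul,
    ENNReal.ofReal_mul (by norm_num), ENNReal.ofReal_natCast, mul_comm]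
  norm_num

end MDP

end

/-! ### Concentration along a run of the algorithm -/

section

theorem Icc_succ_eq_Ico (a T : ℕ) : Finset.Icc (a + 1) (a + T) = Finset.Ico (a + 1) (a + 1 + T) := by
  ext k; simp only [Finset.mem_Icc, Finset.mem_Ico]; omega

theorem sum_range_mul_div_mod {β : Type*} [AddCommMonoid β] (g : ℕ → ℕ → β) {T : ℕ} (hT : 0 < T)
    (n : ℕ) : ∑ i ∈ Finset.range (n * T), g (i / T) (i % T)
      = ∑ t ∈ Finset.range n, ∑ k ∈ Finset.range T, g t k := by
  induction n with
  | zero => simp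
  | succ n ih =>
    rw [Nat.succ_mul, Finset.sum_range_add, ih, Finset.sum_range_succ]
    congr 1
    refine Finset.sum_congr rfl fun k hk => ?_
    have hk' := Finset.mem_range.1 hk
    have h1 : (n * T + k) / T = n := by
      rw [mul_comm, Nat.mul_add_div hT, Nat.div_eq_of_lt hk', add_zero]
    have h2 : (n * T + k) % T = k := by
      rw [mul_comm, Nat.mul_add_mod, Nat.mod_eq_of_lt hk']
    rw [h1, h2]

/-- Enumeration of the pairs `(t, k)` of a square in lexicographic order. -/
theorem sum_range_sq_eq_sum_Icc {β : Type*} [AddCommMonoid β] (g : ℕ → ℕ → β) {T : ℕ}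
    (hT : 0 < T) (a : ℕ) :
    ∑ i ∈ Finset.range (T * T), g (1 + i / T) (a + 1 + i % T)
      = ∑ t ∈ Finset.Icc 1 T, ∑ k ∈ Finset.Icc (a + 1) (a + T), g t k := by
  rw [sum_range_mul_div_mod (fun t k => g (1 + t) (a + 1 + k)) hT]
  have h := Icc_succ_eq_Ico 0 T
  simp only [zero_add] at h
  rw [h, Finset.sum_Ico_eq_sum_range, Nat.add_sub_cancel_left]
  refine Finset.sum_congr rfl fun t _ => ?_
  rw [Icc_succ_eq_Ico, Finset.sum_Ico_eq_sum_range, Nat.add_sub_cancel_left]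

namespace HACRun

variable [Fintype A] {M : MDP S A} {F : Finset (S × A → ℝ)} {ν : Measure (S × A)}
  {p : HACParams} {Ω : Type w} [mΩ : MeasurableSpace Ω] {P : Measure Ω} (R : HACRun M F ν p P)

/-- The σ-algebra of everything that happened before iteration `k` of round `t`. -/
abbrev past (t k : ℕ) : MeasurableSpace Ω :=
  (⨆ q ∈ {q : ℕ × ℕ | 1 ≤ q.1 ∧ q.2 ≤ p.K2 ∧ (q.1 < t ∨ q.1 = t ∧ q.2 < k)},
    MeasurableSpace.comap (R.iter q.1 q.2) ⊤) ⊔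
  (⨆ q ∈ {q : ℕ × ℕ | 1 ≤ q.1 ∧ 1 ≤ q.2 ∧ q.2 ≤ p.K2 ∧ (q.1 < t ∨ q.1 = t ∧ q.2 < k)},
    MeasurableSpace.comap (R.data q.1 q.2) inferInstance)

theorem past_mono {t k t' k' : ℕ} (h : t < t' ∨ t = t' ∧ k ≤ k') : R.past t k ≤ R.past t' k' := by
  refine sup_le_sup ?_ ?_
  · refine biSup_mono fun q hq => ?_
    simp only [Set.mem_ofPred_eq] at hq ⊢
    omega
  · refine biSup_mono fun q hq => ?_
    simp only [Set.mem_ofPred_eq] at hq ⊢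
    omega

/-- Iterates generate their σ-algebra from all sets of functions. Since they take values in the
finite class, each preimage is a finite union of measurable fibres. -/
theorem past_le {t k : ℕ} (ht : t ∈ Finset.Icc 1 p.T) : R.past t k ≤ mΩ := by
  rw [Finset.mem_Icc] at ht
  refine sup_le (iSup₂_le fun q hq => ?_) (iSup₂_le fun q _ => (R.measurable_data q.1 q.2).comap_le)
  simp only [Set.mem_ofPred_eq] at hq
  rintro _ ⟨U, -, rfl⟩
  have : R.iter q.1 q.2 ⁻¹' U = ⋃ f ∈ (F : Set (S × A → ℝ)) ∩ U, {ω | R.iter q.1 q.2 ω = f} := by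
    ext ω
    simp only [Set.mem_preimage, Set.mem_iUnion, Set.mem_ofPred_eq, exists_prop,
      exists_eq_right', Set.mem_inter_iff, Finset.mem_coe]
    refine ⟨fun h => ⟨?_, h⟩, fun h => h.2⟩
    exact R.iter_mem q.1 (Finset.mem_Icc.2 ⟨hq.1, by omega⟩) q.2
      (Finset.mem_Icc.2 ⟨Nat.zero_le _, hq.2.1⟩) ω
  rw [this]
  exact (F.finite_toSet.subset Set.inter_subset_left).measurableSet_biUnion
    fun f _ => R.measurable_iter _ _ f

theorem measurable_data_past {t k t' k' : ℕ} (ht : 1 ≤ t) (hk : 1 ≤ k) (hk2 : k ≤ p.K2)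
    (h : t < t' ∨ t = t' ∧ k < k') : Measurable[R.past t' k'] (R.data t k) := by
  rw [measurable_iff_comap_le]
  refine le_trans ?_ le_sup_right
  exact le_iSup₂_of_le (t, k) ⟨ht, hk, hk2, h⟩ le_rfl

theorem finMeas_iter {t k t' k' : ℕ} (ht : t ∈ Finset.Icc 1 p.T) (hk2 : k ≤ p.K2)
    (h : t < t' ∨ t = t' ∧ k < k') : FinMeas (R.past t' k') (R.iter t k) := by
  refine ⟨F.finite_toSet.subset ?_, fun f => ?_⟩
  · rintro _ ⟨ω, rfl⟩
    exact R.iter_mem t ht k (Finset.mem_Icc.2 ⟨Nat.zero_le _, hk2⟩) ω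
  · have hle : MeasurableSpace.comap (R.iter t k) ⊤ ≤ R.past t' k' := by
      refine le_trans ?_ le_sup_left
      exact le_iSup₂_of_le (f := fun (q : ℕ × ℕ) _ => MeasurableSpace.comap (R.iter q.1 q.2) ⊤)
        (t, k) ⟨(Finset.mem_Icc.1 ht).1, hk2, h⟩ le_rfl
    exact hle _ ⟨{f}, trivial, rfl⟩

/-- Starting from the uniform policy, each update is deterministic given the critic. So the policy
of a round takes finitely many values and depends only on the past. -/
theorem policy_eq_of_iter_eq [Countable A] {ω ω' : Ω} {t : ℕ} (ht : t ∈ Finset.Icc 1 p.T)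
    (h : ∀ t' ∈ Finset.Icc 1 p.T, t' < t → ∀ k ∈ Finset.Icc (p.K1 + 1) p.K2,
      R.iter t' k ω = R.iter t' k ω') : R.policy t ω = R.policy t ω' := by
  induction t with
  | zero => simp at ht
  | succ t ih =>
    refine Policy.ext_prob fun s a => ?_
    rcases Nat.eq_zero_or_pos t with rfl | htpos
    · rw [zero_add, R.policy_one, R.policy_one]
    · have htm : t ∈ Finset.Icc 1 p.T := by
        rw [Finset.mem_Icc] at ht ⊢; omega
      rw [R.policy_succ t htm, R.policy_succ t htm,
        ih htm fun t' ht' htt k hk => h t' ht' (by omega) k hk]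
      have hf : ∀ x, ∑ k ∈ Finset.Icc (p.K1 + 1) p.K2, R.iter t k ω x
          = ∑ k ∈ Finset.Icc (p.K1 + 1) p.K2, R.iter t k ω' x := fun x =>
        Finset.sum_congr rfl fun k hk => by rw [h t htm (by omega) k hk]
      simp only [hf]

theorem finMeas_policy [Countable A] {t k : ℕ} (ht : t ∈ Finset.Icc 1 p.T) :
    FinMeas (R.past t k) (R.policy t) := by
  have h : ∀ q : (Finset.Ico 1 t) × (Finset.Icc (p.K1 + 1) p.K2),
      FinMeas (R.past t k) (R.iter q.1 q.2) := fun q => by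
    have h1 := Finset.mem_Ico.1 q.1.2
    have h2 := Finset.mem_Icc.1 q.2.2
    rw [Finset.mem_Icc] at ht
    exact R.finMeas_iter (Finset.mem_Icc.2 ⟨h1.1, by omega⟩) h2.2 (Or.inl h1.2)
  refine (FinMeas.pi h).of_determined fun ω ω' hωω' => R.policy_eq_of_iter_eq ht ?_
  intro t' ht' htt k hk
  exact congrFun hωω' (⟨t', Finset.mem_Ico.2 ⟨(Finset.mem_Icc.1 ht').1, htt⟩⟩, ⟨k, hk⟩)

/-- The exponential weight of the deviations in iteration `k` of round `t`. -/
def weight (θ α : ℝ) (t k : ℕ) (ω : Ω) : ℝ :=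
  M.stepWeight F ν θ α (R.policy t ω) (R.iter t (k - 1) ω) (R.data t k ω)

variable [MeasurableSingletonClass A]

theorem measurable_weight_past {θ α : ℝ} (hF : ∀ f ∈ F, Measurable f ∧ ∀ x, |f x| ≤ M.horizon)
    {t k t' k' : ℕ} (ht : t ∈ Finset.Icc 1 p.T) (hk : k ∈ Finset.Icc 1 p.K2)
    (h : t < t' ∨ t = t' ∧ k < k') :
    Measurable[R.past t' k'] (fun ω => ENNReal.ofReal (R.weight θ α t k ω)) := by
  classical
  rw [Finset.mem_Icc] at hk
  have hφ : FinMeas (R.past t' k') fun ω => (R.policy t ω, R.iter t (k - 1) ω) :=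
    ((R.finMeas_policy (k := k) ht).mono (R.past_mono (by omega))).prodMk
      (R.finMeas_iter ht (by omega) (by omega))
  have hmem : ∀ ω, R.iter t (k - 1) ω ∈ F := R.iter_mem t ht (k - 1)
    (Finset.mem_Icc.2 ⟨Nat.zero_le _, by omega⟩)
  have h := hφ.measurable_comp
    (R.measurable_data_past (Finset.mem_Icc.1 ht).1 hk.1 hk.2 h)
    -- Off the class the weight need not be measurable in the data, hence the cutoff to `0`. It has
    -- no effect, since the iterates always belong to the class.
    (g := fun c D => if c.2 ∈ F then
    ENNReal.ofReal (M.stepWeight F ν θ α c.1 c.2 D) else 0) (fun c => by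
      by_cases hc : c.2 ∈ F
      · simp only [hc, if_true]
        exact (MDP.measurable_stepWeight hF hc).ennreal_ofReal
      · simp only [hc, if_false]
        exact measurable_const)
  simp only [hmem, if_true] at h
  exact h

/-- Concentration over all averaged iterations of all rounds. -/
theorem exists_concentration_event [IsProbabilityMeasure ν] [IsProbabilityMeasure P] {θ α δ : ℝ} (hT : 1 ≤ p.T) (hK : p.K2 = p.K1 + p.T)
    (hF : ∀ f ∈ F, Measurable f ∧ ∀ x, |f x| ≤ M.horizon) (hδ : 0 < δ)
    (hθ : 0 ≤ θ) (hα : 0 ≤ α) (hα1 : α ≤ 1) (hθH : 6000 * θ * M.horizon ^ 2 ≤ α) :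
    ∃ G : Set Ω, MeasurableSet G ∧ ENNReal.ofReal (1 - δ) ≤ P G ∧ ∀ ω ∈ G,
      ∑ t ∈ Finset.Icc 1 p.T, ∑ k ∈ Finset.Icc (p.K1 + 1) p.K2, Real.log (R.weight θ α t k ω)
        ≤ p.T * p.T * Real.log (1 + 4 * F.card) + Real.log (1 / δ) := by
  set T := p.T with hTdef
  set K : ℝ := 1 + 4 * F.card with hKdef
  have hKpos : 0 < K := by positivity
  have hidx : ∀ n < T * T, 1 + n / T ∈ Finset.Icc 1 p.T ∧ p.K1 + 1 + n % T ∈ Finset.Icc 1 p.K2 ∧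
      p.K1 + 1 + n % T - 1 ≤ p.K2 := fun n hn => by
    have h1 : n / T < T := Nat.div_lt_of_lt_mul hn
    have h2 : n % T < T := Nat.mod_lt _ hT
    simp only [Finset.mem_Icc]
    generalize n / T = x at h1 ⊢
    generalize n % T = y at h2 ⊢
    omega
  have hlex : ∀ j n, j < n → 1 + j / T < 1 + n / T ∨
      1 + j / T = 1 + n / T ∧ p.K1 + 1 + j % T < p.K1 + 1 + n % T := fun j n hjn => by
    have h1 : j / T ≤ n / T := Nat.div_le_div_right hjn.le
    rcases h1.lt_or_eq with h2 | h2
    · left; omega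
    · right
      have h3 := Nat.div_add_mod j T
      have h4 := Nat.div_add_mod n T
      rw [h2] at h3
      omega
  -- The `T * T` averaged iterations are listed in lexicographic order, so that each weight is
  -- measurable with respect to the past of every later one.
  set W : ℕ → Ω → ℝ≥0∞ := fun n ω =>
    ENNReal.ofReal (R.weight θ α (1 + n / T) (p.K1 + 1 + n % T) ω) with hW
  have hWm : ∀ n < T * T, Measurable (W n) := fun n hn =>
    (R.measurable_weight_past hF (hidx n hn).1 (hidx n hn).2.1
      (Or.inr ⟨rfl, Nat.lt_succ_self _⟩)).mono (R.past_le (hidx n hn).1) le_rfl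
  have hprod : ∫⁻ ω, ∏ j ∈ Finset.range (T * T), W j ω ∂P ≤ ENNReal.ofReal K ^ (T * T) := by
    refine lintegral_prod_adapted_le (N := T * T)
      (past := fun n => R.past (1 + n / T) (p.K1 + 1 + n % T)) ?_ ?_ _ le_rfl
    · intro n hn j hjn
      have hj := hidx j (hjn.trans hn)
      exact R.measurable_weight_past hF hj.1 hj.2.1 (hlex j n hjn)
    · intro n hn X hX
      obtain ⟨ht, hk, hk'⟩ := hidx n hn
      classical
      set t := 1 + n / T
      set k := p.K1 + 1 + n % T with hkdef
      have hφ : FinMeas (R.past t k) fun ω => (R.policy t ω, R.iter t (k - 1) ω) :=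
        (R.finMeas_policy ht).prodMk (R.finMeas_iter ht hk' (Or.inr ⟨rfl, by omega⟩))
      have hmem : ∀ ω, R.iter t (k - 1) ω ∈ F := R.iter_mem t ht (k - 1)
        (Finset.mem_Icc.2 ⟨Nat.zero_le _, hk'⟩)
      have h := lintegral_mul_fresh_le (P := P) (R.past_le ht) hX hφ (R.measurable_data t k)
        (law := fun c => M.dataLaw ν p.moff p.mon c.1) (R.data_law t ht k hk)
        (g := fun c D => if c.2 ∈ F then
          ENNReal.ofReal (M.stepWeight F ν θ α c.1 c.2 D) else 0) (fun c => by
            by_cases hc : c.2 ∈ F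
            · simp only [hc, if_true]
              exact (MDP.measurable_stepWeight hF hc).ennreal_ofReal
            · simp only [hc, if_false]
              exact measurable_const) (K := ENNReal.ofReal K) (fun ω => by
            simp only [hmem, if_true]
            exact MDP.lintegral_stepWeight_le hF (hmem ω) hθ hα hα1 hθH)
      simp only [hmem, if_true] at h
      exact h
  have hprodm : Measurable fun ω => ∏ j ∈ Finset.range (T * T), W j ω :=
    Finset.measurable_fun_prod _ fun j hj => hWm j (Finset.mem_range.1 hj)
  -- The threshold of Markov's inequality: the mean of the product is at most `K ^ (T * T)`, so it
  -- is reached with probability at most `δ`.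
  set L : ℝ≥0∞ := ENNReal.ofReal (K ^ (T * T) / δ) with hL
  have hLpos : 0 < K ^ (T * T) / δ := by positivity
  set B : Set Ω := {ω | L ≤ ∏ j ∈ Finset.range (T * T), W j ω} with hB
  have hBm : MeasurableSet B := measurableSet_le measurable_const hprodm
  have hPB : P B ≤ ENNReal.ofReal δ := by
    have h1 := (mul_meas_ge_le_lintegral (μ := P) hprodm L).trans hprod
    have h2 : ENNReal.ofReal K ^ (T * T) = L * ENNReal.ofReal δ := by
      rw [hL, ← ENNReal.ofReal_mul hLpos.le, div_mul_cancel₀ _ hδ.ne', ENNReal.ofReal_pow hKpos.le]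
    rw [h2] at h1
    exact (ENNReal.mul_le_mul_iff_right (ENNReal.ofReal_pos.2 hLpos).ne' ENNReal.ofReal_ne_top).1 h1
  refine ⟨Bᶜ, hBm.compl, ?_, fun ω hω => ?_⟩
  · rw [prob_compl_eq_one_sub hBm, ENNReal.ofReal_sub _ hδ.le, ENNReal.ofReal_one]
    exact tsub_le_tsub_left hPB 1
  · have hone : ∀ t k, 1 ≤ R.weight θ α t k ω := fun t k => MDP.one_le_stepWeight _
    rw [Set.mem_compl_iff, hB, Set.mem_ofPred_eq, not_le] at hω
    simp only [hW] at hω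
    rw [← ENNReal.ofReal_prod_of_nonneg fun i _ => zero_le_one.trans (hone _ _), hL,
      ENNReal.ofReal_lt_ofReal_iff hLpos] at hω
    have h1 := Real.log_le_log (Finset.prod_pos fun i _ => zero_lt_one.trans_le (hone _ _)) hω.le
    rw [Real.log_prod fun i _ => (zero_lt_one.trans_le (hone _ _)).ne',
      sum_range_sq_eq_sum_Icc (fun t k => Real.log (R.weight θ α t k ω)) hT, ← hK, div_eq_mul_one_div,
      Real.log_mul (by positivity) (by positivity), Real.log_pow] at h1
    push_cast at h1
    exact h1

end HACRun

end

/-! ### Error recursions and residuals of the averaged critic -/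

section

theorem sum_sqrt_le_sqrt_card_mul_sum {ι : Type*} (s : Finset ι) {x : ι → ℝ}
    (hx : ∀ i ∈ s, 0 ≤ x i) : ∑ i ∈ s, √(x i) ≤ √(s.card * ∑ i ∈ s, x i) := by
  refine Real.le_sqrt_of_sq_le ?_
  refine (sq_sum_le_card_mul_sum_sq).trans (le_of_eq ?_)
  congr 1
  exact Finset.sum_congr rfl fun i hi => Real.sq_sqrt (hx i hi)

theorem sqrt_add_le_add_sqrt {x y : ℝ} (hx : 0 ≤ x) (hy : 0 ≤ y) : √(x + y) ≤ √x + √y := by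
  refine Real.sqrt_le_iff.2 ⟨by positivity, ?_⟩
  have h1 := Real.sq_sqrt hx
  have h2 := Real.sq_sqrt hy
  nlinarith [mul_nonneg (Real.sqrt_nonneg x) (Real.sqrt_nonneg y)]

section Sequences

variable {T : ℕ} {β a n : ℕ → ℝ} {ρ B : ℝ}

/-- As `ρ ≤ 1`, the terms `β j` telescope and only the initial one is paid for. -/
theorem sum_le_of_recursion (hβ : ∀ j, 0 ≤ β j) (hρ1 : ρ ≤ 1)
    (h : ∀ j < T, a j + β (j + 1) ≤ ρ * β j + n j) (hB : β 0 ≤ B) :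
    ∑ j ∈ Finset.range T, a j ≤ B + ∑ j ∈ Finset.range T, n j := by
  have h1 : ∀ j ∈ Finset.range T, a j ≤ (β j - β (j + 1)) + n j := fun j hj => by
    have := h j (Finset.mem_range.1 hj)
    nlinarith [hβ j]
  refine (Finset.sum_le_sum h1).trans ?_
  rw [Finset.sum_add_distrib, Finset.sum_range_sub']
  linarith [hβ T]

/-- The sequence is dominated by the solution `u` started at `0` plus the decaying start `ρ ^ j *
B`. The Cauchy-Schwarz inequality is applied to `u` only; the start is summed as a geometric series
in `√ρ`. Treating both together would charge `√(T * B / (1 - ρ))` for the start, too much for the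
final bound in terms of the horizon. -/
theorem sum_sqrt_le_of_recursion (hn : ∀ j, 0 ≤ n j) (hρ0 : 0 ≤ ρ) (hρ1 : ρ < 1)
    (h : ∀ j < T, β (j + 1) ≤ ρ * β j + n j) (hB : β 0 ≤ B) (hB0 : 0 ≤ B) :
    ∑ j ∈ Finset.range T, √(β (j + 1))
      ≤ √(T * (∑ j ∈ Finset.range T, n j) / (1 - ρ)) + 2 * √B / (1 - ρ) := by
  have hρ : 0 < 1 - ρ := by linarith
  set u : ℕ → ℝ := fun j => Nat.rec 0 (fun j x => ρ * x + n j) j with hu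
  have hu0 : u 0 = 0 := rfl
  have hus : ∀ j, u (j + 1) = ρ * u j + n j := fun j => rfl
  have hunn : ∀ j, 0 ≤ u j := fun j => by
    induction j with
    | zero => exact hu0.ge
    | succ j ih => rw [hus]; exact add_nonneg (mul_nonneg hρ0 ih) (hn j)
  have hβu : ∀ j ≤ T, β j ≤ u j + ρ ^ j * B := fun j hj => by
    induction j with
    | zero => simpa [hu0] using hB
    | succ j ih =>
      have h1 := mul_le_mul_of_nonneg_left (ih (by omega)) hρ0
      have h2 := h j (by omega)
      rw [hus, pow_succ]
      linarith
  have husum : ∑ j ∈ Finset.range T, u (j + 1) ≤ (∑ j ∈ Finset.range T, n j) / (1 - ρ) := by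
    rw [le_div_iff₀ hρ]
    have h1 : ∑ j ∈ Finset.range T, u (j + 1)
        = ρ * ∑ j ∈ Finset.range T, u j + ∑ j ∈ Finset.range T, n j := by
      simp_rw [hus]; rw [Finset.sum_add_distrib, Finset.mul_sum]
    have h2 := Finset.sum_range_succ' u T
    rw [Finset.sum_range_succ, hu0, add_zero] at h2
    have h3 := mul_nonneg hρ0 (hunn T)
    have h4 : ρ * ∑ j ∈ Finset.range T, u j
        = ρ * ∑ j ∈ Finset.range T, u (j + 1) - ρ * u T := by rw [← h2]; ring
    nlinarith
  set r := √ρ with hr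
  have hr0 : 0 ≤ r := Real.sqrt_nonneg _
  have hr2 : r ^ 2 = ρ := Real.sq_sqrt hρ0
  have hr1 : r < 1 := by nlinarith
  have hgeo : ∑ j ∈ Finset.range T, r ^ (j + 1) ≤ 2 / (1 - ρ) := by
    have h1 : ∑ j ∈ Finset.range T, r ^ (j + 1) ≤ 1 / (1 - r) := by
      have h2 : ∑ j ∈ Finset.range T, r ^ (j + 1) ≤ ∑ j ∈ Finset.range T, r ^ j :=
        Finset.sum_le_sum fun j _ => pow_le_pow_of_le_one hr0 hr1.le (Nat.le_succ j)
      refine h2.trans ?_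
      rw [one_div, ← tsum_geometric_of_lt_one hr0 hr1]
      exact (summable_geometric_of_lt_one hr0 hr1).sum_le_tsum _ fun j _ => pow_nonneg hr0 j
    refine h1.trans ?_
    -- Since `1 - ρ = (1 - r) * (1 + r)` and `1 + r ≤ 2`.
    rw [div_le_div_iff₀ (by linarith) hρ]
    nlinarith
  have hterm : ∀ j ∈ Finset.range T, √(β (j + 1)) ≤ √(u (j + 1)) + √B * r ^ (j + 1) := by
    intro j hj
    have h1 := hβu (j + 1) (Finset.mem_range.1 hj)
    have h2 : √(ρ ^ (j + 1) * B) = √B * r ^ (j + 1) := by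
      rw [Real.sqrt_mul (pow_nonneg hρ0 _), mul_comm]
      congr 1
      rw [← hr2, ← pow_mul, mul_comm, pow_mul, Real.sqrt_sq (pow_nonneg hr0 _)]
    rw [← h2]
    exact (Real.sqrt_le_sqrt h1).trans
      (sqrt_add_le_add_sqrt (hunn (j + 1)) (mul_nonneg (pow_nonneg hρ0 _) hB0))
  refine (Finset.sum_le_sum hterm).trans ?_
  rw [Finset.sum_add_distrib, ← Finset.mul_sum]
  refine add_le_add ?_ ?_
  · refine (sum_sqrt_le_sqrt_card_mul_sum (x := fun j => u (j + 1)) _ fun j _ => hunn (j + 1)).trans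
      (Real.sqrt_le_sqrt ?_)
    rw [Finset.card_range, mul_div_assoc]
    exact mul_le_mul_of_nonneg_left husum (Nat.cast_nonneg _)
  · calc √B * ∑ j ∈ Finset.range T, r ^ (j + 1) ≤ √B * (2 / (1 - ρ)) :=
        mul_le_mul_of_nonneg_left hgeo (Real.sqrt_nonneg _)
      _ = 2 * √B / (1 - ρ) := by ring

end Sequences

/-- The critic, the average of the iterates `h 1, …, h T`. -/
def critic {X : Type*} (T : ℕ) (h : ℕ → X → ℝ) (x : X) : ℝ :=
  (1 / (T : ℝ)) * ∑ j ∈ Finset.range T, h (j + 1) x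

theorem abs_critic_le {X : Type*} {T : ℕ} {h : ℕ → X → ℝ} {C : ℝ} (hT : 1 ≤ T) (hb : ∀ j ≤ T, ∀ x, |h j x| ≤ C) (x : X) :
    |critic T h x| ≤ C := by
  have hTpos : (0 : ℝ) < T := by exact_mod_cast hT
  rw [critic, abs_mul, abs_of_pos (by positivity), one_div, inv_mul_le_iff₀ hTpos]
  refine (Finset.abs_sum_le_sum_abs _ _).trans ?_
  refine (Finset.sum_le_card_nsmul _ _ C fun j hj => hb (j + 1) (Finset.mem_range.1 hj) x).trans ?_
  simp

namespace MDP

variable (M : MDP S A)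

/-- The mean squared Bellman error of `f` for the previous iterate `g`. -/
def offErr (ν : Measure (S × A)) (π : Policy S A) (g f : S × A → ℝ) : ℝ :=
  ∫ x, (f x - M.bellman π g x) ^ 2 ∂ν

/-- The mean squared distance of `f` to `Q^π` under the occupancy measure. -/
def onErr (π : Policy S A) (f : S × A → ℝ) : ℝ :=
  ∫ x, (f x - M.Q π x) ^ 2 ∂(M.occupancy π)

theorem offErr_nonneg (ν : Measure (S × A)) (π : Policy S A) (g f : S × A → ℝ) :
    0 ≤ M.offErr ν π g f := integral_nonneg fun _ => sq_nonneg _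

theorem onErr_nonneg (π : Policy S A) (f : S × A → ℝ) : 0 ≤ M.onErr π f :=
  integral_nonneg fun _ => sq_nonneg _

theorem sq_le_of_abs_le {x c : ℝ} (h : |x| ≤ c) : |x ^ 2| ≤ c ^ 2 := by
  rw [abs_pow]; exact pow_le_pow_left₀ (abs_nonneg _) h 2

theorem abs_sub_Q_le (π : Policy S A) {f : S × A → ℝ} (hb : ∀ x, |f x| ≤ M.horizon) (x : S × A) :
    |f x - M.Q π x| ≤ 2 * M.horizon :=
  (abs_sub _ _).trans (by linarith [hb x, M.abs_Q_le π x])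

theorem onErr_le (π : Policy S A) {f : S × A → ℝ} (hb : ∀ x, |f x| ≤ M.horizon) :
    M.onErr π f ≤ 4 * M.horizon ^ 2 := by
  have h : ∀ x, |(f x - M.Q π x) ^ 2| ≤ (2 * M.horizon) ^ 2 := fun x =>
    sq_le_of_abs_le (M.abs_sub_Q_le π hb x)
  have := (le_abs_self _).trans (abs_integral_le_of_bounded (μ := M.occupancy π) h)
  unfold onErr
  linarith

theorem integrable_sub_Q_sq (π : Policy S A) {f : S × A → ℝ} (hf : Measurable f)
    (hb : ∀ x, |f x| ≤ M.horizon) :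
    Integrable (fun x => (f x - M.Q π x) ^ 2) (M.occupancy π) :=
  integrable_of_bounded ((hf.sub (M.measurable_Q π)).pow_const 2)
    fun x => sq_le_of_abs_le (M.abs_sub_Q_le π hb x)

/-- The Bellman residual of `f` under the occupancy measure of the policy. -/
theorem integral_residual_sq_le (π : Policy S A) {f : S × A → ℝ} (hf : Measurable f)
    (hb : ∀ x, |f x| ≤ M.horizon) :
    ∫ x, (M.bellman π f x - f x) ^ 2 ∂(M.occupancy π) ≤ 4 * M.onErr π f := by
  have h1 := M.integral_bellman_sub_Q_sq_le π hf hb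
  have hTf := M.integrable_sub_Q_sq π (M.measurable_bellman π hf) (M.abs_bellman_le π hb)
  have hfi := M.integrable_sub_Q_sq π hf hb
  have hsum : Integrable (fun x => 2 * (M.bellman π f x - M.Q π x) ^ 2
      + 2 * (f x - M.Q π x) ^ 2) (M.occupancy π) := (hTf.const_mul 2).add (hfi.const_mul 2)
  have hres : Integrable (fun x => (M.bellman π f x - f x) ^ 2) (M.occupancy π) :=
    integrable_of_bounded (C := (2 * M.horizon) ^ 2)
      (((M.measurable_bellman π hf).sub hf).pow_const 2) fun x => sq_le_of_abs_le <|
        (abs_sub _ _).trans (by linarith [hb x, M.abs_bellman_le π hb x])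
  have h2 : ∫ x, (M.bellman π f x - f x) ^ 2 ∂(M.occupancy π)
      ≤ ∫ x, (2 * (M.bellman π f x - M.Q π x) ^ 2 + 2 * (f x - M.Q π x) ^ 2)
        ∂(M.occupancy π) := by
    refine integral_mono hres hsum fun x => ?_
    simp only
    nlinarith [sq_nonneg ((M.bellman π f x - M.Q π x) + (f x - M.Q π x))]
  rw [integral_add (hTf.const_mul 2) (hfi.const_mul 2), integral_const_mul,
    integral_const_mul] at h2
  have h3 := M.onErr_nonneg π f
  unfold onErr at h3 ⊢
  nlinarith [M.γ_lt_one]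

theorem integral_residual_le_onErr (π : Policy S A) {f : S × A → ℝ} (hf : Measurable f)
    (hb : ∀ x, |f x| ≤ M.horizon) :
    ∫ x, (f x - M.bellman π f x) ∂(M.occupancy π) ≤ 2 * √(M.onErr π f) := by
  have h1 := M.integral_residual_sq_le π hf hb
  have h2 := abs_integral_le_sqrt (μ := M.occupancy π) (f := fun x => f x - M.bellman π f x)
    (C := 2 * M.horizon) (hf.sub (M.measurable_bellman π hf)) fun x =>
      (abs_sub _ _).trans (by linarith [hb x, M.abs_bellman_le π hb x])
  refine (le_abs_self _).trans (h2.trans ?_)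
  have h3 : ∀ x, (f x - M.bellman π f x) ^ 2 = (M.bellman π f x - f x) ^ 2 := fun x => by ring
  simp_rw [h3]
  refine (Real.sqrt_le_sqrt h1).trans (le_of_eq ?_)
  rw [Real.sqrt_mul (by norm_num), show (4 : ℝ) = 2 ^ 2 by norm_num, Real.sqrt_sq (by norm_num)]

theorem integral_residual_le_Cnpg (πe π : Policy S A) (hfin : M.Cnpg πe ≠ ⊤) {f : S × A → ℝ}
    (hf : Measurable f) (hb : ∀ x, |f x| ≤ M.horizon) :
    ∫ x, (M.bellman π f x - f x) ∂(M.occupancy πe)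
      ≤ 2 * √(M.Cnpg πe).toReal * √(M.onErr π f) := by
  have h1 := M.integral_residual_sq_le π hf hb
  have h2 := M.integral_occupancy_le_Cnpg πe π hfin (g := fun x => M.bellman π f x - f x)
    (C := 2 * M.horizon) ((M.measurable_bellman π hf).sub hf) fun x =>
      (abs_sub _ _).trans (by linarith [hb x, M.abs_bellman_le π hb x])
  refine h2.trans ?_
  have h3 : √(∫ x, (M.bellman π f x - f x) ^ 2 ∂(M.occupancy π)) ≤ 2 * √(M.onErr π f) := by
    refine (Real.sqrt_le_sqrt h1).trans (le_of_eq ?_)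
    rw [Real.sqrt_mul (by norm_num), show (4 : ℝ) = 2 ^ 2 by norm_num, Real.sqrt_sq (by norm_num)]
  have := mul_le_mul_of_nonneg_left h3 (Real.sqrt_nonneg (M.Cnpg πe).toReal)
  linarith

section Critic

variable {T : ℕ} {h : ℕ → S × A → ℝ}

theorem measurable_critic (hm : ∀ j ≤ T, Measurable (h j)) : Measurable (critic T h) :=
  (Finset.measurable_fun_sum _ fun j hj => hm (j + 1) (Finset.mem_range.1 hj)).const_mul _

/-- The map `f ↦ T^π f - f` is affine, and the weights of the average add up to `1`. -/
theorem integral_residual_critic {C : ℝ} (hT : 1 ≤ T) (hm : ∀ j ≤ T, Measurable (h j))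
    (hb : ∀ j ≤ T, ∀ x, |h j x| ≤ C) (π : Policy S A) (μ : Measure (S × A))
    [IsProbabilityMeasure μ] :
    ∫ x, (M.bellman π (critic T h) x - critic T h x) ∂μ
      = (1 / (T : ℝ)) * ∑ j ∈ Finset.range T, ∫ x, (M.bellman π (h (j + 1)) x - h (j + 1) x) ∂μ := by
  have hTpos : (0 : ℝ) < T := by exact_mod_cast hT
  have hi : ∀ j ∈ Finset.range T, ∀ μ' : Measure (S × A), IsProbabilityMeasure μ' →
      Integrable (h (j + 1)) μ' := fun j hj μ' _ =>
    integrable_of_bounded (hm _ (Finset.mem_range.1 hj)) (hb _ (Finset.mem_range.1 hj))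
  have hnext : ∀ x, M.next π (critic T h) x
      = (1 / (T : ℝ)) * ∑ j ∈ Finset.range T, M.next π (h (j + 1)) x := fun x => by
    unfold next critic
    rw [integral_const_mul, integral_finsetSum _ fun j hj => hi j hj _ inferInstance]
  have hpt : ∀ x, M.bellman π (critic T h) x - critic T h x
      = (1 / (T : ℝ)) * ∑ j ∈ Finset.range T, (M.bellman π (h (j + 1)) x - h (j + 1) x) := by
    intro x
    rw [bellman_eq, hnext]
    simp_rw [bellman_eq]
    rw [Finset.sum_sub_distrib, Finset.sum_add_distrib, ← Finset.mul_sum, critic]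
    simp only [Finset.sum_const, Finset.card_range, nsmul_eq_mul]
    field_simp
  simp_rw [hpt]
  rw [integral_const_mul, integral_finsetSum]
  intro j hj
  exact ((integrable_of_bounded M.measurable_reward M.abs_reward_le).add
    ((integrable_of_bounded (M.measurable_next π (hm _ (Finset.mem_range.1 hj)))
      (M.abs_next_le π (hb _ (Finset.mem_range.1 hj)))).const_mul _)).sub (hi j hj μ inferInstance)

theorem integral_critic_residual_le_onErr (hT : 1 ≤ T) (hm : ∀ j ≤ T, Measurable (h j))
    (hb : ∀ j ≤ T, ∀ x, |h j x| ≤ M.horizon) (π : Policy S A) :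
    ∫ x, (critic T h x - M.bellman π (critic T h) x) ∂(M.occupancy π)
      ≤ (1 / (T : ℝ)) * (2 * ∑ j ∈ Finset.range T, √(M.onErr π (h (j + 1)))) := by
  have h0 : ∀ f : S × A → ℝ, ∫ x, (f x - M.bellman π f x) ∂(M.occupancy π)
      = - ∫ x, (M.bellman π f x - f x) ∂(M.occupancy π) := fun f => by
    rw [← integral_neg]
    exact integral_congr_ae (Filter.Eventually.of_forall fun x => by simp)
  rw [h0, M.integral_residual_critic hT hm hb, ← mul_neg, ← Finset.sum_neg_distrib]
  refine mul_le_mul_of_nonneg_left ?_ (by positivity)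
  rw [Finset.mul_sum]
  refine Finset.sum_le_sum fun j hj => ?_
  rw [← h0]
  exact M.integral_residual_le_onErr π (hm _ (Finset.mem_range.1 hj)) (hb _ (Finset.mem_range.1 hj))

theorem integral_critic_residual_le_Cnpg (hT : 1 ≤ T) (hm : ∀ j ≤ T, Measurable (h j))
    (hb : ∀ j ≤ T, ∀ x, |h j x| ≤ M.horizon) (π : Policy S A)
    (πe : Policy S A) (hfin : M.Cnpg πe ≠ ⊤) :
    ∫ x, (M.bellman π (critic T h) x - critic T h x) ∂(M.occupancy πe)
      ≤ (1 / (T : ℝ)) * (2 * √(M.Cnpg πe).toReal *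
        ∑ j ∈ Finset.range T, √(M.onErr π (h (j + 1)))) := by
  rw [M.integral_residual_critic hT hm hb]
  refine mul_le_mul_of_nonneg_left ?_ (by positivity)
  rw [Finset.mul_sum]
  refine Finset.sum_le_sum fun j hj => ?_
  exact M.integral_residual_le_Cnpg πe π hfin (hm _ (Finset.mem_range.1 hj))
    (hb _ (Finset.mem_range.1 hj))

/-- The transfer coefficient controls `T^π h_j - h_{j+1}`, the regression error, not the residual
`T^π h_{j+1} - h_{j+1}`. The differences `T^π h_{j+1} - T^π h_j` telescope, leaving two boundary
terms of size `H`. Averaging the iterates is what makes their contribution small. -/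
theorem integral_critic_residual_le_Coff (hT : 1 ≤ T) (hm : ∀ j ≤ T, Measurable (h j))
    (hb : ∀ j ≤ T, ∀ x, |h j x| ≤ M.horizon) (π : Policy S A)
    {F : Finset (S × A → ℝ)} {ν : Measure (S × A)}
    (hF : ∀ j ≤ T, h j ∈ F) (πe : Policy S A) (hfin : M.Coff F ν πe ≠ ⊤) :
    ∫ x, (M.bellman π (critic T h) x - critic T h x) ∂(M.occupancy πe)
      ≤ (1 / (T : ℝ)) * ((M.Coff F ν πe).toReal *
        ∑ j ∈ Finset.range T, √(M.offErr ν π (h j) (h (j + 1))) + 2 * M.horizon) := by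
  rw [M.integral_residual_critic hT hm hb]
  refine mul_le_mul_of_nonneg_left ?_ (by positivity)
  set τ : ℕ → ℝ := fun j => ∫ x, M.bellman π (h j) x ∂(M.occupancy πe) with hτ
  have hτb : ∀ j ≤ T, |τ j| ≤ M.horizon := fun j hj =>
    abs_integral_le_of_bounded (M.abs_bellman_le π (hb j hj))
  have hbi : ∀ j ≤ T, Integrable (M.bellman π (h j)) (M.occupancy πe) := fun j hj =>
    integrable_of_bounded (M.measurable_bellman π (hm j hj)) (M.abs_bellman_le π (hb j hj))
  have hhi : ∀ j ≤ T, Integrable (h j) (M.occupancy πe) := fun j hj =>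
    integrable_of_bounded (hm j hj) (hb j hj)
  have hterm : ∀ j ∈ Finset.range T,
      ∫ x, (M.bellman π (h (j + 1)) x - h (j + 1) x) ∂(M.occupancy πe)
        ≤ (M.Coff F ν πe).toReal * √(M.offErr ν π (h j) (h (j + 1))) + (τ (j + 1) - τ j) := by
    intro j hj
    have hj' := Finset.mem_range.1 hj
    have h1 := M.integral_occupancy_le_Coff πe π hfin (hF (j + 1) hj') (hF j hj'.le) (ν := ν)
    rw [integral_sub (hbi j hj'.le) (hhi (j + 1) hj')] at h1
    rw [integral_sub (hbi (j + 1) hj') (hhi (j + 1) hj')]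
    have h2 : ∫ x, (M.bellman π (h j) x - h (j + 1) x) ^ 2 ∂ν = M.offErr ν π (h j) (h (j + 1)) :=
      integral_congr_ae (Filter.Eventually.of_forall fun x => by simp only; ring)
    rw [h2] at h1
    simp only [hτ]
    linarith
  refine (Finset.sum_le_sum hterm).trans ?_
  rw [Finset.sum_add_distrib, Finset.sum_range_sub, ← Finset.mul_sum]
  have h1 := abs_le.1 (hτb T le_rfl)
  have h2 := abs_le.1 (hτb 0 (Nat.zero_le _))
  linarith

end Critic

end MDP

end

/-! ### One iteration of policy evaluation, and the assembly of the regret -/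

section

namespace MDP

/-- The empirical excess on-policy loss of `f` over `Q^π`. -/
def onExcess (M : MDP S A) {moff mon : ℕ} (π : Policy S A) (f : S × A → ℝ)
    (D : Dataset S A moff mon) : ℝ :=
  1 / (mon : ℝ) * ∑ i, excess (fun p => p.2) (M.Q π) f (D.2 i)

variable [Fintype A] (M : MDP S A)

/-- The empirical excess offline loss of `f` over the Bellman backup of `g`. -/
def offExcess {moff mon : ℕ} (π : Policy S A) (g f : S × A → ℝ) (D : Dataset S A moff mon) : ℝ :=
  1 / (moff : ℝ) * ∑ i, excess (M.offlineTarget π g) (M.bellman π g) f (D.1 i)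

/-- The empirical excess losses of all functions of the class agree with their expectations up to a
relative error `α` and an additive error `ξ`. -/
def Concentrated (F : Finset (S × A → ℝ)) (ν : Measure (S × A)) {moff mon : ℕ} (α ξ : ℝ)
    (π : Policy S A) (g : S × A → ℝ) (D : Dataset S A moff mon) : Prop :=
  ∀ f ∈ F, ∀ σ : ℝ, σ = 1 ∨ σ = -1 →
    σ * M.offExcess π g f D ≤ (σ + α) * M.offErr ν π g f + ξ ∧
    σ * M.onExcess π f D ≤ (σ + α) * M.onErr π f + ξ

variable {M} {F : Finset (S × A → ℝ)} {ν : Measure (S × A)} {moff mon : ℕ} {π : Policy S A}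
  {g f f' : S × A → ℝ} {D : Dataset S A moff mon}

/-- The last bracket does not involve `f`: minimizing the loss is minimizing the weighted excess
losses, whose expectations are squared distances. -/
theorem hpeLoss_eq (lam : ℝ) (π : Policy S A) (D : Dataset S A moff mon) (g f : S × A → ℝ) :
    M.hpeLoss lam π D g f = M.offExcess π g f D + lam * M.onExcess π f D
      + (1 / (moff : ℝ) * ∑ i, (M.bellman π g (D.1 i).1 - M.offlineTarget π g (D.1 i)) ^ 2
        + lam * (1 / (mon : ℝ) * ∑ i, (M.Q π (D.2 i).1 - (D.2 i).2) ^ 2)) := by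
  have h1 : ∀ i, (f (D.1 i).1 - M.reward (D.1 i).1 - M.γ * π.avg g (D.1 i).2) ^ 2
      = excess (M.offlineTarget π g) (M.bellman π g) f (D.1 i)
        + (M.bellman π g (D.1 i).1 - M.offlineTarget π g (D.1 i)) ^ 2 := fun i => by
    simp only [excess, offlineTarget]; ring
  have h2 : ∀ i, (f (D.2 i).1 - (D.2 i).2) ^ 2 = excess (fun p => p.2) (M.Q π) f (D.2 i)
      + (M.Q π (D.2 i).1 - (D.2 i).2) ^ 2 := fun i => by
    simp only [excess]; ring
  simp only [hpeLoss, h1, h2, Finset.sum_add_distrib, offExcess, onExcess]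
  ring

/-- Without completeness only the range of the offline loss is available: the loss of `f` is
nonnegative, and that of `f'` is at most `(2 H) ^ 2` per sample. -/
theorem offExcess_sub_le (hg : ∀ x, |g x| ≤ M.horizon) [MeasurableSingletonClass A]
    (hf' : ∀ x, |f' x| ≤ M.horizon) :
    M.offExcess π g f' D - M.offExcess π g f D ≤ 4 * M.horizon ^ 2 := by
  have hterm : ∀ i, excess (M.offlineTarget π g) (M.bellman π g) f' (D.1 i)
      - excess (M.offlineTarget π g) (M.bellman π g) f (D.1 i) ≤ 4 * M.horizon ^ 2 := fun i => by
    have h1 : |f' (D.1 i).1 - M.offlineTarget π g (D.1 i)| ≤ 2 * M.horizon := by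
      have h2 : |M.offlineTarget π g (D.1 i)| ≤ M.horizon := by
        have h1 := π.abs_avg_le hg (D.1 i).2
        calc |M.offlineTarget π g (D.1 i)|
            ≤ |M.reward (D.1 i).1| + M.γ * |π.avg g (D.1 i).2| := by
              refine (abs_add_le _ _).trans ?_
              rw [abs_mul, abs_of_pos M.γ_pos]
          _ ≤ 1 + M.γ * M.horizon :=
              add_le_add (M.abs_reward_le _) (mul_le_mul_of_nonneg_left h1 M.γ_pos.le)
          _ = M.horizon := M.horizon_eq.symm
      exact (abs_sub _ _).trans (by linarith [hf' (D.1 i).1])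
    have h3 := pow_le_pow_left₀ (abs_nonneg _) h1 2
    rw [sq_abs] at h3
    simp only [excess]
    nlinarith [sq_nonneg (f (D.1 i).1 - M.offlineTarget π g (D.1 i))]
  rw [offExcess, offExcess, ← mul_sub, ← Finset.sum_sub_distrib]
  rcases Nat.eq_zero_or_pos moff with rfl | hm
  · simp; positivity
  · have hm' : (0 : ℝ) < moff := by exact_mod_cast hm
    rw [one_div, inv_mul_le_iff₀ hm']
    refine (Finset.sum_le_card_nsmul _ _ _ fun i _ => hterm i).trans ?_
    simp

/-- One iteration under approximate Bellman completeness. -/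
theorem offErr_add_onErr_le [IsProbabilityMeasure ν] {ξ ε : ℝ}
    (hF : ∀ f ∈ F, Measurable f ∧ ∀ x, |f x| ≤ M.horizon) (hg : g ∈ F) (hf : f ∈ F) (hf' : f' ∈ F)
    (hξ : 0 ≤ ξ) (hε : 0 ≤ ε) (hε1 : ε ≤ 1) (happ : ∀ x, |f' x - M.bellman π g x| ≤ ε)
    (hconc : M.Concentrated F ν ((1 - M.γ) / 8) ξ π g D)
    (hmin : M.hpeLoss 1 π D g f ≤ M.hpeLoss 1 π D g f') :
    M.offErr ν π g f + M.onErr π f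
      ≤ (1 + M.γ) / 2 * M.onErr π g + (8 * ξ + 12 * ε * M.horizon) := by
  set α := (1 - M.γ) / 8 with hα
  have hγ0 := M.γ_pos
  have hγ1 := M.γ_lt_one
  have hH := M.one_le_horizon
  have hTg := M.measurable_bellman π (hF g hg).1
  have hTgb := M.abs_bellman_le π (hF g hg).2
  have hoff' : M.offErr ν π g f' ≤ ε := by
    have h := (le_abs_self _).trans (abs_integral_le_of_bounded (μ := ν) (C := ε ^ 2)
      (f := fun x => (f' x - M.bellman π g x) ^ 2) fun x => sq_le_of_abs_le (happ x))
    unfold offErr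
    nlinarith
  -- The Bellman backup of `g` contracts towards `Q^π`. Replacing it by `f'` adds a cross term of at
  -- most `4 ε H` and a square of at most `ε H`.
  have hon' : M.onErr π f' ≤ M.γ * M.onErr π g + 5 * ε * M.horizon := by
    have h1 := M.integral_bellman_sub_Q_sq_le π (hF g hg).1 (hF g hg).2
    have h2 : M.onErr π f' ≤ ∫ x, ((M.bellman π g x - M.Q π x) ^ 2 + 5 * ε * M.horizon)
        ∂(M.occupancy π) := by
      refine integral_mono (M.integrable_sub_Q_sq π (hF f' hf').1 (hF f' hf').2)
        ((M.integrable_sub_Q_sq π hTg hTgb).add (integrable_const _)) fun x => ?_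
      have h3 := abs_le.1 (happ x)
      have h4 := abs_le.1 (M.abs_sub_Q_le π hTgb x)
      have h5 : (f' x - M.bellman π g x) * (M.bellman π g x - M.Q π x) ≤ ε * (2 * M.horizon) := by
        refine (le_abs_self _).trans ?_
        rw [abs_mul]
        exact mul_le_mul (happ x) (M.abs_sub_Q_le π hTgb x) (abs_nonneg _) hε
      have h6 : (f' x - M.bellman π g x) ^ 2 ≤ ε * M.horizon := by
        have := (le_abs_self _).trans (sq_le_of_abs_le (happ x))
        nlinarith
      simp only
      nlinarith
    rw [integral_add (M.integrable_sub_Q_sq π hTg hTgb) (integrable_const _)] at h2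
    simp only [integral_const, probReal_univ, smul_eq_mul, one_mul] at h2
    unfold onErr at h2 ⊢
    linarith
  rw [hpeLoss_eq, hpeLoss_eq] at hmin
  obtain ⟨h1, h2⟩ := hconc f hf (-1) (Or.inr rfl)
  obtain ⟨h3, h4⟩ := hconc f' hf' 1 (Or.inl rfl)
  have hb := M.onErr_nonneg π g
  have ha' := M.offErr_nonneg ν π g f'
  have hb' := M.onErr_nonneg π f'
  have hεH : 0 ≤ ε * M.horizon := by positivity
  set X := M.offErr ν π g f + M.onErr π f with hX
  -- Lower deviations for the minimizer `f`, upper deviations for the competitor `f'`, for both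
  -- losses: four noise terms `ξ`.
  have h5 : (1 - α) * X ≤ 4 * ξ + (1 + α) * (M.offErr ν π g f' + M.onErr π f') := by
    rw [hX]; linarith
  have h6 : M.offErr ν π g f' + M.onErr π f' ≤ M.γ * M.onErr π g + 6 * (ε * M.horizon) := by
    nlinarith
  have hα0 : 0 < α := by rw [hα]; linarith
  have hα1 : α ≤ 1 / 8 := by rw [hα]; linarith
  have h7 := mul_le_mul_of_nonneg_left h6 (by linarith : 0 ≤ 1 + α)
  -- The choice of `α` is made for this inequality: the relative errors on both sides leave a
  -- contraction factor halfway between `γ` and `1`.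
  have h8 : (1 + α) * M.γ ≤ (1 - α) * ((1 + M.γ) / 2) := by rw [hα]; nlinarith
  have h9 := mul_le_mul_of_nonneg_right h8 hb
  refine le_of_mul_le_mul_left ?_ (by linarith : 0 < 1 - α)
  nlinarith [mul_nonneg (by linarith : (0:ℝ) ≤ 1 / 8 - α) hεH,
    mul_nonneg (by linarith : (0:ℝ) ≤ 1 / 8 - α) hξ]

/-- One iteration with a large weight of the on-policy loss. -/
theorem onErr_le_of_realizable [MeasurableSingletonClass A] {ξ lam : ℝ} {T : ℕ} (hT : 4 ≤ T)
    (hlam : lam = T / 2 - 1)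
    (hF : ∀ f ∈ F, Measurable f ∧ ∀ x, |f x| ≤ M.horizon) (hg : g ∈ F) (hf : f ∈ F) (hf' : f' ∈ F)
    (hξ : 0 ≤ ξ) (hreal : M.onErr π f' = 0)
    (hconc : M.Concentrated F ν ((1 - M.γ) / 8) ξ π g D)
    (hmin : M.hpeLoss lam π D g f ≤ M.hpeLoss lam π D g f') :
    M.onErr π f ≤ 20 * M.horizon ^ 2 / T + 4 * ξ := by
  set α := (1 - M.γ) / 8 with hα
  have hγ0 := M.γ_pos
  have hα1 : α ≤ 1 / 8 := by rw [hα]; linarith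
  have hT' : (4 : ℝ) ≤ T := by exact_mod_cast hT
  have hlam' : (T : ℝ) / 4 ≤ lam := by rw [hlam]; linarith
  have hlampos : 0 < lam := by linarith
  rw [hpeLoss_eq, hpeLoss_eq] at hmin
  have h1 := (hconc f hf (-1) (Or.inr rfl)).2
  have h2 := (hconc f' hf' 1 (Or.inl rfl)).2
  rw [hreal, mul_zero, zero_add, one_mul] at h2
  have h3 := offExcess_sub_le (D := D) (f := f) (π := π) (hF g hg).2 (hF f' hf').2
  have h4 : lam * (M.onExcess π f D - M.onExcess π f' D) ≤ 4 * M.horizon ^ 2 := by linarith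
  have h5 : (T : ℝ) / 4 * (M.onExcess π f D - M.onExcess π f' D) ≤ 4 * M.horizon ^ 2 := by
    -- Lowering the weight from `lam` to `T / 4` is legitimate only for a nonnegative difference; a
    -- negative one satisfies the claim trivially.
    rcases le_total 0 (M.onExcess π f D - M.onExcess π f' D) with h | h
    · exact (mul_le_mul_of_nonneg_right hlam' h).trans h4
    · have := mul_nonpos_of_nonneg_of_nonpos (by positivity : (0:ℝ) ≤ (T : ℝ) / 4) h
      exact this.trans (by positivity)
  have h6 : M.onExcess π f D - M.onExcess π f' D ≤ 16 * (M.horizon ^ 2 / T) := by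
    have : 16 * (M.horizon ^ 2 / T) = 16 * M.horizon ^ 2 / T := by ring
    rw [this, le_div_iff₀ (by linarith)]
    linarith
  have hb := M.onErr_nonneg π f
  have hX : 0 ≤ M.horizon ^ 2 / T := by positivity
  have h7 : 20 * M.horizon ^ 2 / T = 20 * (M.horizon ^ 2 / T) := by ring
  rw [h7]
  nlinarith [mul_nonneg (by linarith : (0:ℝ) ≤ 1 / 8 - α) hb]

section Assembly

variable [MeasurableSingletonClass A] {T : ℕ} {pol : ℕ → Policy S A} {h : ℕ → ℕ → S × A → ℝ}

/-- Softmax policy updates along the critics. -/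
def IsSoftmaxUpdate (M : MDP S A) (T : ℕ) (pol : ℕ → Policy S A) (h : ℕ → ℕ → S × A → ℝ) : Prop :=
  (∀ s a, (pol 1).prob s a = 1 / (Fintype.card A : ℝ)) ∧
  ∀ t ∈ Finset.Icc 1 T, ∀ s a, (pol (t + 1)).prob s a = (pol t).prob s a
      * Real.exp ((1 - M.γ) * √(Real.log (Fintype.card A) / T) * critic T (h t) (s, a))
        / ∑ b, (pol t).prob s b
          * Real.exp ((1 - M.γ) * √(Real.log (Fintype.card A) / T) * critic T (h t) (s, b))

/-- The performance difference summed over rounds, with the residual under the comparator left as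
`E`. This is the only term in which the two coefficients enter. -/
theorem sum_V_sub_le_of_residual (hT : 1 ≤ T) (hA : 2 ≤ Fintype.card A)
    (hTA : Real.log (Fintype.card A) ≤ T) (hup : M.IsSoftmaxUpdate T pol h)
    (hm : ∀ t ∈ Finset.Icc 1 T, ∀ j ≤ T, Measurable (h t j))
    (hb : ∀ t ∈ Finset.Icc 1 T, ∀ j ≤ T, ∀ x, |h t j x| ≤ M.horizon) (πe : Policy S A) {E : ℝ}
    (hE : ∑ t ∈ Finset.Icc 1 T, ∫ x, (M.bellman (pol t) (critic T (h t)) x - critic T (h t) x)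
      ∂(M.occupancy πe) ≤ E) :
    ∑ t ∈ Finset.Icc 1 T, (M.V πe - M.V (pol t)) ≤ M.horizon * (E
      + 2 * ∑ t ∈ Finset.Icc 1 T, (1 / (T : ℝ)) *
          ∑ j ∈ Finset.range T, √(M.onErr (pol t) (h t (j + 1)))
      + 2 * M.horizon * √(Real.log (Fintype.card A) * T)) := by
  have hcm : ∀ t ∈ Finset.Icc 1 T, Measurable (critic T (h t)) := fun t ht =>
    measurable_critic (hm t ht)
  have hcb : ∀ t ∈ Finset.Icc 1 T, ∀ x, |critic T (h t) x| ≤ M.horizon := fun t ht =>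
    abs_critic_le hT (hb t ht)
  have hreg := M.sum_integral_next_sub_le hT hA hTA hcm hcb hup.1 hup.2 πe
  have h1 : ∀ t ∈ Finset.Icc 1 T, M.V πe - M.V (pol t) = M.horizon *
      (∫ x, (M.bellman (pol t) (critic T (h t)) x - critic T (h t) x) ∂(M.occupancy πe)
      + ∫ x, (critic T (h t) x - M.bellman (pol t) (critic T (h t)) x) ∂(M.occupancy (pol t))
      + M.γ * ∫ x, (M.next πe (critic T (h t)) x - M.next (pol t) (critic T (h t)) x)
        ∂(M.occupancy πe)) := fun t ht => M.V_sub_V_eq πe (pol t) (hcm t ht) (hcb t ht)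
  rw [Finset.sum_congr rfl h1, ← Finset.mul_sum, Finset.sum_add_distrib, Finset.sum_add_distrib,
    ← Finset.mul_sum]
  refine mul_le_mul_of_nonneg_left ?_ M.horizon_pos.le
  refine add_le_add (add_le_add hE ?_) ?_
  · rw [Finset.mul_sum]
    refine Finset.sum_le_sum fun t ht => ?_
    refine (M.integral_critic_residual_le_onErr hT (hm t ht) (hb t ht) (pol t)).trans (le_of_eq ?_)
    ring
  · refine (mul_le_mul_of_nonneg_left hreg M.γ_pos.le).trans ?_
    refine mul_le_of_le_one_left ?_ M.γ_lt_one.le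
    have := M.horizon_pos
    positivity

theorem sum_V_sub_le_Cnpg (hT : 1 ≤ T) (hA : 2 ≤ Fintype.card A)
    (hTA : Real.log (Fintype.card A) ≤ T) (hup : M.IsSoftmaxUpdate T pol h)
    (hm : ∀ t ∈ Finset.Icc 1 T, ∀ j ≤ T, Measurable (h t j))
    (hb : ∀ t ∈ Finset.Icc 1 T, ∀ j ≤ T, ∀ x, |h t j x| ≤ M.horizon) {B : ℝ}
    (hB : ∑ t ∈ Finset.Icc 1 T, (1 / (T : ℝ)) *
          ∑ j ∈ Finset.range T, √(M.onErr (pol t) (h t (j + 1))) ≤ B)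
    (πe : Policy S A) (hfin : M.Cnpg πe ≠ ⊤) :
    ∑ t ∈ Finset.Icc 1 T, (M.V πe - M.V (pol t)) ≤ M.horizon *
      (2 * √(M.Cnpg πe).toReal * B + 2 * B
      + 2 * M.horizon * √(Real.log (Fintype.card A) * T)) := by
  have hE : ∑ t ∈ Finset.Icc 1 T, ∫ x, (M.bellman (pol t) (critic T (h t)) x - critic T (h t) x)
      ∂(M.occupancy πe) ≤ 2 * √(M.Cnpg πe).toReal * B := by
    refine le_trans ?_ (mul_le_mul_of_nonneg_left hB (by positivity))
    rw [Finset.mul_sum]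
    refine Finset.sum_le_sum fun t ht => ?_
    refine (M.integral_critic_residual_le_Cnpg hT (hm t ht) (hb t ht) (pol t) πe hfin).trans
      (le_of_eq ?_)
    ring
  refine (sum_V_sub_le_of_residual hT hA hTA hup hm hb πe hE).trans ?_
  refine mul_le_mul_of_nonneg_left ?_ M.horizon_pos.le
  linarith

theorem sum_V_sub_le_Coff (hT : 1 ≤ T) (hA : 2 ≤ Fintype.card A)
    (hTA : Real.log (Fintype.card A) ≤ T) (hup : M.IsSoftmaxUpdate T pol h)
    (hF : ∀ f ∈ F, Measurable f ∧ ∀ x, |f x| ≤ M.horizon)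
    (hmem : ∀ t ∈ Finset.Icc 1 T, ∀ j ≤ T, h t j ∈ F) {B B' : ℝ}
    (hB : ∑ t ∈ Finset.Icc 1 T, (1 / (T : ℝ)) *
          ∑ j ∈ Finset.range T, √(M.onErr (pol t) (h t (j + 1))) ≤ B)
    (hB' : ∑ t ∈ Finset.Icc 1 T, (1 / (T : ℝ)) *
          ∑ j ∈ Finset.range T, √(M.offErr ν (pol t) (h t j) (h t (j + 1))) ≤ B')
    (πe : Policy S A) (hfin : M.Coff F ν πe ≠ ⊤) :
    ∑ t ∈ Finset.Icc 1 T, (M.V πe - M.V (pol t)) ≤ M.horizon *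
      ((M.Coff F ν πe).toReal * B' + 2 * M.horizon + 2 * B
      + 2 * M.horizon * √(Real.log (Fintype.card A) * T)) := by
  have hm : ∀ t ∈ Finset.Icc 1 T, ∀ j ≤ T, Measurable (h t j) := fun t ht j hj =>
    (hF _ (hmem t ht j hj)).1
  have hb : ∀ t ∈ Finset.Icc 1 T, ∀ j ≤ T, ∀ x, |h t j x| ≤ M.horizon := fun t ht j hj =>
    (hF _ (hmem t ht j hj)).2
  have hTpos : (0 : ℝ) < T := by exact_mod_cast hT
  have hE : ∑ t ∈ Finset.Icc 1 T, ∫ x, (M.bellman (pol t) (critic T (h t)) x - critic T (h t) x)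
      ∂(M.occupancy πe) ≤ (M.Coff F ν πe).toReal * B' + 2 * M.horizon := by
    have h1 : ∀ t ∈ Finset.Icc 1 T, ∫ x, (M.bellman (pol t) (critic T (h t)) x
        - critic T (h t) x) ∂(M.occupancy πe) ≤ (M.Coff F ν πe).toReal * ((1 / (T : ℝ)) *
          ∑ j ∈ Finset.range T, √(M.offErr ν (pol t) (h t j) (h t (j + 1))))
          + 2 * M.horizon / T := fun t ht => by
      refine (M.integral_critic_residual_le_Coff hT (hm t ht) (hb t ht) (pol t) (hmem t ht)
        πe hfin).trans (le_of_eq ?_)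
      ring
    refine (Finset.sum_le_sum h1).trans ?_
    rw [Finset.sum_add_distrib, ← Finset.mul_sum, Finset.sum_const, Nat.card_Icc,
      Nat.add_sub_cancel, nsmul_eq_mul, mul_div_cancel₀ _ hTpos.ne']
    have := mul_le_mul_of_nonneg_left hB' (ENNReal.toReal_nonneg (a := M.Coff F ν πe))
    linarith
  refine (sum_V_sub_le_of_residual hT hA hTA hup hm hb πe hE).trans ?_
  refine mul_le_mul_of_nonneg_left ?_ M.horizon_pos.le
  linarith

end Assembly

end MDP

end

/-! ### Total errors, constants and the high-probability bounds -/

section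

theorem sum_Icc_eq_sum_range {β : Type*} [AddCommMonoid β] (u : ℕ → β) (a T : ℕ) :
    ∑ k ∈ Finset.Icc (a + 1) (a + T), u k = ∑ j ∈ Finset.range T, u (a + (j + 1)) := by
  rw [Icc_succ_eq_Ico, Finset.sum_Ico_eq_sum_range, Nat.add_sub_cancel_left]
  exact Finset.sum_congr rfl fun j _ => by rw [Nat.add_assoc, Nat.add_comm 1 j]

/-- The Cauchy-Schwarz inequality in both indices costs `√(T * T)`, which the factor `1 / T`
cancels. -/
theorem sum_mean_sqrt_le {T : ℕ} (hT : 1 ≤ T) {x : ℕ → ℕ → ℝ} (hx : ∀ t j, 0 ≤ x t j) :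
    ∑ t ∈ Finset.Icc 1 T, (1 / (T : ℝ)) * ∑ j ∈ Finset.range T, √(x t j)
      ≤ √(∑ t ∈ Finset.Icc 1 T, ∑ j ∈ Finset.range T, x t j) := by
  have hTpos : (0 : ℝ) < T := by exact_mod_cast hT
  have hin : ∀ t, ∑ j ∈ Finset.range T, √(x t j) ≤ √(T * ∑ j ∈ Finset.range T, x t j) := fun t => by
    simpa using sum_sqrt_le_sqrt_card_mul_sum (Finset.range T) fun j _ => hx t j
  rw [← Finset.mul_sum]
  have h1 := (Finset.sum_le_sum fun t (_ : t ∈ Finset.Icc 1 T) => hin t).trans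
    (sum_sqrt_le_sqrt_card_mul_sum (Finset.Icc 1 T) fun t _ =>
      mul_nonneg hTpos.le (Finset.sum_nonneg fun j _ => hx t j))
  rw [Nat.card_Icc, Nat.add_sub_cancel, ← Finset.mul_sum, ← mul_assoc,
    Real.sqrt_mul (by positivity), Real.sqrt_mul_self hTpos.le] at h1
  calc _ ≤ 1 / (T : ℝ) * (T * √(∑ t ∈ Finset.Icc 1 T, ∑ j ∈ Finset.range T, x t j)) :=
        mul_le_mul_of_nonneg_left h1 (by positivity)
    _ = _ := by field_simp

variable {M : MDP S A} {F : Finset (S × A → ℝ)} {ν : Measure (S × A)}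

namespace MDP

/-- The total noise is at most `(8 * 72000 + 12) H T`. For `onErr` it is amplified by `1 / (1 - ρ) =
2 H`, which after square roots yields the factor `H √T`; the start adds `8 H ^ 2` per round before
the averaging, absorbed through `H ≤ √T`. For `offErr` the recursion telescopes without
amplification. -/
theorem sum_mean_sqrt_onErr_le_of_recursion {T : ℕ} (hT : 1 ≤ T) (hTH : M.horizon ^ 2 ≤ T)
    {pol : ℕ → Policy S A} {h : ℕ → ℕ → S × A → ℝ} {ξ : ℕ → ℕ → ℝ} (hξ : ∀ t j, 0 ≤ ξ t j)
    (hξsum : ∑ t ∈ Finset.Icc 1 T, ∑ j ∈ Finset.range T, ξ t j ≤ 72000 * M.horizon * T)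
    (h0 : ∀ t ∈ Finset.Icc 1 T, M.onErr (pol t) (h t 0) ≤ 4 * M.horizon ^ 2)
    (hrec : ∀ t ∈ Finset.Icc 1 T, ∀ j < T,
      M.offErr ν (pol t) (h t j) (h t (j + 1)) + M.onErr (pol t) (h t (j + 1))
        ≤ (1 + M.γ) / 2 * M.onErr (pol t) (h t j) + (8 * ξ t j + 12 * (1 / T) * M.horizon)) :
    ∑ t ∈ Finset.Icc 1 T, (1 / (T : ℝ)) *
        ∑ j ∈ Finset.range T, √(M.onErr (pol t) (h t (j + 1))) ≤ 1082 * M.horizon * √T ∧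
    ∑ t ∈ Finset.Icc 1 T, (1 / (T : ℝ)) *
        ∑ j ∈ Finset.range T, √(M.offErr ν (pol t) (h t j) (h t (j + 1)))
          ≤ 759 * M.horizon * √T := by
  have hTpos : (0 : ℝ) < T := by exact_mod_cast hT
  have hH := M.one_le_horizon
  have hHpos := M.horizon_pos
  have hγ0 := M.γ_pos
  have hγ1 := M.γ_lt_one
  have hHT : M.horizon ≤ √T := Real.le_sqrt_of_sq_le hTH
  have hsT : √(T : ℝ) ^ 2 = T := Real.sq_sqrt hTpos.le
  set n : ℕ → ℕ → ℝ := fun t j => 8 * ξ t j + 12 * (1 / T) * M.horizon with hn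
  have hn0 : ∀ t j, 0 ≤ n t j := fun t j => by
    have := hξ t j
    simp only [hn]
    positivity
  have hnsum : ∑ t ∈ Finset.Icc 1 T, ∑ j ∈ Finset.range T, n t j ≤ 576012 * M.horizon * T := by
    simp only [hn, Finset.sum_add_distrib, ← Finset.mul_sum, Finset.sum_const, Finset.card_range,
      Nat.card_Icc, Nat.add_sub_cancel, nsmul_eq_mul]
    have : (T : ℝ) * (T * (12 * (1 / T) * M.horizon)) = 12 * M.horizon * T := by field_simp
    linarith
  constructor
  · have h1 : ∀ t ∈ Finset.Icc 1 T, ∑ j ∈ Finset.range T, √(M.onErr (pol t) (h t (j + 1)))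
        ≤ √(T * (2 * M.horizon) * ∑ j ∈ Finset.range T, n t j) + 8 * M.horizon ^ 2 := fun t ht => by
      have h2 := sum_sqrt_le_of_recursion (β := fun j => M.onErr (pol t) (h t j)) (T := T)
        (n := n t) (ρ := (1 + M.γ) / 2) (B := 4 * M.horizon ^ 2) (hn0 t) (by linarith) (by linarith)
        (fun j hj => by
          have h3 := hrec t ht j hj
          have h4 := M.offErr_nonneg ν (pol t) (h t j) (h t (j + 1))
          simp only [hn]
          linarith) (h0 t ht) (by positivity)
      have h5 : (1 - (1 + M.γ) / 2) = 1 / (2 * M.horizon) := by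
        have := M.horizon_mul
        field_simp
        linarith
      have h6 : √(4 * M.horizon ^ 2) = 2 * M.horizon := by
        rw [show 4 * M.horizon ^ 2 = (2 * M.horizon) ^ 2 by ring, Real.sqrt_sq (by positivity)]
      rw [h5, h6, div_div_eq_mul_div, div_div_eq_mul_div, div_one, div_one] at h2
      refine h2.trans (le_of_eq ?_)
      congr 1
      · congr 1; ring
      · ring
    have h2 := Finset.sum_le_sum h1
    rw [Finset.sum_add_distrib, Finset.sum_const, Nat.card_Icc, Nat.add_sub_cancel,
      nsmul_eq_mul] at h2
    have h3 := sum_sqrt_le_sqrt_card_mul_sum (Finset.Icc 1 T)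
      (x := fun t => T * (2 * M.horizon) * ∑ j ∈ Finset.range T, n t j) fun t _ =>
        mul_nonneg (by positivity) (Finset.sum_nonneg fun j _ => hn0 t j)
    rw [Nat.card_Icc, Nat.add_sub_cancel, ← Finset.mul_sum] at h3
    -- Here `2 * 576012 ≤ 1074 ^ 2`; with the `8` from the start this gives `1082`.
    have h4 : √(T * (T * (2 * M.horizon) * ∑ t ∈ Finset.Icc 1 T, ∑ j ∈ Finset.range T, n t j))
        ≤ T * (1074 * M.horizon * √T) := by
      refine Real.sqrt_le_iff.2 ⟨by positivity, ?_⟩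
      rw [mul_pow, mul_pow, hsT]
      have := mul_le_mul_of_nonneg_left hnsum
        (show (0 : ℝ) ≤ T * (T * (2 * M.horizon)) by positivity)
      have h5 : (0 : ℝ) ≤ T * T * T * M.horizon ^ 2 := by positivity
      nlinarith
    rw [← Finset.mul_sum]
    calc _ ≤ 1 / (T : ℝ) * (T * (1074 * M.horizon * √T) + T * (8 * M.horizon ^ 2)) :=
          mul_le_mul_of_nonneg_left (by linarith) (by positivity)
      _ = 1074 * M.horizon * √T + 8 * M.horizon * M.horizon := by field_simp
      _ ≤ _ := by
          have := mul_le_mul_of_nonneg_left hHT (show 0 ≤ 8 * M.horizon by positivity)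
          linarith
  · refine (sum_mean_sqrt_le hT fun t j => M.offErr_nonneg ν _ _ _).trans ?_
    refine Real.sqrt_le_iff.2 ⟨by positivity, ?_⟩
    have h1 : ∀ t ∈ Finset.Icc 1 T, ∑ j ∈ Finset.range T,
        M.offErr ν (pol t) (h t j) (h t (j + 1)) ≤ 4 * M.horizon ^ 2 + ∑ j ∈ Finset.range T, n t j :=
      fun t ht => sum_le_of_recursion (β := fun j => M.onErr (pol t) (h t j))
        (ρ := (1 + M.γ) / 2) (fun j => M.onErr_nonneg _ _) (by linarith) (hrec t ht) (h0 t ht)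
    have h2 := Finset.sum_le_sum h1
    rw [Finset.sum_add_distrib, Finset.sum_const, Nat.card_Icc, Nat.add_sub_cancel,
      nsmul_eq_mul] at h2
    rw [mul_pow, mul_pow, hsT]
    nlinarith [mul_nonneg (mul_nonneg hHpos.le hTpos.le) (sub_nonneg.2 hH)]

theorem sum_mean_sqrt_onErr_le_of_le {T : ℕ} (hT : 1 ≤ T)
    {pol : ℕ → Policy S A} {h : ℕ → ℕ → S × A → ℝ} {ξ : ℕ → ℕ → ℝ}
    (hξsum : ∑ t ∈ Finset.Icc 1 T, ∑ j ∈ Finset.range T, ξ t j ≤ 72000 * M.horizon * T)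
    (hle : ∀ t ∈ Finset.Icc 1 T, ∀ j < T,
      M.onErr (pol t) (h t (j + 1)) ≤ 20 * M.horizon ^ 2 / T + 4 * ξ t j) :
    ∑ t ∈ Finset.Icc 1 T, (1 / (T : ℝ)) *
        ∑ j ∈ Finset.range T, √(M.onErr (pol t) (h t (j + 1))) ≤ 1082 * M.horizon * √T := by
  have hTpos : (0 : ℝ) < T := by exact_mod_cast hT
  have hH := M.one_le_horizon
  have hHpos := M.horizon_pos
  refine (sum_mean_sqrt_le hT fun t j => M.onErr_nonneg _ _).trans ?_
  refine Real.sqrt_le_iff.2 ⟨by positivity, ?_⟩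
  have h1 := Finset.sum_le_sum fun t ht => Finset.sum_le_sum fun j hj =>
    hle t ht j (Finset.mem_range.1 hj)
  simp only [Finset.sum_add_distrib, ← Finset.mul_sum, Finset.sum_const, Finset.card_range,
      Nat.card_Icc, Nat.add_sub_cancel, nsmul_eq_mul] at h1
  have h2 : (T : ℝ) * (T * (20 * M.horizon ^ 2 / T)) = 20 * M.horizon ^ 2 * T := by field_simp
  rw [mul_pow, mul_pow, Real.sq_sqrt hTpos.le]
  nlinarith [mul_nonneg (mul_nonneg hHpos.le hTpos.le) (sub_nonneg.2 hH)]

variable [Fintype A]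

/-- Every deviation exponent is `θ * m` times an error of empirical means, so dividing the logarithm
of the weight by `θ * m` gives a valid additive error. -/
theorem concentrated_log_stepWeight {moff mon : ℕ} {θ α : ℝ} {π : Policy S A} {g : S × A → ℝ}
    (hθ : 0 < θ) (hm : 0 < moff) (hmm : mon = moff) (D : Dataset S A moff mon) :
    M.Concentrated F ν α (Real.log (M.stepWeight F ν θ α π g D) / (θ * moff)) π g D := by
  subst hmm
  intro f hf σ hσ
  have hm' : (0 : ℝ) < mon := by exact_mod_cast hm
  have key : ∀ {s e W : ℝ}, θ * (σ * s - mon * ((σ + α) * e)) ≤ W →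
      σ * (1 / (mon : ℝ) * s) ≤ (σ + α) * e + W / (θ * mon) := fun {s e W} h => by
    have h1 : σ * (1 / (mon : ℝ) * s) - (σ + α) * e
        = θ * (σ * s - mon * ((σ + α) * e)) / (θ * mon) := by field_simp
    have h2 := div_le_div_of_nonneg_right h (mul_pos hθ hm').le
    linarith
  exact ⟨key (offDev_le_log_stepWeight hσ hf D), key (onDev_le_log_stepWeight hσ hf D)⟩

/-- An infinite coefficient makes the bound infinite, as `T` and `c` are positive. Only finite
coefficients need an estimate, and that one can be done in real numbers. -/
theorem ofReal_le_bound {c x : ℝ} {T : ℕ} {C : ℝ≥0∞} (hc : 0 < c) (hT : 1 ≤ T)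
    (hx : C ≠ ⊤ → x ≤ c * (M.horizon ^ 2 * √(Real.log (Fintype.card A) * T)
      + M.horizon ^ 2 * √(C.toReal * T))) :
    ENNReal.ofReal x ≤ M.bound c T C := by
  have hHpos := M.horizon_pos
  have hsq : 1 / (1 - M.γ) ^ 2 = M.horizon ^ 2 := by rw [horizon, div_pow, one_pow]
  unfold bound
  rw [hsq]
  by_cases hC : C = ⊤
  · have hT0 : (T : ℝ≥0∞) ≠ 0 := by exact_mod_cast (by omega : T ≠ 0)
    rw [hC, ENNReal.top_mul hT0, ENNReal.top_rpow_of_pos (by norm_num),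
      ENNReal.mul_top (ENNReal.ofReal_pos.2 (by positivity)).ne', add_top,
      ENNReal.mul_top (ENNReal.ofReal_pos.2 hc).ne']
    exact le_top
  · have h1 : (C * (T : ℝ≥0∞)) ^ (1 / 2 : ℝ) = ENNReal.ofReal √(C.toReal * T) := by
      rw [Real.sqrt_eq_rpow, ← ENNReal.ofReal_rpow_of_nonneg (by positivity) (by norm_num),
        ENNReal.ofReal_mul ENNReal.toReal_nonneg, ENNReal.ofReal_toReal hC, ENNReal.ofReal_natCast]
    rw [h1, ← ENNReal.ofReal_mul (by positivity), ← ENNReal.ofReal_add (by positivity)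
      (by positivity), ← ENNReal.ofReal_mul hc.le]
    exact ENNReal.ofReal_le_ofReal (hx hC)

/-- Each round loses at most `H`. The total `T H` is below the claimed bound once `T ≤ 5000 ^ 2 * H
^ 2 * log |A|`, which each of the three cases implies because `log |A| ≥ 1 / 4` and `H ≥ 1`. -/
theorem sum_V_sub_le_of_small {T : ℕ} (pol : ℕ → Policy S A) (hT : 1 ≤ T)
    (hA : 2 ≤ Fintype.card A)
    (hsmall : (T : ℝ) < M.horizon ^ 2 ∨ (T : ℝ) < Real.log (Fintype.card A) ∨ T < 4)
    (πe : Policy S A) :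
    ∑ t ∈ Finset.Icc 1 T, (M.V πe - M.V (pol t))
      ≤ 5000 * (M.horizon ^ 2 * √(Real.log (Fintype.card A) * T)) := by
  have hTpos : (0 : ℝ) < T := by exact_mod_cast hT
  have hH := M.one_le_horizon
  have hHpos := M.horizon_pos
  have hL : 1 / 4 ≤ Real.log (Fintype.card A) := by
    have h1 := Real.log_two_gt_d9
    have h2 := Real.log_le_log (by norm_num) (show (2 : ℝ) ≤ Fintype.card A by exact_mod_cast hA)
    linarith
  have h1 : ∑ t ∈ Finset.Icc 1 T, (M.V πe - M.V (pol t)) ≤ T * M.horizon := by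
    refine (Finset.sum_le_card_nsmul _ _ M.horizon fun t _ => ?_).trans (by simp)
    linarith [M.V_nonneg (pol t), M.V_le_horizon πe]
  have h2 : (T : ℝ) ≤ 5000 * M.horizon * √(Real.log (Fintype.card A) * T) := by
    rw [← Real.sqrt_sq (show 0 ≤ 5000 * M.horizon by positivity), ← Real.sqrt_mul (by positivity)]
    refine Real.le_sqrt_of_sq_le ?_
    have hH2 : 1 ≤ M.horizon ^ 2 := one_le_pow₀ hH
    have hmain : (T : ℝ) ≤ 5000 ^ 2 * (M.horizon ^ 2 * Real.log (Fintype.card A)) := by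
      rcases hsmall with h | h | h
      · nlinarith
      · nlinarith
      · have : (T : ℝ) < 4 := by exact_mod_cast h
        nlinarith
    nlinarith
  calc _ ≤ M.horizon * T := by linarith
    _ ≤ M.horizon * (5000 * M.horizon * √(Real.log (Fintype.card A) * T)) :=
        mul_le_mul_of_nonneg_left h2 hHpos.le
    _ = _ := by ring

variable [MeasurableSingletonClass A]

/-- The regret bound when the residuals are small enough for the coverage coefficient. -/
theorem sum_V_sub_le_of_Cnpg {T : ℕ} {pol : ℕ → Policy S A} {h : ℕ → ℕ → S × A → ℝ}
    (hT : 1 ≤ T) (hA : 2 ≤ Fintype.card A) (hsT : √(T : ℝ) ≤ 2 * √(Real.log (Fintype.card A) * T))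
    (hTA : Real.log (Fintype.card A) ≤ T) (hup : M.IsSoftmaxUpdate T pol h)
    (hF : ∀ f ∈ F, Measurable f ∧ ∀ x, |f x| ≤ M.horizon)
    (hmem : ∀ t ∈ Finset.Icc 1 T, ∀ j ≤ T, h t j ∈ F)
    (hB : ∑ t ∈ Finset.Icc 1 T, (1 / (T : ℝ)) *
      ∑ j ∈ Finset.range T, √(M.onErr (pol t) (h t (j + 1))) ≤ 1082 * M.horizon * √T)
    (πe : Policy S A) (hfin : M.Cnpg πe ≠ ⊤) :
    ∑ t ∈ Finset.Icc 1 T, (M.V πe - M.V (pol t)) ≤ 5000 * (M.horizon ^ 2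
      * √(Real.log (Fintype.card A) * T) + M.horizon ^ 2 * √((M.Cnpg πe).toReal * T)) := by
  have h1 := sum_V_sub_le_Cnpg hT hA hTA hup (fun t ht j hj => (hF _ (hmem t ht j hj)).1)
    (fun t ht j hj => (hF _ (hmem t ht j hj)).2) hB πe hfin
  refine h1.trans ?_
  rw [Real.sqrt_mul ENNReal.toReal_nonneg (T : ℝ)]
  have h2 : 0 ≤ M.horizon ^ 2 * (√(M.Cnpg πe).toReal * √T) := by positivity
  have h3 := mul_le_mul_of_nonneg_left hsT (sq_nonneg M.horizon)
  have h4 : 0 ≤ M.horizon ^ 2 * √(Real.log (Fintype.card A) * T) := by positivity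
  -- The coefficient part has constant `2 * 1082`. The part without coefficient uses `√T ≤ 2 √(T log
  -- |A|)` and has constant `4 * 1082 + 2`. Both are below `5000`.
  nlinarith

/-- The regret bound when the residuals are small enough for the transfer coefficient. -/
theorem sum_V_sub_le_of_Coff {T : ℕ} {pol : ℕ → Policy S A} {h : ℕ → ℕ → S × A → ℝ}
    (hT : 1 ≤ T) (hA : 2 ≤ Fintype.card A) (hsT : √(T : ℝ) ≤ 2 * √(Real.log (Fintype.card A) * T))
    (hTA : Real.log (Fintype.card A) ≤ T) (hup : M.IsSoftmaxUpdate T pol h)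
    (hF : ∀ f ∈ F, Measurable f ∧ ∀ x, |f x| ≤ M.horizon)
    (hmem : ∀ t ∈ Finset.Icc 1 T, ∀ j ≤ T, h t j ∈ F)
    (hB : ∑ t ∈ Finset.Icc 1 T, (1 / (T : ℝ)) *
      ∑ j ∈ Finset.range T, √(M.onErr (pol t) (h t (j + 1))) ≤ 1082 * M.horizon * √T)
    (hB' : ∑ t ∈ Finset.Icc 1 T, (1 / (T : ℝ)) *
      ∑ j ∈ Finset.range T, √(M.offErr ν (pol t) (h t j) (h t (j + 1))) ≤ 759 * M.horizon * √T)
    (πe : Policy S A) (hfin : M.Coff F ν πe ≠ ⊤) :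
    ∑ t ∈ Finset.Icc 1 T, (M.V πe - M.V (pol t)) ≤ 5000 * (M.horizon ^ 2
      * √(Real.log (Fintype.card A) * T)
        + M.horizon ^ 2 * √((M.Coff F ν πe ^ 2).toReal * T)) := by
  have h1 := sum_V_sub_le_Coff hT hA hTA hup hF hmem hB hB' πe hfin
  refine h1.trans ?_
  rw [ENNReal.toReal_pow, Real.sqrt_mul (sq_nonneg (M.Coff F ν πe).toReal) (T : ℝ), Real.sqrt_sq ENNReal.toReal_nonneg]
  have h2 : 0 ≤ M.horizon ^ 2 * ((M.Coff F ν πe).toReal * √T) := by positivity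
  have h3 := mul_le_mul_of_nonneg_left hsT (sq_nonneg M.horizon)
  have h4 : 0 ≤ M.horizon ^ 2 * √(Real.log (Fintype.card A) * T) := by positivity
  have h5 : (1 : ℝ) ≤ √T := Real.one_le_sqrt.2 (by exact_mod_cast hT)
  have h6 := mul_le_mul_of_nonneg_left h5 (sq_nonneg M.horizon)
  nlinarith

/-- With one action `log |A| = 0`, so the bound loses its regret term; but there is only one policy
and the suboptimality is zero. -/
theorem policy_eq_of_card_le_one (hA : Fintype.card A < 2) (π π' : Policy S A) : π = π' := by
  have hsub : Subsingleton A := Fintype.card_le_one_iff_subsingleton.1 (by omega)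
  refine Policy.ext_prob fun s a => ?_
  have h : ∀ π : Policy S A, π.prob s a = 1 := fun π => by
    have := π.sum_prob s
    rwa [Fintype.sum_subsingleton _ a] at this
  rw [h, h]

end MDP

variable [Fintype A]

namespace HACRun

variable {T : ℕ} {δ lam : ℝ} {Ω : Type w} [MeasurableSpace Ω] {P : Measure Ω}
  (R : HACRun M F ν (stdParams M F T δ lam) P)

/-- The last `T + 1` iterates of a round. -/
def late (ω : Ω) (t j : ℕ) : S × A → ℝ := R.iter t ((stdParams M F T δ lam).K1 + j) ω

theorem isSoftmaxUpdate (ω : Ω) : M.IsSoftmaxUpdate T (fun t => R.policy t ω) (R.late ω) := by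
  refine ⟨R.policy_one ω, fun t ht s a => ?_⟩
  have hcr : ∀ x, (1 / (((stdParams M F T δ lam).K2 : ℝ) - (stdParams M F T δ lam).K1)) *
      ∑ k ∈ Finset.Icc ((stdParams M F T δ lam).K1 + 1) (stdParams M F T δ lam).K2, R.iter t k ω x
      = critic T (R.late ω t) x := fun x => by
    have h1 : ((stdParams M F T δ lam).K2 : ℝ) - (stdParams M F T δ lam).K1 = T := by
      simp [stdParams]
    rw [h1]
    unfold critic late
    congr 1
    exact sum_Icc_eq_sum_range (fun k => R.iter t k ω x) (stdParams M F T δ lam).K1 T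
  have h := R.policy_succ t ht ω s a
  simp only [hcr] at h
  exact h

theorem late_mem (ω : Ω) : ∀ t ∈ Finset.Icc 1 T, ∀ j ≤ T, R.late ω t j ∈ F := fun t ht _ hj =>
  R.iter_mem t ht _ (Finset.mem_Icc.2 ⟨Nat.zero_le _, Nat.add_le_add_left hj _⟩) ω

theorem late_argmin (ω : Ω) : ∀ t ∈ Finset.Icc 1 T, ∀ j < T, ∀ f ∈ F,
    M.hpeLoss lam (R.policy t ω) (R.data t ((stdParams M F T δ lam).K1 + (j + 1)) ω)
        (R.late ω t j) (R.late ω t (j + 1))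
      ≤ M.hpeLoss lam (R.policy t ω) (R.data t ((stdParams M F T δ lam).K1 + (j + 1)) ω)
        (R.late ω t j) f := fun t ht j hj =>
  R.iter_argmin t ht ((stdParams M F T δ lam).K1 + (j + 1))
    (Finset.mem_Icc.2 ⟨by omega, Nat.add_le_add_left hj _⟩) ω

variable [MeasurableSingletonClass A]

theorem subopt_le_bound_of_small [Nonempty A] (hT : 1 ≤ T) (ω : Ω)
    (hsmall : ¬ (2 ≤ Fintype.card A ∧ M.horizon ^ 2 ≤ T ∧ Real.log (Fintype.card A) ≤ T ∧ 4 ≤ T))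
    (C : ℝ≥0∞) (πe : Policy S A) :
    ENNReal.ofReal (R.subopt πe ω) ≤ M.bound 5000 T C := by
  refine MDP.ofReal_le_bound (by norm_num) hT fun _ => ?_
  have h0 : 0 ≤ M.horizon ^ 2 * √(C.toReal * T) := by positivity
  change ∑ t ∈ Finset.Icc 1 T, (M.V πe - M.V (R.policy t ω)) ≤ _
  by_cases hA : 2 ≤ Fintype.card A
  · have h1 : (T : ℝ) < M.horizon ^ 2 ∨ (T : ℝ) < Real.log (Fintype.card A) ∨ T < 4 := by
      by_contra! h
      exact hsmall ⟨hA, h⟩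
    have h2 := M.sum_V_sub_le_of_small (fun t => R.policy t ω) hT hA h1 πe
    linarith
  · rw [Finset.sum_eq_zero fun t _ => by
      rw [MDP.policy_eq_of_card_le_one (not_le.1 hA) πe (R.policy t ω), sub_self]]
    positivity

variable [IsProbabilityMeasure ν] [IsProbabilityMeasure P]

/-- With probability at least `1 - δ`, all excess losses in all rounds concentrate, with additive
errors that are small on average. -/
theorem exists_concentrated_event (hT : 1 ≤ T) (hδ : 0 < δ) (hδ1 : δ < 1)
    (hF : ∀ f ∈ F, Measurable f ∧ ∀ x, |f x| ≤ M.horizon) :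
    ∃ G : Set Ω, ENNReal.ofReal (1 - δ) ≤ P G ∧ ∀ ω ∈ G, ∃ ξ : ℕ → ℕ → ℝ, (∀ t j, 0 ≤ ξ t j) ∧
      ∑ t ∈ Finset.Icc 1 T, ∑ j ∈ Finset.range T, ξ t j ≤ 72000 * M.horizon * T ∧
      ∀ t j, M.Concentrated F ν ((1 - M.γ) / 8) (ξ t j) (R.policy t ω) (R.late ω t j)
        (R.data t ((stdParams M F T δ lam).K1 + (j + 1)) ω) := by
  have hTpos : (1 : ℝ) ≤ T := by exact_mod_cast hT
  have hH := M.one_le_horizon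
  have hHpos := M.horizon_pos
  have hγ := M.one_sub_pos
  have hγ0 := M.γ_pos
  have hmulH := M.horizon_mul
  set α := (1 - M.γ) / 8 with hα
  have hαpos : 0 < α := by positivity
  -- The largest exponent scale that the moment bounds allow for the relative error `α`.
  set θ := α / (6000 * M.horizon ^ 2) with hθ
  have hθpos : 0 < θ := by positivity
  obtain ⟨G, -, hPG, hG⟩ := R.exists_concentration_event (θ := θ) (α := α) (δ := δ) hT rfl hF hδ
    hθpos.le hαpos.le (by linarith) (le_of_eq (by rw [hθ]; field_simp))
  have hΩ : Nonempty Ω := nonempty_of_isProbabilityMeasure P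
  have hcard : (1 : ℝ) ≤ F.card := by
    obtain ⟨ω⟩ := hΩ
    have := R.late_mem ω 1 (Finset.mem_Icc.2 ⟨le_rfl, hT⟩) 0 (Nat.zero_le _)
    exact_mod_cast Finset.card_pos.2 ⟨_, this⟩
  set m := (stdParams M F T δ lam).moff with hm
  set ℓ := Real.log (2 * F.card / δ) with hℓ
  have hℓsub : ℓ = Real.log (2 * F.card) + Real.log (1 / δ) := by
    rw [hℓ, ← Real.log_mul (by positivity) (by positivity), mul_one_div]
  have hlog2 : 0 < Real.log (2 * F.card) := Real.log_pos (by linarith)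
  have hlogδ : 0 ≤ Real.log (1 / δ) := Real.log_nonneg (by rw [le_div_iff₀ hδ]; linarith)
  have hℓpos : 0 < ℓ := by linarith
  have hmge : 2 * T * ℓ * M.horizon ^ 2 ≤ m := by
    refine le_trans (le_of_eq ?_) (Nat.le_ceil _)
    rw [MDP.horizon]
    field_simp
    exact hℓ
  have hmpos : (0 : ℝ) < m := lt_of_lt_of_le (by positivity) hmge
  have hmpos' : 0 < m := by exact_mod_cast hmpos
  refine ⟨G, hPG, fun ω hω => ⟨fun t j =>
    Real.log (R.weight θ α t ((stdParams M F T δ lam).K1 + (j + 1)) ω) / (θ * m),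
    fun t j => div_nonneg (Real.log_nonneg (MDP.one_le_stepWeight _)) (by positivity), ?_,
    fun t j => MDP.concentrated_log_stepWeight hθpos hmpos' rfl _⟩⟩
  have h1 := hG ω hω
  -- For `n ≥ 1`, `1 + 4 n ≤ (2 n) ^ 3`.
  have h2 : Real.log (1 + 4 * F.card) ≤ 3 * Real.log (2 * F.card) := by
    rw [← Real.log_rpow (by positivity)]
    refine Real.log_le_log (by positivity) ?_
    norm_cast
    have : 1 ≤ F.card := by exact_mod_cast hcard
    nlinarith [Nat.mul_le_mul this this, Nat.mul_le_mul (Nat.mul_le_mul this this) this]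
  have h3 : ∑ t ∈ Finset.Icc 1 T, ∑ j ∈ Finset.range T,
      Real.log (R.weight θ α t ((stdParams M F T δ lam).K1 + (j + 1)) ω) ≤ 3 * T ^ 2 * ℓ := by
    have h4 : ∀ t, ∑ j ∈ Finset.range T,
        Real.log (R.weight θ α t ((stdParams M F T δ lam).K1 + (j + 1)) ω)
        = ∑ k ∈ Finset.Icc ((stdParams M F T δ lam).K1 + 1) (stdParams M F T δ lam).K2,
          Real.log (R.weight θ α t k ω) := fun t =>
      (sum_Icc_eq_sum_range (fun k => Real.log (R.weight θ α t k ω)) _ T).symm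
    simp only [h4]
    refine h1.trans ?_
    change (T : ℝ) * T * Real.log (1 + 4 * F.card) + Real.log (1 / δ) ≤ _
    have h5 : (1 : ℝ) ≤ T * T := by nlinarith
    rw [hℓsub]
    nlinarith [mul_le_mul_of_nonneg_left h2 (show (0 : ℝ) ≤ T * T by positivity)]
  simp only [← Finset.sum_div]
  rw [div_le_iff₀ (by positivity)]
  refine h3.trans ?_
  -- The constant is `3 * 6000 * 8 / 2`: the `3` bounds the total logarithmic weight, `6000` and `8`
  -- come from `θ` and `α`, and `2` from the sample size. The factor `H ^ 2` in the sample size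
  -- cancels the one in `θ`.
  have h6 : 72000 * M.horizon * T * (θ * (2 * T * ℓ * M.horizon ^ 2))
      = 3 * T ^ 2 * ℓ * (M.horizon * (1 - M.γ)) := by
    rw [hθ, hα]
    field_simp
    ring
  rw [hmulH, mul_one] at h6
  rw [← h6]
  gcongr

/-- The frame of both claims. Outside the main regime the bound holds surely; inside it, the rest is
deterministic on the concentration event. That event does not depend on the comparator, so all
comparators are covered simultaneously. -/
theorem prob_forall_subopt_le [Nonempty A] (hT : 1 ≤ T) (hδ : 0 < δ) (hδ1 : δ < 1)
    (hF : ∀ f ∈ F, Measurable f ∧ ∀ x, |f x| ≤ M.horizon) (C : Policy S A → ℝ≥0∞)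
    (h : 2 ≤ Fintype.card A → √(T : ℝ) ≤ 2 * √(Real.log (Fintype.card A) * T) →
      M.horizon ^ 2 ≤ T → Real.log (Fintype.card A) ≤ T → 4 ≤ T →
      ∀ ω, ∀ ξ : ℕ → ℕ → ℝ, (∀ t j, 0 ≤ ξ t j) →
      ∑ t ∈ Finset.Icc 1 T, ∑ j ∈ Finset.range T, ξ t j ≤ 72000 * M.horizon * T →
      (∀ t j, M.Concentrated F ν ((1 - M.γ) / 8) (ξ t j) (R.policy t ω) (R.late ω t j)
        (R.data t ((stdParams M F T δ lam).K1 + (j + 1)) ω)) →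
      ∀ πe, C πe ≠ ⊤ → R.subopt πe ω ≤ 5000 * (M.horizon ^ 2 * √(Real.log (Fintype.card A) * T)
        + M.horizon ^ 2 * √((C πe).toReal * T))) :
    ENNReal.ofReal (1 - δ) ≤
      P {ω | ∀ πe, ENNReal.ofReal (R.subopt πe ω) ≤ M.bound 5000 T (C πe)} := by
  by_cases hreg : 2 ≤ Fintype.card A ∧ M.horizon ^ 2 ≤ T ∧ Real.log (Fintype.card A) ≤ T ∧ 4 ≤ T
  · obtain ⟨hA, hTH, hTA, hT4⟩ := hreg
    have hsT : √(T : ℝ) ≤ 2 * √(Real.log (Fintype.card A) * T) := by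
      have h1 := Real.log_two_gt_d9
      have h2 := Real.log_le_log (by norm_num) (show (2 : ℝ) ≤ Fintype.card A by exact_mod_cast hA)
      have h3 : (0 : ℝ) ≤ T := Nat.cast_nonneg T
      rw [← Real.sqrt_sq (show (0 : ℝ) ≤ 2 by norm_num), ← Real.sqrt_mul (by norm_num)]
      exact Real.sqrt_le_sqrt (by nlinarith)
    obtain ⟨G, hPG, hG⟩ := R.exists_concentrated_event hT hδ hδ1 hF
    refine hPG.trans (measure_mono fun ω hω πe => ?_)
    obtain ⟨ξ, hξ, hξsum, hconc⟩ := hG ω hω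
    exact MDP.ofReal_le_bound (by norm_num) hT
      (h hA hsT hTH hTA hT4 ω ξ hξ hξsum hconc πe)
  · have huniv : {ω | ∀ πe, ENNReal.ofReal (R.subopt πe ω) ≤ M.bound 5000 T (C πe)} = Set.univ :=
      Set.eq_univ_of_forall fun ω πe => R.subopt_le_bound_of_small hT ω hreg (C πe) πe
    rw [huniv, measure_univ]
    exact ENNReal.ofReal_le_one.2 (by linarith)

theorem prob_subopt_le_of_inherentBellmanError [Nonempty A]
    (R : HACRun M F ν (stdParams M F T δ 1) P) (hT : 1 ≤ T) (hδ : 0 < δ) (hδ1 : δ < 1)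
    (hF : ∀ f ∈ F, Measurable f ∧ ∀ x, |f x| ≤ M.horizon) {ε : ℝ} (hε : ε ≤ 1 / T)
    (hbe : M.HasInherentBellmanError F ε) :
    ENNReal.ofReal (1 - δ) ≤ P {ω | ∀ πe, ENNReal.ofReal (R.subopt πe ω)
      ≤ M.bound 5000 T (min (M.Cnpg πe) (M.Coff F ν πe ^ 2))} := by
  refine R.prob_forall_subopt_le hT hδ hδ1 hF _
    fun hA hsT hTH hTA hT4 ω ξ hξ hξsum hconc πe hfin => ?_
  have hTpos : (1 : ℝ) ≤ T := by exact_mod_cast hT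
  obtain ⟨hB, hB'⟩ := MDP.sum_mean_sqrt_onErr_le_of_recursion (ν := ν) (h := R.late ω)
    (pol := fun t => R.policy t ω) hT hTH hξ hξsum
    (fun t ht => by
      have h0 := hF _ (R.late_mem ω t ht 0 (Nat.zero_le _))
      exact M.onErr_le (R.policy t ω) h0.2)
    fun t ht j hj => by
      obtain ⟨f', hf', happ⟩ := hbe _ (R.late_mem ω t ht j hj.le) (R.policy t ω)
      exact MDP.offErr_add_onErr_le hF (R.late_mem ω t ht j hj.le) (R.late_mem ω t ht (j + 1) hj)
        hf' (hξ t j) (by positivity) (by rw [div_le_one (by linarith)]; exact hTpos)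
        (fun x => (happ x).trans hε) (hconc t j) (R.late_argmin ω t ht j hj f' hf')
  change ∑ t ∈ Finset.Icc 1 T, (M.V πe - M.V (R.policy t ω)) ≤ _
  -- On the same event both error sums are small, so whichever coefficient is smaller for the given
  -- comparator may be used.
  rcases le_total (M.Cnpg πe) (M.Coff F ν πe ^ 2) with hle | hle
  · rw [min_eq_left hle] at hfin ⊢
    exact MDP.sum_V_sub_le_of_Cnpg hT hA hsT hTA (R.isSoftmaxUpdate ω) hF (R.late_mem ω) hB πe hfin
  · rw [min_eq_right hle] at hfin ⊢
    exact MDP.sum_V_sub_le_of_Coff hT hA hsT hTA (R.isSoftmaxUpdate ω) hF (R.late_mem ω) hB hB' πe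
      fun htop => hfin (by rw [htop, ENNReal.top_pow two_ne_zero])

theorem prob_subopt_le_of_realizable [Nonempty A]
    (R : HACRun M F ν (stdParams M F T δ (T / 2 - 1)) P) (hT : 1 ≤ T) (hδ : 0 < δ) (hδ1 : δ < 1)
    (hF : ∀ f ∈ F, Measurable f ∧ ∀ x, |f x| ≤ M.horizon)
    (hreal : ∀ t ∈ Finset.Icc 1 T, ∀ ω, ∃ f ∈ F, M.onErr (R.policy t ω) f = 0) :
    ENNReal.ofReal (1 - δ) ≤ P {ω | ∀ πe, ENNReal.ofReal (R.subopt πe ω)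
      ≤ M.bound 5000 T (M.Cnpg πe)} := by
  refine R.prob_forall_subopt_le hT hδ hδ1 hF _
    fun hA hsT hTH hTA hT4 ω ξ hξ hξsum hconc πe hfin => ?_
  refine MDP.sum_V_sub_le_of_Cnpg hT hA hsT hTA (R.isSoftmaxUpdate ω) hF (R.late_mem ω)
    (MDP.sum_mean_sqrt_onErr_le_of_le hT hξsum fun t ht j hj => ?_) πe hfin
  obtain ⟨f', hf', h0⟩ := hreal t ht ω
  exact MDP.onErr_le_of_realizable hT4 rfl hF (R.late_mem ω t ht j hj.le)
    (R.late_mem ω t ht (j + 1) hj) hf' (hξ t j) h0 (hconc t j) (R.late_argmin ω t ht j hj f' hf')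

end HACRun

end

end

end HybridRL

theorem mainTheorem1 :
    ∃ c : ℝ, 0 < c ∧
      ∀ (S : Type*) (A : Type*) [MeasurableSpace S] [MeasurableSpace A] [Fintype A]
        [MeasurableSingletonClass A] (M : HybridRL.MDP S A)
        (F : Finset (S × A → ℝ)) (ν : Measure (S × A)) [IsProbabilityMeasure ν]
        (T : ℕ) (δ lam : ℝ) (Ω : Type*) [MeasurableSpace Ω] (P : Measure Ω)
        [IsProbabilityMeasure P]
        (R : HybridRL.HACRun M F ν (HybridRL.stdParams M F T δ lam) P)
        (Pi : Set (HybridRL.Policy S A)),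
        1 ≤ T → 0 < δ → δ < 1 →
        (∀ f ∈ F, Measurable f ∧ ∀ x, |f x| ≤ 1 / (1 - M.γ)) →
        (∀ t ∈ Finset.Icc 1 T, ∀ ω, R.policy t ω ∈ Pi) →
        M.Realizable F Pi →
        (∀ ε : ℝ, ε ≤ 1 / T → M.HasInherentBellmanError F ε → lam = 1 →
          ENNReal.ofReal (1 - δ) ≤
            P {ω | ∀ πe : HybridRL.Policy S A,
              ENNReal.ofReal (R.subopt πe ω) ≤
                M.bound c T (min (M.Cnpg πe) (M.Coff F ν πe ^ 2))}) ∧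
        (lam = T / 2 - 1 →
          ENNReal.ofReal (1 - δ) ≤
            P {ω | ∀ πe : HybridRL.Policy S A,
              ENNReal.ofReal (R.subopt πe ω) ≤ M.bound c T (M.Cnpg πe)}) := by
  refine ⟨5000, by norm_num, fun S A _ _ _ _ M F ν _ T δ lam Ω _ P _ R Pi hT hδ hδ1 hF hPi hreal =>
    ⟨?_, ?_⟩⟩
  all_goals
    -- The reset distribution is a probability measure on `S × A`, so there is at least one action.
    have hne : Nonempty A := (nonempty_of_isProbabilityMeasure M.reset).map Prod.snd
  · rintro ε hε hbe rfl
    exact R.prob_subopt_le_of_inherentBellmanError hT hδ hδ1 hF hε hbe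
  · rintro rfl
    exact R.prob_subopt_le_of_realizable hT hδ hδ1 hF fun t ht ω => hreal _ (hPi t ht ω)
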